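/- Let $\ell\ge 2$, let $V$ be an $\ell$-dimensional Euclidean space with orthonormal coordinates $x_1,\dots,x_\ell$, and let $W$ be a finite group of orthogonal transformations of $V$ that is generated by orthogonal reflections and acts irreducibly on $V$. Let $S=\mathbf R[x_1,\dots,x_\ell]$ be the algebra of polynomial functions on $V$, $F$ its field of fractions, $R=S^W$ the ring of invariants, and $\mathcal A$ the set of reflecting hyperplanes of $W$. For each $H\in\mathcal A$ choose a linear form $\alpha_H$ with kernel $H$, and put $Q=\prod_{H\in\mathcal A}\alpha_H$. Write $\partial_i=\partial/\partial x_i$. Let $\Omega^p=\bigoplus_{i_1<\dots<i_p}S\,dx_{i_1}\wedge\dots\wedge dx_{i_p}$ be the $S$-module of polynomial $p$-forms, let $d$ be exterior differentiation (extended to forms with coefficients in $F$), and let $$\Omega^p(\mathcal A)=\Bigl\{\tfrac{\eta}{Q}\ \Big|\ \eta\in\Omega^p,\ d\bigl(\tfrac{\eta}{Q}\bigr)\in\tfrac1Q\,\Omega^{p+1}\Bigr\}$$ be the module of logarithmic $p$-forms with poles along $\mathcal A$. A system of basic invariants is a family of $\ell$ algebraically independent homogeneous polynomials that generate $R$ as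 an $\mathbf R$-algebra. Let $D$ be a Saito derivation, that is, an $\mathbf R$-derivation of $F$ such that, for some system of basic invariants $g_1,\dots,g_\ell$ with $\deg g_i\le\deg g_\ell$ for all $i$, one has $Dg_\ell=1$ and $Dg_i=0$ for $i<\ell$. Define $\hat d$ on $S$ by $$\hat d f=\sum_{i=1}^{\ell}(\partial_i f)\,d\bigl(Q\,(Dx_i)\bigr).$$ Let $f_1,\dots,f_\ell$ be any system of basic invariants. Then for every $0\le p\le\ell$, $$\Omega^p(\mathcal A)=\bigoplus_{1\le i_1<\dots<i_p\le\ell}S\,Q^{-p}\bigl(\hat d f_{i_1}\wedge\dots\wedge\hat d f_{i_p}\bigr),$$ that is, $\Omega^p(\mathcal A)$ is a free $S$-module with basis the forms $Q^{-p}(\hat d f_{i_1}\wedge\dots\wedge\hat d f_{i_p})$, $1\le i_1<\dots<i_p\le\ell$. -/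

import Mathlib

namespace CoxeterLog

open MvPolynomial

/-- The Euclidean space `V` of dimension `l`, with its orthonormal coordinates. -/
abbrev V (l : ℕ) : Type := EuclideanSpace ℝ (Fin l)

/-- The algebra `S` of polynomial functions on `V`, as polynomials in the coordinates. -/
abbrev S (l : ℕ) : Type := MvPolynomial (Fin l) ℝ

/-- The field of rational functions on `V`. -/
abbrev K (l : ℕ) : Type := FractionRing (S l)

/-! ### Coxeter groups, arrangements, invariants -/

/-- The orthogonal reflection in the hyperplane orthogonal to `v`. -/
noncomputable def refl {l : ℕ} (v : V l) : V l ≃ₗᵢ[ℝ] V l :=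
  ((Submodule.span ℝ {v})ᗮ).reflection

/-- A Coxeter group in the sense of Euclidean geometry: a finite group of orthogonal
transformations, generated by orthogonal reflections, acting irreducibly on `V`. -/
structure IsFiniteCoxeterGroup {l : ℕ} (W : Subgroup (V l ≃ₗᵢ[ℝ] V l)) : Prop where
  finite : Finite W
  generated : Subgroup.closure {r | r ∈ W ∧ ∃ v : V l, v ≠ 0 ∧ r = refl v} = W
  nontrivial : Nontrivial (V l)
  irreducible : ∀ U : Submodule ℝ (V l), (∀ w ∈ W, ∀ u ∈ U, w u ∈ U) → U = ⊥ ∨ U = ⊤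

/-- The set of reflecting hyperplanes of `W`. -/
def arrangement {l : ℕ} (W : Subgroup (V l ≃ₗᵢ[ℝ] V l)) : Set (Submodule ℝ (V l)) :=
  {H | ∃ v : V l, v ≠ 0 ∧ H = (Submodule.span ℝ {v})ᗮ ∧ refl v ∈ W}

/-- The reflecting hyperplanes of a finite group are finite in number, so that the product
defining the polynomial `Q` below is a genuine finite product. -/
theorem arrangement_finite {l : ℕ} (W : Subgroup (V l ≃ₗᵢ[ℝ] V l)) [Finite W] :
    (arrangement W).Finite := by
  have hW : (W : Set (V l ≃ₗᵢ[ℝ] V l)).Finite := Set.toFinite _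
  refine Set.Finite.of_finite_image (f := fun H : Submodule ℝ (V l) => H.reflection)
    (hW.subset ?_) ?_
  · rintro _ ⟨H, ⟨v, -, rfl, hv⟩, rfl⟩
    exact hv
  · intro H _ H' _ h
    ext x
    rw [← Submodule.reflection_eq_self_iff, ← Submodule.reflection_eq_self_iff]
    exact Iff.of_eq (congrArg (fun r : V l ≃ₗᵢ[ℝ] V l => r x = x) h)

/-- A linear form on `V`, as a homogeneous linear polynomial. -/
noncomputable def linearPoly {l : ℕ} (φ : Module.Dual ℝ (V l)) : S l :=
  ∑ i, C (φ (EuclideanSpace.single i 1)) * X i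

/-- The defining polynomial `Q`, the product of the linear forms `α H` over all reflecting
hyperplanes `H` of `W`. -/
noncomputable def Q {l : ℕ} (W : Subgroup (V l ≃ₗᵢ[ℝ] V l))
    (α : Submodule ℝ (V l) → Module.Dual ℝ (V l)) : S l :=
  ∏ᶠ H ∈ arrangement W, linearPoly (α H)

/-- The invariant ring `R`: the polynomial functions `f` with `f (w v) = f v` for all `w ∈ W`
and all `v`. -/
noncomputable def invariants {l : ℕ} (W : Subgroup (V l ≃ₗᵢ[ℝ] V l)) : Subalgebra ℝ (S l) where
  carrier := {f | ∀ w ∈ W, ∀ v : V l, eval (w v).ofLp f = eval v.ofLp f}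
  mul_mem' ha hb w hw v := by rw [map_mul, map_mul, ha w hw v, hb w hw v]
  add_mem' ha hb w hw v := by rw [map_add, map_add, ha w hw v, hb w hw v]
  algebraMap_mem' r w _ v := by simp [algebraMap_eq]

/-- A system of basic invariants: algebraically independent homogeneous polynomials
`f₁, …, f_l` with `R = ℝ[f₁, …, f_l]`. -/
structure IsBasicInvariants {l : ℕ} (W : Subgroup (V l ≃ₗᵢ[ℝ] V l)) (f : Fin l → S l) :
    Prop where
  homogeneous : ∀ i, ∃ n, (f i).IsHomogeneous n
  algebraicIndependent : AlgebraicIndependent ℝ f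
  adjoin_eq : Algebra.adjoin ℝ (Set.range f) = invariants W

/-- A Saito derivation: a derivation `D` of the field of rational functions such that, for some
system of basic invariants, `D` takes an invariant of highest degree in the system to `1` and
the others to `0`. (Rescaling that invariant rescales `D`.) -/
def IsSaitoDerivation {l : ℕ} (W : Subgroup (V l ≃ₗᵢ[ℝ] V l))
    (D : Derivation ℝ (K l) (K l)) : Prop :=
  ∃ (g : Fin l → S l) (k : Fin l), IsBasicInvariants W g ∧
    (∀ i, (g i).totalDegree ≤ (g k).totalDegree) ∧
    D (algebraMap (S l) (K l) (g k)) = 1 ∧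
    ∀ i, i ≠ k → D (algebraMap (S l) (K l) (g i)) = 0

/-! ### The extension of a derivation to the fraction field, and partial derivatives -/

section Extension

variable {A F : Type*} [CommRing A] [IsDomain A] [Algebra ℝ A] [Field F] [Algebra A F]
  [IsFractionRing A F]

/-- The quotient rule, for a chosen representation of an element of the fraction field. -/
noncomputable def extFun (F : Type*) [Field F] [Algebra A F] [IsFractionRing A F]
    (δ : Derivation ℝ A A) (f : F) : F :=
  let a : A := (IsLocalization.sec (nonZeroDivisors A) f).1
  let b : A := (IsLocalization.sec (nonZeroDivisors A) f).2
  algebraMap A F (b * δ a - a * δ b) / algebraMap A F b ^ 2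

/-- The quotient rule holds for every representation as a quotient. -/
theorem extFun_div (δ : Derivation ℝ A A) (a b : A) (hb : b ≠ 0) :
    extFun F δ (algebraMap A F a / algebraMap A F b) =
      algebraMap A F (b * δ a - a * δ b) / algebraMap A F b ^ 2 := by
  have inj : Function.Injective (algebraMap A F) := IsFractionRing.injective A F
  have ne : ∀ {x : A}, x ≠ 0 → algebraMap A F x ≠ 0 := fun {x} hx h =>
    hx (inj (by rw [h, map_zero]))
  set f := algebraMap A F a / algebraMap A F b with hf
  have hs := IsLocalization.sec_spec (nonZeroDivisors A) f
  unfold extFun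
  set c : A := (IsLocalization.sec (nonZeroDivisors A) f).1
  have he : ((IsLocalization.sec (nonZeroDivisors A) f).2 : A) ≠ 0 :=
    nonZeroDivisors.ne_zero (IsLocalization.sec (nonZeroDivisors A) f).2.2
  set e : A := ((IsLocalization.sec (nonZeroDivisors A) f).2 : A)
  have h1 : a * e = c * b := by
    apply inj
    rw [map_mul, map_mul, ← hs, hf]
    field_simp [ne hb]
  have h2 : a * δ e + e * δ a = c * δ b + b * δ c := by
    have := congrArg δ h1
    rwa [Derivation.leibniz, Derivation.leibniz] at this
  rw [div_eq_div_iff (pow_ne_zero 2 (ne he)) (pow_ne_zero 2 (ne hb)), ← map_pow, ← map_pow,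
    ← map_mul, ← map_mul]
  congr 1
  linear_combination (-(e * b)) * h2 + (e * δ b + b * δ e) * h1

/-- The extension of a derivation of an integral domain to its fraction field. -/
noncomputable def extDerivation (F : Type*) [Field F] [Algebra A F] [IsFractionRing A F]
    [Algebra ℝ F] [IsScalarTower ℝ A F] (δ : Derivation ℝ A A) : Derivation ℝ F F :=
  have ne : ∀ {x : A}, x ≠ 0 → algebraMap A F x ≠ 0 := fun {x} hx h =>
    hx (IsFractionRing.injective A F (by rw [h, map_zero]))
  have rep : ∀ f : F, ∃ a b : A, b ≠ 0 ∧ f = algebraMap A F a / algebraMap A F b := fun f => by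
    obtain ⟨a, b, hb, rfl⟩ := IsFractionRing.div_surjective (A := A) f
    exact ⟨a, b, nonZeroDivisors.ne_zero hb, rfl⟩
  Derivation.mk'
    { toFun := extFun F δ
      map_add' := fun f g => by
        obtain ⟨a, b, hb, rfl⟩ := rep f
        obtain ⟨c, e, he, rfl⟩ := rep g
        have hb' := ne hb
        have he' := ne he
        rw [extFun_div δ _ _ hb, extFun_div δ _ _ he, div_add_div _ _ hb' he', ← map_mul,
          ← map_mul, ← map_mul, ← map_add, extFun_div δ _ _ (mul_ne_zero hb he)]
        simp only [map_add, map_sub, map_mul, Derivation.leibniz, smul_eq_mul]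
        field_simp
        ring
      map_smul' := fun r f => by
        obtain ⟨a, b, hb, rfl⟩ := rep f
        have hb' := ne hb
        have h : r • (algebraMap A F a / algebraMap A F b) =
            algebraMap A F (r • a) / algebraMap A F b := by
          rw [Algebra.smul_def r a, map_mul, ← IsScalarTower.algebraMap_apply ℝ A F,
            Algebra.smul_def r (_ / _ : F), mul_div_assoc]
        rw [h, extFun_div δ _ _ hb, extFun_div δ _ _ hb, RingHom.id_apply, Derivation.map_smul,
          Algebra.smul_def r (_ / _ : F), IsScalarTower.algebraMap_apply ℝ A F]
        simp only [map_sub, map_mul, Algebra.smul_def]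
        field_simp }
    (fun f g => by
      obtain ⟨a, b, hb, rfl⟩ := rep f
      obtain ⟨c, e, he, rfl⟩ := rep g
      have hb' := ne hb
      have he' := ne he
      change extFun F δ _ = _ • extFun F δ _ + _ • extFun F δ _
      rw [extFun_div δ _ _ hb, extFun_div δ _ _ he, div_mul_div_comm, ← map_mul, ← map_mul,
        extFun_div δ _ _ (mul_ne_zero hb he)]
      simp only [map_add, map_sub, map_mul, Derivation.leibniz, smul_eq_mul]
      field_simp
      ring)

variable [Algebra ℝ F] [IsScalarTower ℝ A F] in
/-- The extension agrees with the given derivation on the integral domain. -/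
theorem extDerivation_algebraMap (δ : Derivation ℝ A A) (a : A) :
    extDerivation F δ (algebraMap A F a) = algebraMap A F (δ a) := by
  change extFun F δ _ = _
  have h := extFun_div (F := F) δ a 1 one_ne_zero
  simpa using h

end Extension

/-- The partial derivative `∂ᵢ` on rational functions, the extension of `∂ᵢ` on polynomials. -/
noncomputable def partialD {l : ℕ} (i : Fin l) : Derivation ℝ (K l) (K l) :=
  extDerivation (K l) (pderiv i)

/-! ### Differential forms -/

/-- Rational `1`-forms: `dx₁, …, dx_l` is the standard basis. -/
abbrev Form1 (l : ℕ) : Type := Fin l → K l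

/-- Rational `p`-forms. -/
abbrev Form (l p : ℕ) : Type := ⋀[K l]^p (Form1 l)

/-- The basis `dx₁, …, dx_l` of the rational `1`-forms. -/
noncomputable def dx (l : ℕ) : Module.Basis (Fin l) (K l) (Form1 l) := Pi.basisFun (K l) (Fin l)

/-- The differential of a rational function, `df = ∑ i, (∂ᵢ f) dxᵢ`. -/
noncomputable def dFun {l : ℕ} (f : K l) : Form1 l := ∑ i, partialD i f • dx l i

/-- Exterior differentiation of rational `p`-forms: if `ω = ∑ I, f_I dx_I`, where `I` runs over
the `p`-element subsets `i₁ < ⋯ < i_p` of the indices and `dx_I = dx_{i₁} ∧ ⋯ ∧ dx_{i_p}`, then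
`dω = ∑ I, df_I ∧ dx_I`. -/
noncomputable def extDer {l p : ℕ} (ω : Form l p) : Form l (p + 1) :=
  ∑ I : Set.powersetCard (Fin l) p,
    exteriorPower.ιMulti (K l) (p + 1)
      (Fin.cons (dFun (((dx l).exteriorPower p).repr ω I))
        (fun j : Fin p => dx l (Set.powersetCard.ofFinEmbEquiv.symm I j)))

/-- The module `Ω^p` of polynomial `p`-forms, inside the rational `p`-forms: the `S`-span
of the forms `dx_{i₁} ∧ ⋯ ∧ dx_{i_p}` with `i₁ < ⋯ < i_p`. -/
noncomputable def polyForms (l p : ℕ) : Submodule (S l) (Form l p) :=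
  Submodule.span (S l) (Set.range (exteriorPower.ιMulti_family (K l) p (dx l)))

/-- The set `Ω^p(𝒜)` of logarithmic `p`-forms: the rational forms `ω = η / q` with `η ∈ Ω^p` and
`dω ∈ (1 / q) Ω^(p+1)`. Here `q` is the defining polynomial of the arrangement. -/
def logForms {l : ℕ} (q : S l) (p : ℕ) : Set (Form l p) :=
  {ω | (∃ η ∈ polyForms l p, ω = (algebraMap (S l) (K l) q)⁻¹ • η) ∧
    ∃ ζ ∈ polyForms l (p + 1), extDer ω = (algebraMap (S l) (K l) q)⁻¹ • ζ}

/-- The operator `d̂`, sending `f ∈ S` to `∑ i, (∂ᵢ f) d(q · D xᵢ)`. -/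
noncomputable def dHat {l : ℕ} (q : S l) (D : Derivation ℝ (K l) (K l)) (f : S l) : Form1 l :=
  ∑ i, algebraMap (S l) (K l) (pderiv i f) •
    dFun (algebraMap (S l) (K l) q * D (algebraMap (S l) (K l) (X i)))

/-- The forms `q^(-p) (d̂f_{i₁} ∧ ⋯ ∧ d̂f_{i_p})`, indexed by the `p`-element subsets
`i₁ < ⋯ < i_p` of the indices. -/
noncomputable def hatForm {l : ℕ} (q : S l) (D : Derivation ℝ (K l) (K l)) (f : Fin l → S l)
    (p : ℕ) (I : Set.powersetCard (Fin l) p) : Form l p :=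
  (algebraMap (S l) (K l) q ^ p)⁻¹ •
    exteriorPower.ιMulti_family (K l) p (fun i => dHat q D (f i)) I

end CoxeterLog

open CoxeterLog

namespace CoxeterLog

open MvPolynomial

/-! Let `J` be the Jacobian matrix of the basic invariants `g` attached to `D`, with columns the
gradients `∇g_j`, and let `N` be the number of hyperplanes. The field `θ = Q·(Dx_1, …, Dx_l)` is
polynomial: it sends `g_k` to `Q` and the other `g_j` to `0`. With `B = (∂_n θ_r)`, the form `d̂f`
is `B∇f`. Two facts give the theorem.

(1) `Ω^p(𝒜)` consists of the `p`-forms with polynomial coordinates in the exterior powers of the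
basis of `1`-forms dual to `∇g_1, …, ∇g_l` (`logForms_eq_lattice`). This is Saito's criterion: `det
J` is a nonzero constant times `Q` (`exists_det_jac_eq`), `Q` divides every `∇g_i·∇Q`, and `Q` is
squarefree.

(2) `JᵀBJ = Q·U` with `U` polynomial (`exists_mul_fieldDeriv_mul_eq`) and `det U` a nonzero constant
(`isUnit_det_of_mul_fieldDeriv_mul_eq`). Hence in the coordinates of (1) the forms `Q⁻¹ d̂g_j` are
the columns of a unimodular matrix; replacing `g` by `f` multiplies it by another one
(`exists_jac_eq_mul`).

Polynomiality in (2) holds because the entries of `JᵀBJ` are anti-invariant. That `det U` is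
constant is a degree count resting on `2N = hl`, with `h` the largest degree; that it is nonzero
means `det B ≠ 0`. Both follow from an eigenvector `z` of a Coxeter element `c` that lies off all
complexified hyperplanes and kills every `g_i` except `g_k` (`exists_isRegularVector`). At `z` the
field `θ` is proportional to `z` and `∇Q` to `∇g_k`, so by Euler's formula the `∇g_j(z)` are
eigenvectors of `B(z)` with nonzero eigenvalues.

The vector `z` comes from the bipartite Coxeter diagram and the Perron vector of the Gram matrix of
the simple roots. Counting inversions gives `2N ≤ ord(c)·l`; the invertibility of `JᵀJ` at `z` gives
the reverse inequality, and the resulting equality pins down the exponents as far as needed. -/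

variable {l : ℕ}

/-! ### Linear polynomials and the action of isometries on polynomials -/

/-- The linear polynomial `v ↦ ⟪a, v⟫`. -/
noncomputable def lin (a : V l) : S l := ∑ i, C (a i) * X i

theorem eval_lin (a v : V l) : eval v.ofLp (lin a) = inner ℝ a v := by
  simp [lin, PiLp.inner_apply, mul_comm]

theorem poly_ext {f g : S l} (h : ∀ v : V l, eval v.ofLp f = eval v.ofLp g) : f = g :=
  MvPolynomial.funext fun v => h (WithLp.toLp 2 v)

theorem lin_sub (a b : V l) : lin (a - b) = lin a - lin b :=
  poly_ext fun v => by simp [eval_lin, inner_sub_left]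

theorem lin_smul (c : ℝ) (a : V l) : lin (c • a) = C c * lin a :=
  poly_ext fun v => by simp [eval_lin, inner_smul_left]

theorem lin_zero : lin (0 : V l) = 0 := by simp [lin]

theorem lin_single (i : Fin l) : lin (EuclideanSpace.single i 1) = X i :=
  poly_ext fun v => by rw [eval_lin, EuclideanSpace.inner_single_left]; simp

theorem lin_injective : Function.Injective (lin : V l → S l) := fun a b h => by
  refine ext_inner_right ℝ fun v => ?_
  rw [← eval_lin, ← eval_lin, h]

theorem lin_ne_zero {a : V l} (ha : a ≠ 0) : lin a ≠ 0 := fun h =>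
  ha (lin_injective (h.trans lin_zero.symm))

theorem lin_isHomogeneous (a : V l) : (lin a).IsHomogeneous 1 :=
  IsHomogeneous.sum _ _ _ fun _ _ => isHomogeneous_C_mul_X _ _

theorem pderiv_lin (i : Fin l) (a : V l) : pderiv i (lin a) = C (a i) := by
  simp [lin, pderiv_X, Pi.single_apply]

theorem lin_prime {a : V l} (ha : a ≠ 0) : Prime (lin a) := by
  rw [← irreducible_iff_prime]
  have hd : (lin a).totalDegree = 1 := (lin_isHomogeneous a).totalDegree (lin_ne_zero ha)
  refine irreducible_of_totalDegree_eq_one hd fun x hx => ?_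
  rw [isUnit_iff_ne_zero]
  rintro rfl
  refine lin_ne_zero ha (MvPolynomial.ext _ _ fun m => ?_)
  simpa using hx m

theorem exists_smul_of_lin_dvd {a b : V l} (h : lin a ∣ lin b) :
    ∃ c : ℝ, b = c • a := by
  have : b ∈ (Submodule.span ℝ {a})ᗮᗮ := by
    rw [Submodule.mem_orthogonal]
    intro u hu
    rw [Submodule.mem_orthogonal_singleton_iff_inner_right] at hu
    obtain ⟨q, hq⟩ := h
    rw [real_inner_comm, ← eval_lin, hq, map_mul, eval_lin, hu, zero_mul]
  rw [Submodule.orthogonal_orthogonal, Submodule.mem_span_singleton] at this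
  obtain ⟨c, hc⟩ := this
  exact ⟨c, hc.symm⟩

/-- The action of an isometry on polynomial functions by composition. -/
noncomputable def act (w : V l ≃ₗᵢ[ℝ] V l) : S l →ₐ[ℝ] S l :=
  aeval fun n => lin (w.symm (EuclideanSpace.single n 1))

theorem inner_symm_apply (w : V l ≃ₗᵢ[ℝ] V l) (a v : V l) :
    inner ℝ (w.symm a) v = inner ℝ a (w v) := by
  rw [← w.inner_map_map, w.apply_symm_apply]

theorem eval_act (w : V l ≃ₗᵢ[ℝ] V l) (f : S l) (v : V l) :
    eval v.ofLp (act w f) = eval (w v).ofLp f := by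
  induction f using MvPolynomial.induction_on with
  | C a => simp [act]
  | add p q hp hq => rw [map_add, map_add, map_add, hp, hq]
  | mul_X p i hp =>
    rw [map_mul, map_mul, map_mul, hp, eval_X]
    congr 1
    rw [act, aeval_X, eval_lin, inner_symm_apply, EuclideanSpace.inner_single_left]
    simp

theorem act_lin (w : V l ≃ₗᵢ[ℝ] V l) (a : V l) : act w (lin a) = lin (w.symm a) :=
  poly_ext fun v => by rw [eval_act, eval_lin, eval_lin, inner_symm_apply]

theorem mem_invariants_iff {W : Subgroup (V l ≃ₗᵢ[ℝ] V l)} {f : S l} :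
    f ∈ invariants W ↔ ∀ w ∈ W, act w f = f := by
  constructor
  · intro h w hw
    exact poly_ext fun v => by rw [eval_act]; exact h w hw v
  · intro h w hw v
    rw [← eval_act, h w hw]

theorem refl_apply (v x : V l) :
    refl v x = x - (2 * inner ℝ v x / inner ℝ v v) • v := by
  rw [refl, Submodule.reflection_orthogonal_apply, Submodule.reflection_singleton_apply]
  rw [real_inner_self_eq_norm_sq]
  simp only [Real.ringHom_apply, two_smul, neg_sub]
  rw [← add_smul]
  congr 2
  ring

theorem refl_refl (v x : V l) : refl v (refl v x) = x :=
  Submodule.reflection_reflection _ _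

theorem refl_symm (v : V l) : (refl v).symm = refl v :=
  Submodule.reflection_symm

theorem refl_smul {c : ℝ} (hc : c ≠ 0) (v : V l) : refl (c • v) = refl v := by
  have : Submodule.span ℝ {c • v} = Submodule.span ℝ {v} :=
    Submodule.span_singleton_smul_eq (IsUnit.mk0 c hc) v
  simp only [refl, this]

theorem refl_of_inner_eq_zero {v x : V l} (h : inner ℝ v x = 0) : refl v x = x :=
  Submodule.reflection_mem_subspace_eq_self
    (Submodule.mem_orthogonal_singleton_iff_inner_right.2 h)

/-- The reflection moves each coordinate by a multiple of `lin v`, so it acts trivially modulo `lin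
v`. -/
theorem lin_dvd_sub_act_refl (v : V l) (f : S l) :
    lin v ∣ f - act (refl v) f := by
  rw [← Ideal.mem_span_singleton, ← Ideal.Quotient.eq]
  have : (Ideal.Quotient.mkₐ ℝ (Ideal.span {lin v})) =
      (Ideal.Quotient.mkₐ ℝ (Ideal.span {lin v})).comp (act (refl v)) := by
    ext n
    simp only [Ideal.Quotient.mkₐ_eq_mk, AlgHom.comp_apply]
    rw [Ideal.Quotient.eq, Ideal.mem_span_singleton, ← lin_single, act_lin, refl_symm,
      refl_apply, ← lin_sub, sub_sub_cancel, lin_smul]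
    exact Dvd.intro_left _ rfl
  exact congrArg (fun φ : S l →ₐ[ℝ] _ => φ f) this

/-- Here `f - act (refl v) f = 2f`. With `Q_dvd`, this makes anti-invariants divisible by `Q`. -/
theorem lin_dvd_of_act_refl_eq_neg {v : V l} {f : S l}
    (h : act (refl v) f = -f) : lin v ∣ f := by
  have h1 := lin_dvd_sub_act_refl v f
  rw [h, sub_neg_eq_add] at h1
  have : f = C (1 / 2 : ℝ) * (f + f) := by
    rw [← two_mul, ← mul_assoc, show (2 : S l) = C 2 from rfl, ← C_mul]
    norm_num
  rw [this]
  exact Dvd.dvd.mul_left h1 _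

/-! ### Gradients -/

/-- The matrix of an isometry in the standard coordinates, with polynomial entries. -/
noncomputable def actMat (w : V l ≃ₗᵢ[ℝ] V l) : Matrix (Fin l) (Fin l) (S l) :=
  Matrix.of fun n m => C (w (EuclideanSpace.single m 1) n)

theorem symm_single_apply (w : V l ≃ₗᵢ[ℝ] V l) (n m : Fin l) :
    w.symm (EuclideanSpace.single n 1) m = w (EuclideanSpace.single m 1) n := by
  have := inner_symm_apply w (EuclideanSpace.single n 1) (EuclideanSpace.single m 1)
  simpa [EuclideanSpace.inner_single_left, EuclideanSpace.inner_single_right] using this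

theorem actMat_transpose_mul (w : V l ≃ₗᵢ[ℝ] V l) : (actMat w).transpose * actMat w = 1 := by
  ext1 n m
  have := w.inner_map_map (EuclideanSpace.single n 1) (EuclideanSpace.single m 1)
  rw [EuclideanSpace.inner_single_left, PiLp.inner_apply] at this
  simp only [RCLike.inner_apply, Real.ringHom_apply, PiLp.single_apply,
    one_mul] at this
  simp only [Matrix.mul_apply, Matrix.transpose_apply, actMat, Matrix.of_apply, ← C_mul,
    ← map_sum, Matrix.one_apply]
  rw [← RingHom.map_one C, ← RingHom.map_zero C, ← apply_ite C, ← this]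
  simp [mul_comm]

theorem actMat_mul_transpose (w : V l ≃ₗᵢ[ℝ] V l) : actMat w * (actMat w).transpose = 1 :=
  mul_eq_one_comm.1 (actMat_transpose_mul w)

theorem pderiv_act (w : V l ≃ₗᵢ[ℝ] V l) (m : Fin l) (f : S l) :
    pderiv m (act w f) = ∑ n, actMat w n m * act w (pderiv n f) := by
  induction f using MvPolynomial.induction_on with
  | C a => simp [act]
  | add p q hp hq => simp [hp, hq, mul_add, Finset.sum_add_distrib]
  | mul_X p i hp =>
    have hX : pderiv m (act w (X i)) = actMat w i m := by
      rw [← lin_single, act_lin, pderiv_lin, symm_single_apply]; rfl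
    simp only [map_mul, Derivation.leibniz, hp, smul_eq_mul, hX, map_add, pderiv_X,
      Pi.single_apply, mul_add, Finset.sum_add_distrib, Finset.mul_sum]
    congr 1
    · rw [Finset.sum_eq_single i]
      · simp; ring
      · intro b _ hb; simp [Ne.symm hb]
      · simp
    · exact Finset.sum_congr rfl fun _ _ => by ring

/-! ### The Jacobian determinant of a system of basic invariants -/

/-- The Jacobian matrix of a family of polynomials; its columns are the gradients. -/
noncomputable def jac (f : Fin l → S l) : Matrix (Fin l) (Fin l) (S l) :=
  Matrix.of fun n j => pderiv n (f j)

/-- The gradient of a polynomial. -/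
noncomputable def grad (f : S l) : Fin l → S l := fun n => pderiv n f

/-- Chain rule for a polynomial in the `g_j`; induction on the generated algebra avoids naming that
polynomial. -/
theorem grad_mem_range_jac {W : Subgroup (V l ≃ₗᵢ[ℝ] V l)} {g : Fin l → S l}
    (hg : IsBasicInvariants W g) {r : S l} (hr : r ∈ invariants W) :
    grad r ∈ LinearMap.range (jac g).mulVecLin := by
  rw [← hg.adjoin_eq] at hr
  induction hr using Algebra.adjoin_induction with
  | mem x hx =>
    obtain ⟨j, rfl⟩ := hx
    refine ⟨Pi.single j 1, ?_⟩
    ext1 n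
    simp [jac, grad]
  | algebraMap c =>
    convert zero_mem (LinearMap.range (jac g).mulVecLin)
    ext1 n
    simp [grad, algebraMap_eq]
  | add x y _ _ hx hy =>
    convert add_mem hx hy
    ext1 n
    simp [grad]
  | mul x y _ _ hx hy =>
    convert add_mem (Submodule.smul_mem _ x hy) (Submodule.smul_mem _ y hx)
    ext1 n
    simp [grad]

/-- Differentiating `F(y) = 0` gives `F'(y)∇y = -∑ y^j ∇F_j`, and the coefficients `F_j` are
invariant. -/
theorem eval_derivative_smul_grad_mem {W : Subgroup (V l ≃ₗᵢ[ℝ] V l)} {g : Fin l → S l}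
    (hg : IsBasicInvariants W g) (F : Polynomial (S l)) (hF : ∀ n, F.coeff n ∈ invariants W)
    (y : S l) (hy : F.eval y = 0) :
    F.derivative.eval y • grad y ∈ LinearMap.range (jac g).mulVecLin := by
  have h1 : ∑ j ∈ F.support, y ^ j • grad (F.coeff j) ∈ LinearMap.range (jac g).mulVecLin :=
    Submodule.sum_mem _ fun j _ => Submodule.smul_mem _ _ (grad_mem_range_jac hg (hF j))
  convert neg_mem h1
  ext1 n
  have h2 := congrArg (pderiv n) hy
  rw [Polynomial.eval_eq_sum, Polynomial.sum, map_sum, map_zero] at h2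
  rw [Pi.neg_apply, eq_neg_iff_add_eq_zero, ← h2, Polynomial.derivative_eval, Polynomial.sum]
  simp only [grad, Pi.smul_apply, Finset.sum_apply, smul_eq_mul, Derivation.leibniz,
    Derivation.leibniz_pow, Finset.sum_mul, ← Finset.sum_add_distrib, nsmul_eq_mul]
  exact Finset.sum_congr rfl fun j _ => by ring

/-- Take `F = ∏ (T - lin z)` over the stable set `O`: its coefficients are invariant, `lin b` is a
root, and `F'(lin b)` is the product of differences. -/
theorem prod_smul_grad_mem {W : Subgroup (V l ≃ₗᵢ[ℝ] V l)} {g : Fin l → S l}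
    (hg : IsBasicInvariants W g) [DecidableEq (V l)] (O : Finset (V l))
    (hO : ∀ w ∈ W, ∀ z ∈ O, w z ∈ O) (b : V l) (hb : b ∈ O) :
    (∏ z ∈ O.erase b, lin (b - z)) • grad (lin b) ∈ LinearMap.range (jac g).mulVecLin := by
  have key := eval_derivative_smul_grad_mem hg
    (∏ z ∈ O, (Polynomial.X - Polynomial.C (lin z))) ?_ (lin b) ?_
  · convert key using 2
    rw [← Finset.mul_prod_erase _ _ hb]
    simp [Polynomial.derivative_mul, Polynomial.eval_prod, lin_sub]
  · intro n
    rw [mem_invariants_iff]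
    intro w hw
    have h : (∏ z ∈ O, (Polynomial.X - Polynomial.C (lin z))).map (act w : S l →+* S l) =
        ∏ z ∈ O, (Polynomial.X - Polynomial.C (lin z)) := by
      rw [Polynomial.map_prod]
      refine Finset.prod_nbij' (fun z => w.symm z) (fun z => w z) ?_ ?_ ?_ ?_ ?_
      · exact fun z hz => hO _ (W.inv_mem hw) z hz
      · exact fun z hz => hO w hw z hz
      · simp
      · simp
      · intro z _
        simp [act_lin]
    conv_rhs => rw [← h]
    rw [Polynomial.coeff_map]
    rfl
  · rw [Polynomial.eval_prod]
    exact Finset.prod_eq_zero hb (by simp)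

/-- The orbit of a vector under a finite group of isometries. -/
noncomputable def orb (W : Subgroup (V l ≃ₗᵢ[ℝ] V l)) [Finite W] (b : V l) : Finset (V l) :=
  (Set.finite_range fun w : W => (w : V l ≃ₗᵢ[ℝ] V l) b).toFinset

theorem mem_orb {W : Subgroup (V l ≃ₗᵢ[ℝ] V l)} [Finite W] {b z : V l} :
    z ∈ orb W b ↔ ∃ w ∈ W, w b = z := by
  simp [orb]

open Classical in
/-- The product of the differences of a vector with the other points of its orbit. -/
noncomputable def orbDiff (W : Subgroup (V l ≃ₗᵢ[ℝ] V l)) [Finite W] (b : V l) : S l :=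
  ∏ z ∈ (orb W b).erase b, lin (b - z)

/-- An upper bound for `det J` that needs no knowledge of the degrees: the vectors `orbDiff W (b k)
• b k` lie in the column span of `J`, and the matrix of the `b k` is constant and invertible. -/
theorem det_jac_dvd {W : Subgroup (V l ≃ₗᵢ[ℝ] V l)} [Finite W] {g : Fin l → S l}
    (hg : IsBasicInvariants W g) (b : Fin l → V l) (hb : LinearIndependent ℝ b) :
    (jac g).det ∣ ∏ k, orbDiff W (b k) := by
  classical
  have h : ∀ k, orbDiff W (b k) • grad (lin (b k)) ∈ LinearMap.range (jac g).mulVecLin :=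
    fun k => prod_smul_grad_mem hg _ (fun w hw z hz => by
      obtain ⟨w', hw', rfl⟩ := mem_orb.1 hz
      exact mem_orb.2 ⟨w * w', W.mul_mem hw hw', rfl⟩) _ (mem_orb.2 ⟨1, W.one_mem, rfl⟩)
  choose c hc using h
  have hmul : jac g * Matrix.of (fun n k => c k n) =
      Matrix.of (fun n k => C (b k n)) * Matrix.diagonal fun k => orbDiff W (b k) := by
    ext1 n k
    have := congrFun (hc k) n
    rw [Matrix.mul_diagonal]
    simpa [Matrix.mul_apply, Matrix.mulVec, dotProduct, grad, pderiv_lin, mul_comm] using this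
  have hdet := congrArg Matrix.det hmul
  rw [Matrix.det_mul, Matrix.det_mul, Matrix.det_diagonal] at hdet
  have hB : (Matrix.of fun n k => b k n).det ≠ 0 := by
    rw [← Matrix.det_transpose, ← isUnit_iff_ne_zero, ← Matrix.isUnit_iff_isUnit_det,
      ← Matrix.linearIndependent_rows_iff_isUnit]
    exact hb.map' (WithLp.linearEquiv 2 ℝ (Fin l → ℝ)).toLinearMap (LinearEquiv.ker _)
  have hu : IsUnit (Matrix.of (fun n k => C (b k n)) : Matrix (Fin l) (Fin l) (S l)).det := by
    have : (Matrix.of (fun n k => C (b k n)) : Matrix (Fin l) (Fin l) (S l)) =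
      (C : ℝ →+* S l).mapMatrix (Matrix.of fun n k => b k n) := rfl
    rw [this, ← RingHom.map_det]
    exact (IsUnit.mk0 _ hB).map C
  rw [← hu.dvd_mul_left, ← hdet]
  exact Dvd.intro _ rfl

/-! ### Multiplicity of a linear form in the Jacobian determinant -/

/-- Finitely many proper subspaces do not cover `V`; those to avoid are `β⊥` and the loci where some
other `w ∈ W` agrees with `refl β`. -/
theorem exists_generic {W : Subgroup (V l ≃ₗᵢ[ℝ] V l)} [Finite W] {β : V l} (hβ : β ≠ 0) :
    ∃ y : V l, inner ℝ β y ≠ 0 ∧ ∀ w ∈ W, w y = refl β y → w = refl β := by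
  classical
  have hfin : {w : V l ≃ₗᵢ[ℝ] V l | w ∈ W ∧ w ≠ refl β}.Finite :=
    (Set.toFinite (W : Set (V l ≃ₗᵢ[ℝ] V l))).subset fun w hw => hw.1
  let F : (V l ≃ₗᵢ[ℝ] V l) → Submodule ℝ (V l) := fun w =>
    LinearMap.eqLocus w.toLinearEquiv.toLinearMap (refl β).toLinearEquiv.toLinearMap
  have h := Subspace.biUnion_ne_univ_of_top_notMem
    (s := (insert (Submodule.span ℝ {β})ᗮ (hfin.toFinset.image F) : Finset (Submodule ℝ (V l))))
    (by
      rw [Finset.mem_insert, not_or]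
      constructor
      · intro h
        have : β ∈ (Submodule.span ℝ {β})ᗮ := h ▸ Submodule.mem_top
        rw [Submodule.mem_orthogonal_singleton_iff_inner_right] at this
        exact hβ (inner_self_eq_zero.1 this)
      · simp only [Finset.mem_image, not_exists, not_and]
        intro w hw h
        simp only [Set.Finite.mem_toFinset, Set.mem_ofPred_eq] at hw
        refine hw.2 (LinearIsometryEquiv.ext fun x => ?_)
        have : x ∈ F w := h ▸ Submodule.mem_top
        exact this)
  rw [Set.ne_univ_iff_exists_notMem] at h
  obtain ⟨y, hy⟩ := h
  simp only [Set.mem_iUnion, not_exists] at hy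
  refine ⟨y, fun h => ?_, fun w hw h => ?_⟩
  · exact hy (Submodule.span ℝ {β})ᗮ (by simp)
      (Submodule.mem_orthogonal_singleton_iff_inner_right.2 h)
  · by_contra hne
    exact hy (F w) (Finset.mem_insert_of_mem (Finset.mem_image_of_mem _
      (hfin.mem_toFinset.2 ⟨hw, hne⟩))) h

theorem eq_refl_of_sub_eq_smul {β y z : V l} {c : ℝ} (hn : ‖z‖ = ‖y‖) (hne : y ≠ z)
    (h : y - z = c • β) : z = refl β y := by
  have hz : z = y - c • β := by rw [← h]; abel
  have h1 : inner ℝ z z = inner ℝ y y := by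
    rw [real_inner_self_eq_norm_sq, real_inner_self_eq_norm_sq, hn]
  have hc : c ≠ 0 := by
    rintro rfl
    exact hne (by rw [hz]; simp)
  have hβ : inner ℝ β β ≠ 0 := by
    intro h0
    rw [inner_self_eq_zero] at h0
    exact hne (by rw [hz, h0]; simp)
  rw [hz, inner_sub_left, inner_sub_right, inner_sub_right, inner_smul_left, inner_smul_right,
    inner_smul_left, inner_smul_right, real_inner_comm β y] at h1
  simp only [conj_trivial] at h1
  have h2 : c * inner ℝ β β = 2 * inner ℝ β y := by
    apply mul_left_cancel₀ hc
    linarith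
  rw [refl_apply, ← h2, mul_div_cancel_right₀ _ hβ, hz]

theorem norm_of_mem_orb {W : Subgroup (V l ≃ₗᵢ[ℝ] V l)} [Finite W] {b z : V l}
    (h : z ∈ orb W b) : ‖z‖ = ‖b‖ := by
  obtain ⟨w, -, rfl⟩ := mem_orb.1 h
  exact w.norm_map b

/-- This forces `lin β` to divide `det J` at most once, and only if `refl β ∈ W`. Apply
`det_jac_dvd` to a generic `y` completed by vectors of `β⊥`. A difference `b - z` within an orbit is
parallel to `β` only if `z = refl β b`, which is impossible for `b ∈ β⊥` and happens for at most one
`z` when `b = y`. -/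
theorem exists_dvd_of_not_dvd {W : Subgroup (V l ≃ₗᵢ[ℝ] V l)} [Finite W] {g : Fin l → S l}
    (hg : IsBasicInvariants W g) {β : V l} (hβ : β ≠ 0) :
    ∃ A : S l, ¬ lin β ∣ A ∧ ((jac g).det ∣ A ∨ refl β ∈ W ∧ (jac g).det ∣ lin β * A) := by
  classical
  obtain ⟨y, hy0, hy⟩ := exists_generic (W := W) hβ
  obtain ⟨i0, hi0⟩ : ∃ i, β i ≠ 0 := by
    by_contra! h
    exact hβ (by ext i; simpa using h i)
  have hp := lin_prime hβ
  let e : Fin l → V l := fun k => EuclideanSpace.single k 1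
  -- Off `i0`, the standard vectors are corrected along `e i0` so as to be orthogonal to `β`.
  let b : Fin l → V l := fun k => if k = i0 then y else e k - (β k / β i0) • e i0
  have hbi : b i0 = y := if_pos rfl
  have hb0 : ∀ k, k ≠ i0 → inner ℝ β (b k) = 0 := by
    intro k hk
    simp only [b, if_neg hk, e, inner_sub_right, inner_smul_right,
      EuclideanSpace.inner_single_right]
    simp only [conj_trivial, one_mul]
    field_simp
    ring
  have hli : LinearIndependent ℝ b := by
    rw [Fintype.linearIndependent_iff]
    intro c hc
    have hci : c i0 = 0 := by
      have h1 := congrArg (fun x => inner ℝ β x) hc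
      simp only [inner_sum, inner_smul_right, inner_zero_right] at h1
      rw [Finset.sum_eq_single i0 (fun k _ hk => by rw [hb0 k hk, mul_zero]) (by simp), hbi] at h1
      exact (mul_eq_zero.1 h1).resolve_right hy0
    intro k
    by_cases hk : k = i0
    · rw [hk, hci]
    have h1 := congrArg (fun x : V l => x k) hc
    simp only [WithLp.ofLp_sum, WithLp.ofLp_smul, Finset.sum_apply, Pi.smul_apply, smul_eq_mul,
      WithLp.ofLp_zero, Pi.zero_apply] at h1
    rw [Finset.sum_eq_single k] at h1
    · simpa [b, if_neg hk, e, hk] using h1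
    · intro j _ hj
      by_cases hj0 : j = i0
      · rw [hj0, hci, zero_mul]
      · simp [b, if_neg hj0, e, hk, Ne.symm hj]
    · simp
  have hdvd := det_jac_dvd hg b hli
  rw [← Finset.mul_prod_erase _ _ (Finset.mem_univ i0), hbi] at hdvd
  set R := ∏ k ∈ Finset.univ.erase i0, orbDiff W (b k)
  have hR : ¬ lin β ∣ R := by
    intro h
    obtain ⟨k, hk, h⟩ := (hp.dvd_finsetProd_iff _).1 h
    obtain ⟨z, hz, h⟩ := (hp.dvd_finsetProd_iff _).1 h
    obtain ⟨c, hc⟩ := exists_smul_of_lin_dvd h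
    rw [Finset.mem_erase] at hz
    have := eq_refl_of_sub_eq_smul (norm_of_mem_orb hz.2) (Ne.symm hz.1) hc
    rw [refl_of_inner_eq_zero (hb0 k (Finset.ne_of_mem_erase hk))] at this
    exact hz.1 this
  have hfac : ∀ z ∈ (orb W y).erase y, lin β ∣ lin (y - z) → z = refl β y := by
    intro z hz h
    obtain ⟨c, hc⟩ := exists_smul_of_lin_dvd h
    rw [Finset.mem_erase] at hz
    exact eq_refl_of_sub_eq_smul (norm_of_mem_orb hz.2) (Ne.symm hz.1) hc
  by_cases hmem : refl β y ∈ (orb W y).erase y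
  · have hW : refl β ∈ W := by
      obtain ⟨w, hw, h⟩ := mem_orb.1 (Finset.mem_of_mem_erase hmem)
      rwa [← hy w hw h]
    -- The single factor `y - refl β y` is this scalar times `β`; only `lin β` is taken out of it.
    refine ⟨C (2 * inner ℝ β y / inner ℝ β β) *
      (∏ z ∈ ((orb W y).erase y).erase (refl β y), lin (y - z)) * R, ?_, Or.inr ⟨hW, ?_⟩⟩
    · intro h
      rcases hp.dvd_or_dvd h with h | h
      · rcases hp.dvd_or_dvd h with h | h
        · have hne : (2 * inner ℝ β y / inner ℝ β β) ≠ 0 :=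
            div_ne_zero (mul_ne_zero two_ne_zero hy0) (inner_self_ne_zero.2 hβ)
          exact hp.not_isUnit (isUnit_of_dvd_unit h ((IsUnit.mk0 _ hne).map C))
        · obtain ⟨z, hz, h⟩ := (hp.dvd_finsetProd_iff _).1 h
          exact Finset.ne_of_mem_erase hz (hfac z (Finset.mem_of_mem_erase hz) h)
      · exact hR h
    · convert hdvd using 1
      rw [orbDiff, ← Finset.mul_prod_erase _ _ hmem, refl_apply β y, sub_sub_cancel, lin_smul]
      ring
  · refine ⟨orbDiff W y * R, ?_, Or.inl hdvd⟩
    intro h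
    rcases hp.dvd_or_dvd h with h | h
    · obtain ⟨z, hz, h⟩ := (hp.dvd_finsetProd_iff _).1 h
      exact hmem (hfac z hz h ▸ hz)
    · exact hR h

/-! ### The defining polynomial of the arrangement -/

/-- The vector representing a linear form. -/
noncomputable def normalVec (φ : Module.Dual ℝ (V l)) : V l :=
  WithLp.toLp 2 fun i => φ (EuclideanSpace.single i 1)

theorem inner_normalVec (φ : Module.Dual ℝ (V l)) (v : V l) : inner ℝ (normalVec φ) v = φ v := by
  have hv : v = ∑ i, v i • EuclideanSpace.single i (1 : ℝ) := by
    have := (EuclideanSpace.basisFun (Fin l) ℝ).sum_repr v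
    simpa using this.symm
  conv_rhs => rw [hv, map_sum]
  simp [PiLp.inner_apply, normalVec]

theorem ker_eq_normalVec (φ : Module.Dual ℝ (V l)) :
    LinearMap.ker φ = (Submodule.span ℝ {normalVec φ})ᗮ := by
  ext v
  rw [LinearMap.mem_ker, Submodule.mem_orthogonal_singleton_iff_inner_right, inner_normalVec]

theorem exists_smul_of_orthogonal_eq {u v : V l}
    (h : (Submodule.span ℝ {u})ᗮ = (Submodule.span ℝ {v})ᗮ) : ∃ c : ℝ, u = c • v := by
  have := congrArg Submodule.orthogonal h
  rw [Submodule.orthogonal_orthogonal, Submodule.orthogonal_orthogonal] at this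
  obtain ⟨c, hc⟩ := Submodule.mem_span_singleton.1 (this ▸ Submodule.mem_span_singleton_self u)
  exact ⟨c, hc.symm⟩

/-- A choice of linear forms for an arrangement. -/
def IsDefining (W : Subgroup (V l ≃ₗᵢ[ℝ] V l))
    (α : Submodule ℝ (V l) → Module.Dual ℝ (V l)) : Prop :=
  ∀ H ∈ arrangement W, LinearMap.ker (α H) = H

theorem IsDefining.eq_orthogonal {W : Subgroup (V l ≃ₗᵢ[ℝ] V l)}
    {α : Submodule ℝ (V l) → Module.Dual ℝ (V l)} (hα : IsDefining W α) {H : Submodule ℝ (V l)}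
    (hH : H ∈ arrangement W) : H = (Submodule.span ℝ {normalVec (α H)})ᗮ := by
  rw [← ker_eq_normalVec, hα H hH]

theorem IsDefining.exists_smul {W : Subgroup (V l ≃ₗᵢ[ℝ] V l)}
    {α : Submodule ℝ (V l) → Module.Dual ℝ (V l)} (hα : IsDefining W α) {v : V l} (hv : v ≠ 0)
    (hW : refl v ∈ W) :
    ∃ c : ℝ, c ≠ 0 ∧ v = c • normalVec (α (Submodule.span ℝ {v})ᗮ) := by
  obtain ⟨c, hc⟩ := exists_smul_of_orthogonal_eq (hα.eq_orthogonal ⟨v, hv, rfl, hW⟩)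
  refine ⟨c, ?_, hc⟩
  rintro rfl
  exact hv (by rw [hc, zero_smul])

theorem IsDefining.normalVec_ne_zero {W : Subgroup (V l ≃ₗᵢ[ℝ] V l)}
    {α : Submodule ℝ (V l) → Module.Dual ℝ (V l)} (hα : IsDefining W α) {H : Submodule ℝ (V l)}
    (hH : H ∈ arrangement W) : normalVec (α H) ≠ 0 := by
  obtain ⟨v, hv, rfl, hW⟩ := hH
  obtain ⟨c, -, h⟩ := hα.exists_smul hv hW
  intro h0
  exact hv (by rw [h, h0, smul_zero])

theorem IsDefining.refl_mem {W : Subgroup (V l ≃ₗᵢ[ℝ] V l)}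
    {α : Submodule ℝ (V l) → Module.Dual ℝ (V l)} (hα : IsDefining W α) {H : Submodule ℝ (V l)}
    (hH : H ∈ arrangement W) : refl (normalVec (α H)) ∈ W := by
  obtain ⟨v, hv, rfl, hW⟩ := hH
  obtain ⟨c, hc, h⟩ := hα.exists_smul hv hW
  rw [← refl_smul hc, ← h]
  exact hW

theorem IsDefining.eq_of_lin_dvd {W : Subgroup (V l ≃ₗᵢ[ℝ] V l)}
    {α : Submodule ℝ (V l) → Module.Dual ℝ (V l)} (hα : IsDefining W α) {H H' : Submodule ℝ (V l)}
    (hH : H ∈ arrangement W) (hH' : H' ∈ arrangement W)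
    (h : lin (normalVec (α H)) ∣ lin (normalVec (α H'))) : H = H' := by
  obtain ⟨c, hc⟩ := exists_smul_of_lin_dvd h
  have hc0 : c ≠ 0 := by
    rintro rfl
    exact hα.normalVec_ne_zero hH' (by rw [hc, zero_smul])
  rw [hα.eq_orthogonal hH, hα.eq_orthogonal hH', hc,
    Submodule.span_singleton_smul_eq (IsUnit.mk0 c hc0)]

theorem Q_eq_prod {W : Subgroup (V l ≃ₗᵢ[ℝ] V l)} [Finite W]
    (α : Submodule ℝ (V l) → Module.Dual ℝ (V l)) :
    Q W α = ∏ H ∈ (arrangement_finite W).toFinset, lin (normalVec (α H)) := by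
  rw [Q, finprod_mem_eq_finite_toFinset_prod _ (arrangement_finite W)]
  rfl

/-- The factors of `Q` are pairwise non-associated primes. -/
theorem Q_dvd {W : Subgroup (V l ≃ₗᵢ[ℝ] V l)} [Finite W]
    {α : Submodule ℝ (V l) → Module.Dual ℝ (V l)} (hα : IsDefining W α) {f : S l}
    (h : ∀ H ∈ arrangement W, lin (normalVec (α H)) ∣ f) : Q W α ∣ f := by
  rw [Q_eq_prod]
  refine Finset.prod_dvd_of_isRelPrime ?_ fun H hH => h H ((Set.Finite.mem_toFinset _).1 hH)
  intro H hH H' hH' hne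
  simp only [Set.Finite.coe_toFinset] at hH hH'
  exact (lin_prime (hα.normalVec_ne_zero hH)).irreducible.isRelPrime_iff_not_dvd.2
    fun hd => hne (hα.eq_of_lin_dvd hH hH' hd)

theorem lin_dvd_Q {W : Subgroup (V l ≃ₗᵢ[ℝ] V l)} [Finite W]
    {α : Submodule ℝ (V l) → Module.Dual ℝ (V l)} (hα : IsDefining W α) {v : V l} (hv : v ≠ 0)
    (hW : refl v ∈ W) : lin v ∣ Q W α := by
  obtain ⟨c, hc, h⟩ := hα.exists_smul hv hW
  have hH : (Submodule.span ℝ {v})ᗮ ∈ arrangement W := ⟨v, hv, rfl, hW⟩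
  rw [h, lin_smul, ((IsUnit.mk0 c hc).map C).mul_left_dvd, Q_eq_prod]
  exact Finset.dvd_prod_of_mem (fun H => lin (normalVec (α H)))
    ((Set.Finite.mem_toFinset _).2 hH)

theorem Q_ne_zero {W : Subgroup (V l ≃ₗᵢ[ℝ] V l)} [Finite W]
    {α : Submodule ℝ (V l) → Module.Dual ℝ (V l)} (hα : IsDefining W α) : Q W α ≠ 0 := by
  rw [Q_eq_prod]
  exact Finset.prod_ne_zero_iff.2 fun H hH =>
    lin_ne_zero (hα.normalVec_ne_zero ((Set.Finite.mem_toFinset _).1 hH))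

/-- This is the squarefreeness of `Q`: if `∂_n α_H ≠ 0`, then `α_H` does not divide `∂_n Q`, because
it does not divide the summand `(∂_n α_H)·Q/α_H`. -/
theorem Q_dvd_of_dvd_pderiv_mul {W : Subgroup (V l ≃ₗᵢ[ℝ] V l)} [Finite W]
    {α : Submodule ℝ (V l) → Module.Dual ℝ (V l)} (hα : IsDefining W α) {s : S l}
    (h : ∀ n, Q W α ∣ pderiv n (Q W α) * s) : Q W α ∣ s := by
  classical
  refine Q_dvd hα fun H hH => ?_
  have ha := hα.normalVec_ne_zero hH
  have hp := lin_prime ha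
  have hH' := (Set.Finite.mem_toFinset (arrangement_finite W)).2 hH
  by_contra hs
  obtain ⟨n, hn⟩ : ∃ n, normalVec (α H) n ≠ 0 := by
    by_contra! h0
    exact ha (by ext n; simpa using h0 n)
  have hQ := Q_eq_prod (W := W) α
  rw [← Finset.mul_prod_erase _ _ hH'] at hQ
  set q' := ∏ H' ∈ (arrangement_finite W).toFinset.erase H, lin (normalVec (α H'))
  have h1 : lin (normalVec (α H)) ∣ pderiv n (Q W α) :=
    (hp.dvd_or_dvd (((Dvd.intro _ hQ.symm).trans (h n)))).resolve_right hs
  rw [hQ, Derivation.leibniz, pderiv_lin, smul_eq_mul, smul_eq_mul] at h1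
  have h2 := (Dvd.intro (pderiv n q') rfl : lin (normalVec (α H)) ∣ _)
  rw [dvd_add_right h2, ((IsUnit.mk0 _ hn).map C).dvd_mul_right] at h1
  obtain ⟨H', hmem, h3⟩ := (hp.dvd_finsetProd_iff _).1 h1
  rw [Finset.mem_erase, Set.Finite.mem_toFinset] at hmem
  exact hmem.1 (hα.eq_of_lin_dvd hH hmem.2 h3).symm

theorem Q_isHomogeneous {W : Subgroup (V l ≃ₗᵢ[ℝ] V l)} [Finite W]
    (α : Submodule ℝ (V l) → Module.Dual ℝ (V l)) :
    (Q W α).IsHomogeneous (arrangement W).ncard := by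
  rw [Q_eq_prod, Set.ncard_eq_toFinset_card _ (arrangement_finite W)]
  have := IsHomogeneous.prod (arrangement_finite W).toFinset
    (fun H => lin (normalVec (α H))) (fun _ => 1) fun H _ => lin_isHomogeneous _
  simpa using this

theorem actMat_mul_map_jac {f : Fin l → S l} {w : V l ≃ₗᵢ[ℝ] V l}
    (h : ∀ j, act w (f j) = f j) : (jac f).map (act w) = actMat w * jac f := by
  have h1 : jac f = (actMat w).transpose * (jac f).map (act w) := by
    ext1 n j
    have := pderiv_act w n (f j)
    rw [h] at this
    simpa [jac, Matrix.mul_apply] using this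
  conv_rhs => rw [h1, ← mul_assoc, actMat_mul_transpose, one_mul]

theorem det_actMat_refl {v : V l} (hv : v ≠ 0) : (actMat (refl v)).det = -1 := by
  have h : actMat (refl v) =
      (C : ℝ →+* S l).mapMatrix (LinearMap.toMatrix (EuclideanSpace.basisFun (Fin l) ℝ).toBasis
        (EuclideanSpace.basisFun (Fin l) ℝ).toBasis (refl v).toLinearEquiv.toLinearMap) := by
    ext1 n m
    simp [actMat, LinearMap.toMatrix_apply]
  rw [h, ← RingHom.map_det, LinearMap.det_toMatrix, refl, Submodule.det_reflection]
  rw [Submodule.orthogonal_orthogonal, finrank_span_singleton hv]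
  simp

theorem act_det_jac {f : Fin l → S l} {w : V l ≃ₗᵢ[ℝ] V l}
    (h : ∀ j, act w (f j) = f j) : act w (jac f).det = (actMat w).det * (jac f).det := by
  rw [← Matrix.det_mul, ← actMat_mul_map_jac h]
  exact (act w : S l →+* S l).map_det (jac f)

theorem IsBasicInvariants.act_eq {W : Subgroup (V l ≃ₗᵢ[ℝ] V l)} {g : Fin l → S l}
    (hg : IsBasicInvariants W g) {w : V l ≃ₗᵢ[ℝ] V l} (hw : w ∈ W) (j : Fin l) :
    act w (g j) = g j :=
  mem_invariants_iff.1 (hg.adjoin_eq ▸ Algebra.subset_adjoin ⟨j, rfl⟩) w hw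

/-- `Q` divides `det J` by anti-invariance. An irreducible factor of the quotient divides a product
of orbit differences, hence is a linear form `lin β`; it would then divide `det J` once without
`refl β` being in `W`, or twice, against `exists_dvd_of_not_dvd`. -/
theorem exists_det_jac_eq {W : Subgroup (V l ≃ₗᵢ[ℝ] V l)} [Finite W]
    {α : Submodule ℝ (V l) → Module.Dual ℝ (V l)} (hα : IsDefining W α) {g : Fin l → S l}
    (hg : IsBasicInvariants W g) : ∃ c : ℝ, c ≠ 0 ∧ (jac g).det = C c * Q W α := by
  classical
  obtain ⟨q, hq⟩ : Q W α ∣ (jac g).det := Q_dvd hα fun H hH => by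
    refine lin_dvd_of_act_refl_eq_neg ?_
    rw [act_det_jac (hg.act_eq (hα.refl_mem hH)), det_actMat_refl (hα.normalVec_ne_zero hH),
      neg_one_mul]
  have hdvd := det_jac_dvd hg (EuclideanSpace.basisFun (Fin l) ℝ)
    (EuclideanSpace.basisFun (Fin l) ℝ).toBasis.linearIndependent
  have hne : ∏ k, orbDiff W (EuclideanSpace.basisFun (Fin l) ℝ k) ≠ 0 :=
    Finset.prod_ne_zero_iff.2 fun k _ => Finset.prod_ne_zero_iff.2 fun z hz =>
      lin_ne_zero (sub_ne_zero.2 (Finset.ne_of_mem_erase hz).symm)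
  have hq0 : q ≠ 0 := by
    rintro rfl
    rw [hq, mul_zero, zero_dvd_iff] at hdvd
    exact hne hdvd
  have hu : IsUnit q := by
    by_contra hu
    obtain ⟨p, hp, hpq⟩ := WfDvdMonoid.exists_irreducible_factor hu hq0
    have hp' := hp.prime
    obtain ⟨k, -, h⟩ := (hp'.dvd_finsetProd_iff _).1 ((hpq.trans (Dvd.intro_left _ hq.symm)).trans hdvd)
    obtain ⟨z, hz, h⟩ := (hp'.dvd_finsetProd_iff _).1 h
    set β := EuclideanSpace.basisFun (Fin l) ℝ k - z
    have hβ : β ≠ 0 := sub_ne_zero.2 (Finset.ne_of_mem_erase hz).symm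
    have hβq : lin β ∣ q :=
      ((hp.associated_of_dvd (lin_prime hβ).irreducible h).dvd_iff_dvd_left).1 hpq
    obtain ⟨A, hA, h | ⟨hW, h⟩⟩ := exists_dvd_of_not_dvd hg hβ
    · exact hA ((hβq.trans (Dvd.intro_left _ hq.symm)).trans h)
    · have h2 : lin β * lin β ∣ lin β * A :=
        (mul_dvd_mul (lin_dvd_Q hα hβ hW) hβq).trans (hq ▸ h)
      exact hA ((mul_dvd_mul_iff_left (lin_ne_zero hβ)).1 h2)
  obtain ⟨c, hc, rfl⟩ := MvPolynomial.isUnit_iff_eq_C_of_isReduced.1 hu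
  exact ⟨c, hc.ne_zero, by rw [hq, mul_comm]⟩

end CoxeterLog

namespace CoxeterLog

variable {l : ℕ}

/-! ### Roots and simple systems -/

/-- The unit normals of the reflecting hyperplanes. -/
def roots (W : Subgroup (V l ≃ₗᵢ[ℝ] V l)) : Set (V l) := {v | ‖v‖ = 1 ∧ refl v ∈ W}

theorem ne_zero_of_mem_roots {W : Subgroup (V l ≃ₗᵢ[ℝ] V l)} {v : V l} (hv : v ∈ roots W) :
    v ≠ 0 := by
  rintro rfl
  simpa using hv.1

theorem inner_self_of_mem_roots {W : Subgroup (V l ≃ₗᵢ[ℝ] V l)} {v : V l} (hv : v ∈ roots W) :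
    inner ℝ v v = 1 := by
  rw [real_inner_self_eq_norm_sq, hv.1, one_pow]

theorem refl_apply_of_mem_roots {W : Subgroup (V l ≃ₗᵢ[ℝ] V l)} {v : V l} (hv : v ∈ roots W)
    (x : V l) : refl v x = x - (2 * inner ℝ v x) • v := by
  rw [refl_apply, inner_self_of_mem_roots hv, div_one]

theorem eq_or_eq_neg_of_smul {u v : V l} (hu : ‖u‖ = 1) (hv : ‖v‖ = 1) {c : ℝ} (h : u = c • v) :
    u = v ∨ u = -v := by
  rw [h, norm_smul, hv, mul_one, Real.norm_eq_abs, abs_eq zero_le_one] at hu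
  rcases hu with rfl | rfl
  · left; rw [h, one_smul]
  · right; rw [h, neg_one_smul]

theorem roots_finite (W : Subgroup (V l ≃ₗᵢ[ℝ] V l)) [Finite W] : (roots W).Finite := by
  refine Set.Finite.of_finite_fibers (fun v => (Submodule.span ℝ {v})ᗮ)
    ((arrangement_finite W).subset ?_) ?_
  · rintro _ ⟨v, hv, rfl⟩
    exact ⟨v, ne_zero_of_mem_roots hv, rfl, hv.2⟩
  · rintro _ ⟨v, hv, rfl⟩
    refine (Set.toFinite {v, -v}).subset ?_
    rintro u ⟨hu, h⟩
    obtain ⟨c, hc⟩ := exists_smul_of_orthogonal_eq h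
    exact eq_or_eq_neg_of_smul hu.1 hv.1 hc

theorem neg_mem_roots {W : Subgroup (V l ≃ₗᵢ[ℝ] V l)} {v : V l} (hv : v ∈ roots W) :
    -v ∈ roots W := by
  refine ⟨by rw [norm_neg, hv.1], ?_⟩
  rw [← neg_one_smul ℝ v, refl_smul (by norm_num)]
  exact hv.2

theorem refl_map (w : V l ≃ₗᵢ[ℝ] V l) (v : V l) : refl (w v) = w * refl v * w⁻¹ := by
  ext1 x
  change refl (w v) x = w (refl v (w.symm x))
  have h : inner ℝ (w v) x = inner ℝ v (w.symm x) := by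
    rw [← w.inner_map_map v, w.apply_symm_apply]
  rw [refl_apply, refl_apply, map_sub, map_smul, w.apply_symm_apply, w.inner_map_map, h]

theorem map_mem_roots {W : Subgroup (V l ≃ₗᵢ[ℝ] V l)} {w : V l ≃ₗᵢ[ℝ] V l} (hw : w ∈ W)
    {v : V l} (hv : v ∈ roots W) : w v ∈ roots W := by
  refine ⟨by rw [w.norm_map, hv.1], ?_⟩
  rw [refl_map]
  exact W.mul_mem (W.mul_mem hw hv.2) (W.inv_mem hw)

theorem exists_root_smul {W : Subgroup (V l ≃ₗᵢ[ℝ] V l)} {v : V l} (hv : v ≠ 0)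
    (hW : refl v ∈ W) : ∃ u ∈ roots W, ∃ c : ℝ, c ≠ 0 ∧ v = c • u := by
  have hn := norm_ne_zero_iff.2 hv
  refine ⟨‖v‖⁻¹ • v, ⟨?_, ?_⟩, ‖v‖, hn, ?_⟩
  · rw [norm_smul, norm_inv, norm_norm, inv_mul_cancel₀ hn]
  · rwa [refl_smul (inv_ne_zero hn)]
  · rw [smul_smul, mul_inv_cancel₀ hn, one_smul]

theorem exists_regular (W : Subgroup (V l ≃ₗᵢ[ℝ] V l)) [Finite W] :
    ∃ x : V l, ∀ v ∈ roots W, inner ℝ v x ≠ 0 := by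
  classical
  have h := Subspace.biUnion_ne_univ_of_top_notMem
    (s := (roots_finite W).toFinset.image fun v => (Submodule.span ℝ {v})ᗮ) (by
      simp only [Finset.mem_image, Set.Finite.mem_toFinset, not_exists, not_and]
      intro v hv h
      have : v ∈ (Submodule.span ℝ {v})ᗮ := h ▸ Submodule.mem_top
      rw [Submodule.mem_orthogonal_singleton_iff_inner_right, inner_self_of_mem_roots hv] at this
      exact one_ne_zero this)
  rw [Set.ne_univ_iff_exists_notMem] at h
  obtain ⟨y, hy⟩ := h
  simp only [Set.mem_iUnion, not_exists] at hy
  exact ⟨y, fun v hv h0 => hy _ (Finset.mem_image_of_mem _ ((roots_finite W).mem_toFinset.2 hv))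
    (Submodule.mem_orthogonal_singleton_iff_inner_right.2 h0)⟩

/-- If every reflection of a Coxeter group preserves a subspace, the subspace is trivial. -/
theorem IsFiniteCoxeterGroup.eq_bot_or_eq_top {W : Subgroup (V l ≃ₗᵢ[ℝ] V l)}
    (hW : IsFiniteCoxeterGroup W) (U : Submodule ℝ (V l))
    (hU : ∀ v ∈ roots W, ∀ u ∈ U, refl v u ∈ U) : U = ⊥ ∨ U = ⊤ := by
  have := hW.finite
  have hle : Subgroup.closure {r | r ∈ W ∧ ∃ v : V l, v ≠ 0 ∧ r = refl v} ≤
      { carrier := {w | ∀ u ∈ U, w u ∈ U}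
        mul_mem' := fun {a b} ha hb u hu => ha _ (hb u hu)
        one_mem' := fun u hu => hu
        inv_mem' := fun {w} hw u hu => by
          have hmap : U.map w.toLinearEquiv.toLinearMap = U := by
            refine Submodule.eq_of_le_of_finrank_eq ?_ (LinearEquiv.finrank_map_eq _ _)
            rintro _ ⟨x, hx, rfl⟩
            exact hw x hx
          rw [← hmap] at hu
          obtain ⟨x, hx, rfl⟩ := hu
          change w.symm (w x) ∈ U
          rwa [w.symm_apply_apply] } := by
    rw [Subgroup.closure_le]
    rintro r ⟨hr, v, hv, rfl⟩ u hu
    obtain ⟨v', hv', c, hc, rfl⟩ := exists_root_smul hv hr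
    rw [refl_smul hc]
    exact hU v' hv' u hu
  rw [hW.generated] at hle
  exact hW.irreducible U fun w hw => hle hw

theorem exists_submodule_ne (hl : 2 ≤ l) {v : V l} (hv : v ≠ 0) :
    Submodule.span ℝ {v} ≠ ⊥ ∧ Submodule.span ℝ {v} ≠ ⊤ := by
  refine ⟨by simpa using hv, fun h => ?_⟩
  have h1 := finrank_span_singleton (K := ℝ) hv
  rw [h, finrank_top, finrank_euclideanSpace_fin] at h1
  omega

/-- The span is stable. Were it zero, there would be no reflections and every line would be stable,
which `2 ≤ l` forbids. -/
theorem IsFiniteCoxeterGroup.span_roots {W : Subgroup (V l ≃ₗᵢ[ℝ] V l)}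
    (hW : IsFiniteCoxeterGroup W) (hl : 2 ≤ l) : Submodule.span ℝ (roots W) = ⊤ := by
  have hU := hW.eq_bot_or_eq_top (Submodule.span ℝ (roots W)) fun v hv u hu => by
    rw [refl_apply]
    exact sub_mem hu (Submodule.smul_mem _ _ (Submodule.subset_span hv))
  refine hU.resolve_left fun h => ?_
  obtain ⟨x, hx⟩ := @exists_ne _ hW.nontrivial (0 : V l)
  have hne := exists_submodule_ne hl hx
  rcases hW.eq_bot_or_eq_top (Submodule.span ℝ {x}) (fun v hv => by
    exact absurd ((Submodule.mem_bot ℝ).1 (h ▸ Submodule.subset_span hv))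
      (ne_zero_of_mem_roots hv)) with h | h
  · exact hne.1 h
  · exact hne.2 h

/-- A system of simple roots for `W`, with respect to a regular vector `x`. -/
structure IsSimpleSystem (W : Subgroup (V l ≃ₗᵢ[ℝ] V l)) (x : V l)
    (b : Module.Basis (Fin l) ℝ (V l)) : Prop where
  regular : ∀ v ∈ roots W, inner ℝ v x ≠ 0
  mem_roots : ∀ i, b i ∈ roots W
  pos : ∀ i, 0 < inner ℝ (b i) x
  nonneg : ∀ v ∈ roots W, 0 < inner ℝ v x → ∀ i, 0 ≤ b.repr v i
  inner_nonpos : ∀ i j, i ≠ j → inner ℝ (b i) (b j) ≤ 0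

/-! ### Existence and basic properties of simple systems -/

/-- Move the negative coefficients of a relation to the other side. The common value has nonpositive
square norm, so it is zero, and pairing with `x` kills the coefficients. -/
theorem linearIndependent_of_inner_nonpos {ι : Type*} [Fintype ι] {v : ι → V l} {x : V l}
    (hx : ∀ i, 0 < inner ℝ (v i) x) (hv : ∀ i j, i ≠ j → inner ℝ (v i) (v j) ≤ 0) :
    LinearIndependent ℝ v := by
  rw [Fintype.linearIndependent_iff]
  intro c hc
  have h0 : ∑ i, (c i)⁺ • v i = ∑ i, (c i)⁻ • v i := by
    rw [← sub_eq_zero, ← Finset.sum_sub_distrib, ← hc]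
    exact Finset.sum_congr rfl fun i _ => by rw [← sub_smul, posPart_sub_negPart]
  have h1 : inner ℝ (∑ i, (c i)⁺ • v i) (∑ i, (c i)⁺ • v i) ≤ 0 := by
    conv_lhs => rw [h0]
    rw [← h0, h0]
    conv_lhs => arg 2; rw [← h0]
    rw [sum_inner]
    refine Finset.sum_nonpos fun i _ => ?_
    rw [inner_sum]
    refine Finset.sum_nonpos fun j _ => ?_
    rw [inner_smul_left, inner_smul_right, conj_trivial, ← mul_assoc]
    by_cases hij : i = j
    · subst hij
      have : (c i)⁺ * (c i)⁻ = 0 := by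
        rcases le_total 0 (c i) with h | h
        · rw [negPart_eq_zero.2 h, mul_zero]
        · rw [posPart_eq_zero.2 h, zero_mul]
      rw [this, zero_mul]
    · exact mul_nonpos_of_nonneg_of_nonpos
        (mul_nonneg (posPart_nonneg _) (negPart_nonneg _)) (hv i j hij)
  have h2 : ∑ i, (c i)⁺ • v i = 0 := real_inner_self_nonpos.1 h1
  have key : ∀ d : ι → ℝ, (∀ i, 0 ≤ d i) → ∑ i, d i • v i = 0 → ∀ i, d i = 0 := by
    intro d hd h i
    have h3 := congrArg (fun y => inner ℝ y x) h
    simp only [sum_inner, inner_smul_left, conj_trivial, inner_zero_left] at h3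
    rw [Finset.sum_eq_zero_iff_of_nonneg fun i _ => mul_nonneg (hd i) (hx i).le] at h3
    exact (mul_eq_zero.1 (h3 i (Finset.mem_univ i))).resolve_right (hx i).ne'
  intro i
  rw [← posPart_sub_negPart (c i), key _ (fun i => posPart_nonneg _) h2 i,
    key _ (fun i => negPart_nonneg _) (h0 ▸ h2) i, sub_zero]

/-- Take a minimal set `Δ` of positive roots whose nonnegative combinations include all positive
roots. If two of its members made an acute angle, expanding the reflection of one in the other would
express a member of `Δ` through the rest. -/
theorem IsFiniteCoxeterGroup.exists_isSimpleSystem {W : Subgroup (V l ≃ₗᵢ[ℝ] V l)}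
    (hW : IsFiniteCoxeterGroup W) (hl : 2 ≤ l) : ∃ x b, IsSimpleSystem W x b := by
  classical
  have := hW.finite
  obtain ⟨x, hx⟩ := exists_regular W
  let P : Set (V l) := {v | v ∈ roots W ∧ 0 < inner ℝ v x}
  have hP : P.Finite := (roots_finite W).subset fun v hv => hv.1
  obtain ⟨Δ, hΔ⟩ := exists_minimal_of_wellFoundedLT
    (fun T : Finset (V l) => (T : Set (V l)) ⊆ P ∧ P ⊆ Submodule.span NNReal (T : Set (V l)))
    ⟨hP.toFinset, by simp, by simp⟩
  have hΔP : ∀ γ ∈ Δ, γ ∈ P := fun γ hγ => hΔ.prop.1 hγ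
  have hspanpos : ∀ T : Finset (V l), T ⊆ Δ → ∀ u ∈ Submodule.span NNReal (T : Set (V l)),
      0 ≤ inner ℝ u x := by
    intro T hT u hu
    induction hu using Submodule.span_induction with
    | mem y hy => exact (hΔP y (hT hy)).2.le
    | zero => simp
    | add y z _ _ hy hz => rw [inner_add_left]; exact add_nonneg hy hz
    | smul a y _ hy =>
      rw [NNReal.smul_def, inner_smul_left]
      exact mul_nonneg a.2 hy
  have hirr : ∀ γ ∈ Δ, γ ∉ Submodule.span NNReal ((Δ.erase γ : Finset (V l)) : Set (V l)) := by
    intro γ hγ h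
    have h1 : Submodule.span NNReal (Δ : Set (V l)) ≤
        Submodule.span NNReal ((Δ.erase γ : Finset (V l)) : Set (V l)) := by
      rw [Submodule.span_le]
      intro δ hδ
      by_cases hδγ : δ = γ
      · rw [hδγ]; exact h
      · exact Submodule.subset_span (Finset.mem_coe.2 (Finset.mem_erase.2 ⟨hδγ, hδ⟩))
    have := hΔ.le_of_le (y := Δ.erase γ) ⟨fun y hy => hΔP y (Finset.mem_of_mem_erase hy),
      hΔ.prop.2.trans h1⟩ (Finset.erase_subset _ _)
    exact Finset.notMem_erase γ Δ (this hγ)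
  -- Pairing with `x` forces `r > 0`; dividing by `r` then makes `γ` redundant in `Δ`.
  have hno : ∀ γ ∈ Δ, ∀ δ ∈ Δ, δ ≠ γ → ∀ r s : ℝ, 0 < s →
      ∀ u ∈ Submodule.span NNReal ((Δ.erase γ : Finset (V l)) : Set (V l)),
      r • γ = s • δ + u → False := by
    intro γ hγ δ hδ hne r s hs u hu h
    have h1 := congrArg (fun y => inner ℝ y x) h
    simp only [inner_add_left, inner_smul_left, conj_trivial] at h1
    have h2 := hspanpos _ (Finset.erase_subset _ _) u hu
    have h3 : 0 < r := by
      have h4 : 0 < r * inner ℝ γ x := by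
        rw [h1]
        exact add_pos_of_pos_of_nonneg (mul_pos hs (hΔP δ hδ).2) h2
      exact (pos_iff_pos_of_mul_pos h4).2 (hΔP γ hγ).2
    refine hirr γ hγ ?_
    have h5 : γ = NNReal.mk r⁻¹ (inv_nonneg.2 h3.le) • (NNReal.mk s hs.le • δ + u) := by
      change γ = r⁻¹ • (s • δ + u)
      rw [← h, smul_smul, inv_mul_cancel₀ h3.ne', one_smul]
    have h6 := Submodule.smul_mem _ (NNReal.mk r⁻¹ (inv_nonneg.2 h3.le))
      (add_mem (Submodule.smul_mem _ (NNReal.mk s hs.le) (Submodule.subset_span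
        (Finset.mem_coe.2 (Finset.mem_erase.2 ⟨hne, hδ⟩)))) hu)
    rwa [← h5] at h6
  have hdec : ∀ ρ ∈ P, ∀ γ ∈ Δ, ∃ a : NNReal,
      ∃ u ∈ Submodule.span NNReal ((Δ.erase γ : Finset (V l)) : Set (V l)), ρ = a • γ + u := by
    intro ρ hρ γ hγ
    have := hΔ.prop.2 hρ
    rw [← Finset.insert_erase hγ, Finset.coe_insert, SetLike.mem_coe,
      Submodule.mem_span_insert] at this
    exact this
  have hobt : ∀ γ ∈ Δ, ∀ δ ∈ Δ, γ ≠ δ → inner ℝ γ δ ≤ 0 := by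
    intro γ hγ δ hδ hne
    by_contra! hpos
    have hr := refl_apply_of_mem_roots (hΔP γ hγ).1 δ
    have hroot := map_mem_roots (hΔP γ hγ).1.2 (hΔP δ hδ).1
    rcases lt_or_gt_of_ne (hx _ hroot) with hneg | hp
    · have hmem : -(refl γ δ) ∈ P := ⟨neg_mem_roots hroot, by rw [inner_neg_left]; linarith⟩
      obtain ⟨a, u, hu, h⟩ := hdec _ hmem γ hγ
      refine hno γ hγ δ hδ hne.symm (2 * inner ℝ γ δ - a) 1 one_pos u hu ?_
      rw [hr, NNReal.smul_def] at h
      rw [sub_smul, one_smul, sub_eq_iff_eq_add, add_assoc, add_comm u, ← h]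
      abel
    · have hmem : refl γ δ ∈ P := ⟨hroot, hp⟩
      obtain ⟨a, u, hu, h⟩ := hdec _ hmem δ hδ
      refine hno δ hδ γ hγ hne (1 - a) (2 * inner ℝ γ δ) (by linarith) u hu ?_
      rw [hr, NNReal.smul_def] at h
      rw [sub_smul, one_smul, sub_eq_iff_eq_add, add_assoc, add_comm u, ← h]
      abel
  have hli : LinearIndependent ℝ (fun γ : Δ => (γ : V l)) :=
    linearIndependent_of_inner_nonpos (fun γ => (hΔP γ γ.2).2) fun γ δ hne =>
      hobt γ γ.2 δ δ.2 fun h => hne (Subtype.ext h)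
  have hle : ∀ v ∈ Submodule.span NNReal (Δ : Set (V l)),
      v ∈ Submodule.span ℝ (Set.range fun γ : Δ => (γ : V l)) := by
    intro v hv
    induction hv using Submodule.span_induction with
    | mem y hy => exact Submodule.subset_span ⟨⟨y, hy⟩, rfl⟩
    | zero => exact zero_mem _
    | add y z _ _ hy hz => exact add_mem hy hz
    | smul a y _ hy => exact Submodule.smul_mem _ (a : ℝ) hy
  have hspan : ⊤ ≤ Submodule.span ℝ (Set.range fun γ : Δ => (γ : V l)) := by
    rw [← hW.span_roots hl, Submodule.span_le]
    intro v hv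
    rcases lt_or_gt_of_ne (hx v hv) with hneg | hp
    · rw [SetLike.mem_coe, ← neg_mem_iff]
      exact hle _ (hΔ.prop.2 ⟨neg_mem_roots hv, by rw [inner_neg_left]; linarith⟩)
    · exact hle _ (hΔ.prop.2 ⟨hv, hp⟩)
  let b₀ := Module.Basis.mk hli hspan
  have hcard : Fintype.card Δ = l := by
    rw [← Module.finrank_eq_card_basis b₀, finrank_euclideanSpace_fin]
  let e := Fintype.equivFinOfCardEq hcard
  let b := b₀.reindex e
  have hb : ∀ i, b i = (e.symm i : V l) := fun i => by simp [b, b₀]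
  refine ⟨x, b, hx, fun i => ?_, fun i => ?_, ?_, ?_⟩
  · rw [hb]; exact (hΔP _ (e.symm i).2).1
  · rw [hb]; exact (hΔP _ (e.symm i).2).2
  · intro v hv hpos i
    have := hΔ.prop.2 ⟨hv, hpos⟩
    rw [SetLike.mem_coe] at this
    clear hpos hv
    induction this using Submodule.span_induction with
    | mem y hy =>
      have : y = b (e ⟨y, hy⟩) := by rw [hb, e.symm_apply_apply]
      rw [this, Module.Basis.repr_self, Finsupp.single_apply]
      split_ifs <;> norm_num
    | zero => simp
    | add y z _ _ hy hz => rw [map_add]; exact add_nonneg hy hz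
    | smul a y _ hy =>
      rw [NNReal.smul_def, map_smul]
      exact mul_nonneg a.2 hy
  · intro i j hij
    rw [hb, hb]
    exact hobt _ (e.symm i).2 _ (e.symm j).2 fun h => hij (e.symm.injective (Subtype.ext h))

namespace IsSimpleSystem

variable {W : Subgroup (V l ≃ₗᵢ[ℝ] V l)} {x : V l} {b : Module.Basis (Fin l) ℝ (V l)}

theorem inner_self (h : IsSimpleSystem W x b) (i : Fin l) : inner ℝ (b i) (b i) = 1 :=
  inner_self_of_mem_roots (h.mem_roots i)

theorem refl_apply (h : IsSimpleSystem W x b) (i : Fin l) (v : V l) :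
    refl (b i) v = v - (2 * inner ℝ (b i) v) • b i :=
  refl_apply_of_mem_roots (h.mem_roots i) v

theorem repr_refl (h : IsSimpleSystem W x b) {i j : Fin l} (hij : i ≠ j) (v : V l) :
    b.repr (refl (b i) v) j = b.repr v j := by
  rw [h.refl_apply, map_sub, map_smul, b.repr_self]
  simp [hij]

/-- A root with a positive coordinate is positive. -/
theorem pos_of_repr_pos (h : IsSimpleSystem W x b) {v : V l} (hv : v ∈ roots W) {i : Fin l}
    (hi : 0 < b.repr v i) : 0 < inner ℝ v x := by
  refine lt_of_le_of_ne (not_lt.1 fun hneg => ?_) (h.regular v hv).symm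
  have := h.nonneg (-v) (neg_mem_roots hv) (by rw [inner_neg_left]; linarith) i
  rw [map_neg, Finsupp.neg_apply] at this
  linarith

/-- Roots are unit vectors, so a positive root proportional to `b i` equals `b i`. -/
theorem exists_repr_pos (h : IsSimpleSystem W x b) {v : V l} (hv : v ∈ roots W)
    (hpos : 0 < inner ℝ v x) {i : Fin l} (hi : v ≠ b i) : ∃ j, i ≠ j ∧ 0 < b.repr v j := by
  by_contra! hcon
  have h0 : ∀ j, i ≠ j → b.repr v j = 0 := fun j hj =>
    le_antisymm (hcon j hj) (h.nonneg v hv hpos j)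
  have hvi : v = b.repr v i • b i := by
    conv_lhs => rw [← b.sum_repr v]
    rw [Finset.sum_eq_single i]
    · intro j _ hj; rw [h0 j hj.symm, zero_smul]
    · simp
  rcases eq_or_eq_neg_of_smul hv.1 (h.mem_roots i).1 hvi with h1 | h1
  · exact hi h1
  · have := h.pos i
    rw [h1, inner_neg_left] at hpos
    linarith

/-- The reflection changes only coordinate `i`, and `v` has another positive coordinate, which
survives. -/
theorem refl_pos (h : IsSimpleSystem W x b) {v : V l} (hv : v ∈ roots W)
    (hpos : 0 < inner ℝ v x) {i : Fin l} (hi : v ≠ b i) : 0 < inner ℝ (refl (b i) v) x := by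
  obtain ⟨j, hij, hj⟩ := h.exists_repr_pos hv hpos hi
  refine h.pos_of_repr_pos (map_mem_roots (h.mem_roots i).2 hv) (i := j) ?_
  rwa [h.repr_refl hij]

theorem exists_inner_pos (h : IsSimpleSystem W x b) {v : V l} (hv : v ∈ roots W)
    (hpos : 0 < inner ℝ v x) : ∃ i, 0 < inner ℝ (b i) v := by
  by_contra! hcon
  have h1 : inner ℝ v v ≤ 0 := by
    conv_lhs => arg 2; rw [← b.sum_repr v]
    rw [sum_inner]
    refine Finset.sum_nonpos fun i _ => ?_
    rw [inner_smul_left, conj_trivial]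
    exact mul_nonpos_of_nonneg_of_nonpos (h.nonneg v hv hpos i) (hcon i)
  rw [inner_self_of_mem_roots hv] at h1
  linarith

/-- Among counterexamples minimise `⟨v, x⟩`. Some simple root has positive product with `v`, and
reflecting in it lowers `⟨v, x⟩` while keeping the root positive. -/
theorem induction (h : IsSimpleSystem W x b) [Finite W] {p : V l → Prop}
    (simple : ∀ i, p (b i)) (step : ∀ i v, v ∈ roots W → p (refl (b i) v) → p v) {v : V l}
    (hv : v ∈ roots W) (hpos : 0 < inner ℝ v x) : p v := by
  classical
  by_contra hcon
  let T := (roots_finite W).toFinset.filter fun v => 0 < inner ℝ v x ∧ ¬ p v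
  obtain ⟨u, hu, hmin⟩ := T.exists_min_image (fun v => inner ℝ v x)
    ⟨v, by simp [T, hv, hpos, hcon]⟩
  simp only [T, Finset.mem_filter, Set.Finite.mem_toFinset] at hu hmin
  obtain ⟨i, hi⟩ := h.exists_inner_pos hu.1 hu.2.1
  have hne : u ≠ b i := fun h0 => hu.2.2 (h0 ▸ simple i)
  have hr := map_mem_roots (h.mem_roots i).2 hu.1
  have hrp := h.refl_pos hu.1 hu.2.1 hne
  have := hmin _ ⟨hr, hrp, fun hp => hu.2.2 (step i u hu.1 hp)⟩
  rw [h.refl_apply, inner_sub_left, inner_smul_left, conj_trivial] at this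
  have := mul_pos (mul_pos two_pos hi) (h.pos i)
  linarith

/-- The Coxeter diagram of an irreducible group is connected. -/
theorem eq_empty_or_univ (h : IsSimpleSystem W x b) (hW : IsFiniteCoxeterGroup W)
    (I : Set (Fin l)) (hI : ∀ i ∈ I, ∀ j ∉ I, inner ℝ (b i) (b j) = 0) :
    I = ∅ ∨ I = Set.univ := by
  have := hW.finite
  -- Each root lies in `U` or in `Uᗮ`: this holds for simple roots and passes through simple
  -- reflections. Hence all reflections preserve `U`.
  let U := Submodule.span ℝ (b '' I)
  have hbU : ∀ i ∈ I, b i ∈ U := fun i hi => Submodule.subset_span ⟨i, hi, rfl⟩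
  have hbU' : ∀ j ∉ I, b j ∈ Uᗮ := by
    intro j hj
    rw [Submodule.mem_orthogonal]
    intro u hu
    induction hu using Submodule.span_induction with
    | mem y hy => obtain ⟨i, hi, rfl⟩ := hy; exact hI i hi j hj
    | zero => simp
    | add y z _ _ hy hz => rw [inner_add_left, hy, hz, add_zero]
    | smul a y _ hy => rw [inner_smul_left, hy, mul_zero]
  have hstable : ∀ i v, (v ∈ U ∨ v ∈ Uᗮ) → (refl (b i) v ∈ U ∨ refl (b i) v ∈ Uᗮ) := by
    intro i v hv
    by_cases hi : i ∈ I
    · rcases hv with hv | hv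
      · left
        rw [h.refl_apply]
        exact sub_mem hv (Submodule.smul_mem _ _ (hbU i hi))
      · right
        rwa [refl_of_inner_eq_zero ((Submodule.mem_orthogonal _ _).1 hv _ (hbU i hi))]
    · rcases hv with hv | hv
      · left
        rwa [refl_of_inner_eq_zero ((Submodule.mem_orthogonal' _ _).1 (hbU' i hi) _ hv)]
      · right
        rw [h.refl_apply]
        exact sub_mem hv (Submodule.smul_mem _ _ (hbU' i hi))
  have hpos : ∀ v ∈ roots W, 0 < inner ℝ v x → v ∈ U ∨ v ∈ Uᗮ := by
    intro v hv hp
    refine h.induction (p := fun v => v ∈ U ∨ v ∈ Uᗮ) (fun i => ?_) (fun i v _ hv => ?_) hv hp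
    · by_cases hi : i ∈ I
      · exact Or.inl (hbU i hi)
      · exact Or.inr (hbU' i hi)
    · rw [← refl_refl (b i) v]
      exact hstable i _ hv
  have hall : ∀ v ∈ roots W, v ∈ U ∨ v ∈ Uᗮ := by
    intro v hv
    rcases lt_or_gt_of_ne (h.regular v hv) with hn | hp
    · have := hpos (-v) (neg_mem_roots hv) (by rw [inner_neg_left]; linarith)
      rwa [neg_mem_iff, neg_mem_iff] at this
    · exact hpos v hv hp
  rcases hW.eq_bot_or_eq_top U fun v hv u hu => by
    rcases hall v hv with hv' | hv'
    · rw [CoxeterLog.refl_apply]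
      exact sub_mem hu (Submodule.smul_mem _ _ hv')
    · rwa [refl_of_inner_eq_zero ((Submodule.mem_orthogonal' _ _).1 hv' _ hu)] with h0 | h0
  · left
    ext i
    simp only [Set.mem_empty_iff_false, iff_false]
    intro hi
    have := hbU i hi
    rw [h0, Submodule.mem_bot] at this
    exact b.ne_zero i this
  · right
    ext i
    simp only [Set.mem_univ, iff_true]
    by_contra hi
    have := hbU' i hi
    rw [h0, Submodule.top_orthogonal_eq_bot, Submodule.mem_bot] at this
    exact b.ne_zero i this

/-! ### The Coxeter diagram and its Perron vector -/

/-- The root `s_j s_i b_j` has coordinates `-2κ > 0` and `4κ² - 1`, so the latter cannot be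
negative. -/
theorem inner_le_neg_half (h : IsSimpleSystem W x b) {i j : Fin l} (hij : i ≠ j)
    (hne : inner ℝ (b i) (b j) ≠ 0) : inner ℝ (b i) (b j) ≤ -(1 / 2 : ℝ) := by
  by_contra! hlt
  set κ : ℝ := inner ℝ (b i) (b j) with hκ
  have hneg : κ < 0 := lt_of_le_of_ne (h.inner_nonpos i j hij) hne
  have hji : inner ℝ (b j) (b i) = κ := real_inner_comm _ _
  let v := refl (b j) (refl (b i) (b j))
  have hv : v ∈ roots W :=
    map_mem_roots (h.mem_roots j).2 (map_mem_roots (h.mem_roots i).2 (h.mem_roots j))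
  have hveq : v = (-(2 * κ)) • b i + (4 * κ ^ 2 - 1) • b j := by
    simp only [v]
    rw [h.refl_apply i, ← hκ, h.refl_apply j, inner_sub_right, inner_smul_right, hji, h.inner_self]
    module
  have hri : b.repr v i = -(2 * κ) := by
    rw [hveq]; simp [hij.symm]
  have hrj : b.repr v j = 4 * κ ^ 2 - 1 := by
    rw [hveq]; simp [hij]
  have hp := h.pos_of_repr_pos hv (i := i) (by rw [hri]; linarith)
  have := h.nonneg v hv hp j
  rw [hrj] at this
  nlinarith

/-- The Coxeter diagram is a forest, hence bipartite. -/
theorem exists_coloring (h : IsSimpleSystem W x b) :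
    ∃ c : Fin l → Bool, ∀ i j, i ≠ j → c i = c j → inner ℝ (b i) (b j) = 0 := by
  classical
  suffices H : ∀ n, ∀ T : Finset (Fin l), T.card = n →
      ∃ c : Fin l → Bool, ∀ i ∈ T, ∀ j ∈ T, i ≠ j → c i = c j → inner ℝ (b i) (b j) = 0 by
    obtain ⟨c, hc⟩ := H _ Finset.univ rfl
    exact ⟨c, fun i j => hc i (Finset.mem_univ i) j (Finset.mem_univ j)⟩
  intro n
  induction n with
  | zero =>
    intro T hT
    rw [Finset.card_eq_zero] at hT
    exact ⟨fun _ => true, by simp [hT]⟩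
  | succ n ih =>
    intro T hT
    have hTne : T.Nonempty := Finset.card_pos.1 (by omega)
    -- The sum is `‖∑ b i‖²`, so some row sum is positive. With `1` on the diagonal and nonzero
    -- off-diagonal entries at most `-1/2`, vertex `i` has at most one neighbour in `T`; colour the
    -- rest, then `i`.
    have hsum : 0 < ∑ i ∈ T, ∑ j ∈ T, inner ℝ (b i) (b j) := by
      have hne : ∑ i ∈ T, b i ≠ 0 := by
        intro h0
        have := congrArg (fun y => inner ℝ y x) h0
        simp only [sum_inner, inner_zero_left] at this
        exact (Finset.sum_pos (fun i _ => h.pos i) hTne).ne' this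
      have := real_inner_self_pos.2 hne
      rw [sum_inner] at this
      simpa only [inner_sum] using this
    obtain ⟨i, hi, hipos⟩ : ∃ i ∈ T, 0 < ∑ j ∈ T, inner ℝ (b i) (b j) := by
      by_contra! hcon
      exact absurd (Finset.sum_nonpos hcon) (not_le.2 hsum)
    obtain ⟨c, hc⟩ := ih (T.erase i) (by rw [Finset.card_erase_of_mem hi, hT]; rfl)
    rw [← Finset.add_sum_erase _ _ hi, h.inner_self] at hipos
    have huniq : ∀ j ∈ T.erase i, ∀ k ∈ T.erase i, inner ℝ (b i) (b j) ≠ 0 →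
        inner ℝ (b i) (b k) ≠ 0 → j = k := by
      intro j hj k hk hij hik
      by_contra hjk
      have h1 := h.inner_le_neg_half (Finset.ne_of_mem_erase hj).symm hij
      have h2 := h.inner_le_neg_half (Finset.ne_of_mem_erase hk).symm hik
      rw [← Finset.add_sum_erase _ _ hj,
        ← Finset.add_sum_erase _ _ (Finset.mem_erase.2 ⟨Ne.symm hjk, hk⟩)] at hipos
      have h3 : ∑ m ∈ ((T.erase i).erase j).erase k, inner ℝ (b i) (b m) ≤ 0 :=
        Finset.sum_nonpos fun m hm => h.inner_nonpos i m
          (Finset.ne_of_mem_erase (Finset.mem_of_mem_erase (Finset.mem_of_mem_erase hm))).symm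
      linarith
    obtain ⟨d, hd⟩ : ∃ d : Bool, ∀ j ∈ T.erase i, inner ℝ (b i) (b j) ≠ 0 → d ≠ c j := by
      by_cases hex : ∃ j ∈ T.erase i, inner ℝ (b i) (b j) ≠ 0
      · obtain ⟨j, hj, hij⟩ := hex
        refine ⟨!(c j), fun k hk hik => ?_⟩
        rw [huniq k hk j hj hik hij]
        simp
      · push Not at hex
        exact ⟨true, fun j hj hij => absurd (hex j hj) hij⟩
    refine ⟨Function.update c i d, fun j hj k hk hjk hcjk => ?_⟩
    by_cases hji : j = i
    · subst hji
      rw [Function.update_self, Function.update_of_ne hjk.symm] at hcjk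
      by_contra h0
      exact hd k (Finset.mem_erase.2 ⟨hjk.symm, hk⟩) h0 hcjk
    · by_cases hki : k = i
      · subst hki
        rw [Function.update_self, Function.update_of_ne hjk] at hcjk
        by_contra h0
        rw [real_inner_comm] at h0
        exact hd j (Finset.mem_erase.2 ⟨hjk, hj⟩) h0 hcjk.symm
      · rw [Function.update_of_ne hji, Function.update_of_ne hki] at hcjk
        exact hc j (Finset.mem_erase.2 ⟨hji, hj⟩) k (Finset.mem_erase.2 ⟨hki, hk⟩) hjk hcjk

/-- The Perron–Frobenius vector of the Gram matrix of the simple roots. -/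
theorem exists_perron (h : IsSimpleSystem W x b) (hW : IsFiniteCoxeterGroup W) :
    ∃ (a : Fin l → ℝ) (r : ℝ), (∀ i, 0 < a i) ∧ 0 < r ∧
      ∀ i, inner ℝ (b i) (∑ j, a j • b j) = r * a i := by
  have := hW.nontrivial
  let L : V l →L[ℝ] V l := LinearMap.toContinuousLinearMap
    ((EuclideanSpace.basisFun (Fin l) ℝ).toBasis.constr ℝ b)
  have hL : ∀ a : V l, L a = ∑ j, a j • b j := by
    intro a
    simp [L, Module.Basis.constr_apply_fintype]
  let T : V l →L[ℝ] V l := (ContinuousLinearMap.adjoint L) ∘L L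
  have hT : ∀ a c, inner ℝ (T a) c = inner ℝ (L a) (L c) := by
    intro a c
    simp only [T, ContinuousLinearMap.comp_apply]
    rw [ContinuousLinearMap.adjoint_inner_left]
  have hsa : IsSelfAdjoint T := by
    rw [ContinuousLinearMap.isSelfAdjoint_iff_isSymmetric]
    intro a c
    change inner ℝ (T a) c = inner ℝ a (T c)
    rw [hT, real_inner_comm, ← hT, real_inner_comm]
  obtain ⟨a₀, ha₀, hmin⟩ := (isCompact_sphere (0 : V l) 1).exists_isMinOn
    (NormedSpace.sphere_nonempty.2 zero_le_one) T.reApplyInnerSelf_continuous.continuousOn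
  -- Off-diagonal Gram entries are nonpositive, so absolute values do not increase the quadratic
  -- form: `a` is again a minimiser, hence an eigenvector.
  let a : V l := WithLp.toLp 2 fun i => |a₀ i|
  have hna : ‖a‖ = ‖a₀‖ := by
    rw [EuclideanSpace.norm_eq, EuclideanSpace.norm_eq]
    simp [a]
  have hle : T.reApplyInnerSelf a ≤ T.reApplyInnerSelf a₀ := by
    simp only [ContinuousLinearMap.reApplyInnerSelf_apply, RCLike.re_to_real]
    rw [hT, hT, hL, hL]
    simp only [sum_inner, inner_sum]
    refine Finset.sum_le_sum fun i _ => Finset.sum_le_sum fun j _ => ?_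
    simp only [inner_smul_left, inner_smul_right, conj_trivial, a]
    rw [← mul_assoc, ← mul_assoc]
    by_cases hij : j = i
    · rw [hij, abs_mul_abs_self]
    · refine mul_le_mul_of_nonpos_right ?_ (h.inner_nonpos _ _ hij)
      rw [← abs_mul]
      exact le_abs_self _
  have ha1 : ‖a‖ = 1 := by rw [hna]; simpa using ha₀
  have ha0 : a ≠ 0 := by
    intro h0; rw [h0, norm_zero] at ha1; exact zero_ne_one ha1
  have hmin' : IsMinOn T.reApplyInnerSelf (Metric.sphere 0 ‖a‖) a := by
    rw [ha1]
    intro y hy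
    exact hle.trans (hmin hy)
  have hev := hsa.hasEigenvector_of_isMinOn ha0 hmin'
  set r : ℝ := (⨅ x : { x : V l // x ≠ 0 }, T.rayleighQuotient x : ℝ)
  have hTa : T a = r • a := hev.apply_eq_smul
  have hinner : ∀ i, inner ℝ (b i) (L a) = r * a i := by
    intro i
    have hbi : b i = L (EuclideanSpace.single i 1) := by
      rw [hL, Finset.sum_eq_single i]
      · simp
      · intro j _ hj; simp [hj]
      · simp
    rw [hbi, real_inner_comm, ← hT, hTa, inner_smul_left, EuclideanSpace.inner_single_right]
    simp
  have hr : 0 < r := by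
    have hLa : L a ≠ 0 := by
      intro h0
      rw [hL] at h0
      have := Fintype.linearIndependent_iff.1 b.linearIndependent _ h0
      exact ha0 (by ext i; simpa using this i)
    have h1 := real_inner_self_pos.2 hLa
    rw [← hT, hTa, inner_smul_left, conj_trivial, real_inner_self_eq_norm_sq, ha1] at h1
    simpa using h1
  have hnn : ∀ i, 0 ≤ a i := fun i => abs_nonneg _
  refine ⟨a, r, fun i => ?_, hr, fun i => by rw [← hL, hinner]⟩
  -- If `a i = 0`, the nonpositive terms `a j ⟨b i, b j⟩` sum to zero, so `b i` is orthogonal to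
  -- each `b j` with `a j ≠ 0`; connectedness applies.
  have hZ := h.eq_empty_or_univ hW {i | a i = 0} (by
    intro i hi j hj
    have hi : a i = 0 := hi
    have h1 := hinner i
    rw [hi, mul_zero, hL, inner_sum] at h1
    simp only [inner_smul_right] at h1
    rw [Finset.sum_eq_zero_iff_of_nonpos] at h1
    · exact (mul_eq_zero.1 (h1 j (Finset.mem_univ j))).resolve_left hj
    · intro k _
      by_cases hk : i = k
      · rw [← hk, hi, zero_mul]
      · exact mul_nonpos_of_nonneg_of_nonpos (hnn k) (h.inner_nonpos i k hk))
  rcases hZ with h0 | h0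
  · refine lt_of_le_of_ne (hnn i) fun hi => ?_
    have : i ∈ ({i | a i = 0} : Set (Fin l)) := hi.symm
    rw [h0] at this
    exact this
  · exfalso
    refine ha0 (by ext j; exact (h0 ▸ Set.mem_univ j : j ∈ ({i | a i = 0} : Set (Fin l))))

end IsSimpleSystem

/-! ### The Coxeter element -/

namespace IsSimpleSystem

variable {W : Subgroup (V l ≃ₗᵢ[ℝ] V l)} {x : V l} {b : Module.Basis (Fin l) ℝ (V l)}

/-- The product of the simple reflections along a word. -/
noncomputable def word (b : Module.Basis (Fin l) ℝ (V l)) (L : List (Fin l)) : V l ≃ₗᵢ[ℝ] V l :=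
  (L.map fun i => refl (b i)).prod

theorem word_cons (i : Fin l) (L : List (Fin l)) (v : V l) :
    word b (i :: L) v = refl (b i) (word b L v) := rfl

theorem word_append (L L' : List (Fin l)) : word b (L ++ L') = word b L * word b L' := by
  simp [word]

theorem word_mem (h : IsSimpleSystem W x b) (L : List (Fin l)) : word b L ∈ W :=
  Subgroup.list_prod_mem _ fun r hr => by
    obtain ⟨i, -, rfl⟩ := List.mem_map.1 hr
    exact (h.mem_roots i).2

/-- The positive roots that a transformation makes negative. -/
def inversions (W : Subgroup (V l ≃ₗᵢ[ℝ] V l)) (x : V l) (w : V l ≃ₗᵢ[ℝ] V l) : Set (V l) :=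
  {v | v ∈ roots W ∧ 0 < inner ℝ v x ∧ inner ℝ (w v) x < 0}

/-- A simple reflection makes only its own root negative, so each letter adds at most one inversion.
-/
theorem ncard_inversions_word_le [Finite W] (h : IsSimpleSystem W x b) (L : List (Fin l)) :
    (inversions W x (word b L)).ncard ≤ L.length := by
  have hfin : ∀ w, (inversions W x w).Finite := fun w =>
    (roots_finite W).subset fun v hv => hv.1
  induction L with
  | nil =>
    have : inversions W x (word b []) = ∅ := by
      ext v
      simp only [Set.mem_empty_iff_false, iff_false]
      rintro ⟨-, h1, h2⟩
      exact lt_asymm h1 h2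
    simp [this]
  | cons i L ih =>
    have hsub : inversions W x (word b (i :: L)) ⊆
        insert ((word b L).symm (b i)) (inversions W x (word b L)) := by
      rintro v ⟨hv, hpos, hneg⟩
      rw [word_cons] at hneg
      by_cases hw : inner ℝ (word b L v) x < 0
      · exact Set.mem_insert_of_mem _ ⟨hv, hpos, hw⟩
      · have hr := map_mem_roots (h.word_mem L) hv
        have hw' := lt_of_le_of_ne (not_lt.1 hw) (h.regular _ hr).symm
        have heq : word b L v = b i := by
          by_contra hne
          exact lt_asymm hneg (h.refl_pos hr hw' hne)
        rw [← heq, LinearIsometryEquiv.symm_apply_apply]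
        exact Set.mem_insert _ _
    calc _ ≤ _ := Set.ncard_le_ncard hsub ((hfin _).insert _)
      _ ≤ _ := Set.ncard_insert_le _ _
      _ ≤ _ := by rw [List.length_cons]; omega

theorem word_apply (h : IsSimpleSystem W x b) (L : List (Fin l)) (hL : L.Nodup)
    (horth : ∀ i ∈ L, ∀ j ∈ L, i ≠ j → inner ℝ (b i) (b j) = 0) (v : V l) :
    word b L v = v - (L.map fun i => (2 * inner ℝ (b i) v) • b i).sum := by
  induction L with
  | nil => simp [word]
  | cons i L ih =>
    rw [List.nodup_cons] at hL
    have hih := ih hL.2 fun j hj k hk => horth j (List.mem_cons_of_mem _ hj) k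
      (List.mem_cons_of_mem _ hk)
    have hzero : inner ℝ (b i) (L.map fun i => (2 * inner ℝ (b i) v) • b i).sum = 0 := by
      have hgen : ∀ L' : List (Fin l), (∀ j ∈ L', inner ℝ (b i) (b j) = 0) →
          inner ℝ (b i) (L'.map fun i => (2 * inner ℝ (b i) v) • b i).sum = 0 := by
        intro L' hL'
        induction L' with
        | nil => simp
        | cons j L' ih' =>
          rw [List.map_cons, List.sum_cons, inner_add_right, inner_smul_right,
            hL' j List.mem_cons_self, mul_zero, zero_add]
          exact ih' fun k hk => hL' k (List.mem_cons_of_mem _ hk)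
      refine hgen L fun j hj => horth i List.mem_cons_self j (List.mem_cons_of_mem _ hj) ?_
      rintro rfl
      exact hL.1 hj
    rw [word_cons, hih, h.refl_apply, inner_sub_right, hzero, sub_zero, List.map_cons,
      List.sum_cons]
    abel

theorem word_toList_apply (h : IsSimpleSystem W x b) (A : Finset (Fin l))
    (horth : ∀ i ∈ A, ∀ j ∈ A, i ≠ j → inner ℝ (b i) (b j) = 0) (v : V l) :
    word b A.toList v = v - ∑ i ∈ A, (2 * inner ℝ (b i) v) • b i := by
  rw [h.word_apply A.toList A.nodup_toList (by simpa using horth), Finset.sum_map_toList]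

/-- The sum of `c^k v` over a period is fixed by `c`, hence zero. So along a cyclic orbit of roots
the sign of `⟨·, x⟩` passes from positive to negative somewhere, and the orbit meets the inversions
of `c`. There are thus at most `ord(c)·L.length` roots, and each hyperplane carries two. -/
theorem card_roots_le [Finite W] (h : IsSimpleSystem W x b) (L : List (Fin l))
    (hfix : ∀ v, word b L v = v → v = 0) :
    2 * (arrangement W).ncard ≤ orderOf (word b L) * L.length := by
  classical
  set c := word b L with hc
  set n := orderOf c with hn
  have hcW : c ∈ W := h.word_mem L
  have hn0 : 0 < n := by
    rw [hn, orderOf_pos_iff]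
    have := isOfFinOrder_of_finite (⟨c, hcW⟩ : W)
    exact W.subtype.isOfFinOrder this
  have hroots := roots_finite W
  have hpow : ∀ k, ∀ v ∈ roots W, (c ^ k) v ∈ roots W := fun k v hv =>
    map_mem_roots (W.pow_mem hcW k) hv
  have hsucc : ∀ k v, (c ^ (k + 1)) v = c ((c ^ k) v) := fun k v => by rw [pow_succ']; rfl
  have hsum : ∀ v, ∑ k ∈ Finset.range n, (c ^ k) v = 0 := by
    intro v
    apply hfix
    rw [map_sum]
    simp only [← hsucc]
    have h1 := Finset.sum_range_succ (fun k => (c ^ k) v) n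
    rw [Finset.sum_range_succ', hn, pow_orderOf_eq_one, pow_zero] at h1
    exact add_right_cancel h1
  have hsumx : ∀ v, ∑ k ∈ Finset.range n, inner ℝ ((c ^ k) v) x = 0 := by
    intro v
    rw [← sum_inner, hsum, inner_zero_left]
  have hex : ∀ v ∈ roots W, ∃ k < n, (c ^ k) v ∈ inversions W x c := by
    intro v hv
    by_contra! hcon
    have hcon' : ∀ k, (c ^ k) v ∉ inversions W x c := by
      intro k
      rw [← pow_mod_orderOf]
      exact hcon _ (Nat.mod_lt _ hn0)
    have hstep : ∀ k, 0 < inner ℝ ((c ^ k) v) x → 0 < inner ℝ ((c ^ (k + 1)) v) x := by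
      intro k hk
      refine lt_of_le_of_ne (not_lt.1 fun hneg => ?_) (h.regular _ (hpow _ v hv)).symm
      exact hcon' k ⟨hpow k v hv, hk, by rwa [← hsucc]⟩
    obtain ⟨k₀, hk₀⟩ : ∃ k, 0 < inner ℝ ((c ^ k) v) x := by
      by_contra! hle
      have hlt : ∀ k, inner ℝ ((c ^ k) v) x < 0 := fun k =>
        lt_of_le_of_ne (hle k) (h.regular _ (hpow _ v hv))
      have := Finset.sum_neg (s := Finset.range n) (f := fun k => inner ℝ ((c ^ k) v) x)
        (fun k _ => hlt k) ⟨0, Finset.mem_range.2 hn0⟩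
      exact this.ne (hsumx v)
    have hall : ∀ k, 0 < inner ℝ ((c ^ k) ((c ^ k₀) v)) x := by
      intro k
      have : (c ^ k) ((c ^ k₀) v) = (c ^ (k + k₀)) v := by rw [pow_add]; rfl
      rw [this]
      induction k with
      | zero => rwa [zero_add]
      | succ k ih =>
        rw [Nat.add_right_comm]
        exact hstep _ (ih (by rw [pow_add]; rfl))
    exact (Finset.sum_pos (fun k _ => hall k) ⟨0, Finset.mem_range.2 hn0⟩).ne'
      (hsumx ((c ^ k₀) v))
  have hinv : (inversions W x c).Finite := hroots.subset fun v hv => hv.1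
  have h1 : (roots W).ncard ≤ n * L.length := by
    have hsub : roots W ⊆ (fun p : ℕ × V l => (c ^ p.1).symm p.2) ''
        ((Finset.range n : Set ℕ) ×ˢ inversions W x c) := by
      intro v hv
      obtain ⟨k, hk, hmem⟩ := hex v hv
      exact ⟨(k, (c ^ k) v), ⟨by simpa using hk, hmem⟩, LinearIsometryEquiv.symm_apply_apply _ _⟩
    have hfin : ((Finset.range n : Set ℕ) ×ˢ inversions W x c).Finite :=
      (Finset.finite_toSet _).prod hinv
    calc (roots W).ncard ≤ _ := Set.ncard_le_ncard hsub (hfin.image _)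
      _ ≤ _ := Set.ncard_image_le hfin
      _ = n * (inversions W x c).ncard := by
        rw [Set.ncard_prod, Set.ncard_coe_finset, Finset.card_range]
      _ ≤ _ := Nat.mul_le_mul_left _ (h.ncard_inversions_word_le L)
  refine le_trans ?_ h1
  let P : Set (V l) := {v | v ∈ roots W ∧ 0 < inner ℝ v x}
  have hP : P.Finite := hroots.subset fun v hv => hv.1
  have h2 : (arrangement W).ncard ≤ P.ncard := by
    have hsub : arrangement W ⊆ (fun v => (Submodule.span ℝ {v})ᗮ) '' P := by
      rintro H ⟨v, hv, rfl, hvW⟩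
      obtain ⟨u, hu, a, ha, rfl⟩ := exists_root_smul hv hvW
      rw [Submodule.span_singleton_smul_eq (IsUnit.mk0 a ha)]
      rcases lt_or_gt_of_ne (h.regular u hu) with hneg | hpos
      · refine ⟨-u, ⟨neg_mem_roots hu, by rw [inner_neg_left]; linarith⟩, ?_⟩
        change (Submodule.span ℝ {-u})ᗮ = _
        rw [← Set.neg_singleton, Submodule.span_neg]
      · exact ⟨u, ⟨hu, hpos⟩, rfl⟩
    exact (Set.ncard_le_ncard hsub (hP.image _)).trans (Set.ncard_image_le hP)
  have h3 : (Neg.neg '' P).ncard = P.ncard := Set.ncard_image_of_injective _ neg_injective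
  have hdisj : Disjoint P (Neg.neg '' P) := by
    rw [Set.disjoint_left]
    rintro _ ⟨-, h4⟩ ⟨u, ⟨-, h5⟩, rfl⟩
    rw [inner_neg_left] at h4
    linarith
  have h4 := Set.ncard_union_eq hdisj hP (hP.image _)
  have h5 : (P ∪ Neg.neg '' P).ncard ≤ (roots W).ncard := by
    refine Set.ncard_le_ncard ?_ hroots
    rintro v (hv | ⟨u, hu, rfl⟩)
    · exact hv.1
    · exact neg_mem_roots hu.1
  omega

end IsSimpleSystem

open IsSimpleSystem in
/-- A Coxeter element `c`, with its plane spanned by `ξ` and `η`. -/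
theorem IsFiniteCoxeterGroup.exists_coxeter_element {W : Subgroup (V l ≃ₗᵢ[ℝ] V l)}
    (hW : IsFiniteCoxeterGroup W) (hl : 2 ≤ l) :
    ∃ c ∈ W, ∃ (ξ η : V l) (κ : ℝ), 0 < κ ∧ κ < 1 ∧
      c ξ = (4 * κ ^ 2 - 1) • ξ + (2 * κ) • η ∧ c η = -η - (2 * κ) • ξ ∧
      (∀ v : V l, v ≠ 0 → refl v ∈ W → inner ℝ v (ξ + η) ≠ 0) ∧
      2 * (arrangement W).ncard ≤ orderOf c * l := by
  classical
  have := hW.finite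
  obtain ⟨x, b, h⟩ := hW.exists_isSimpleSystem hl
  obtain ⟨color, hcol⟩ := h.exists_coloring
  obtain ⟨a, r, ha, hr, hperron⟩ := h.exists_perron hW
  let A := Finset.univ.filter fun i => color i = true
  let B := Finset.univ.filter fun i => ¬ color i = true
  have hA : ∀ i ∈ A, ∀ j ∈ A, i ≠ j → inner ℝ (b i) (b j) = 0 := by
    intro i hi j hj hij
    simp only [A, Finset.mem_filter, Finset.mem_univ, true_and] at hi hj
    exact hcol i j hij (hi.trans hj.symm)
  have hB : ∀ i ∈ B, ∀ j ∈ B, i ≠ j → inner ℝ (b i) (b j) = 0 := by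
    intro i hi j hj hij
    simp only [B, Finset.mem_filter, Finset.mem_univ, true_and, Bool.not_eq_true] at hi hj
    exact hcol i j hij (hi.trans hj.symm)
  have hcA := h.word_toList_apply A hA
  have hcB := h.word_toList_apply B hB
  have hsplit : ∀ f : Fin l → V l, ∑ i ∈ A, f i + ∑ i ∈ B, f i = ∑ i, f i := fun f =>
    Finset.sum_filter_add_sum_filter_not _ _ _
  -- The two colour parts of the Perron vector. Roots of one colour are orthogonal, so the word of a
  -- colour negates its own part and adds `2(1 - r)` times it to the other part.
  set ξ := ∑ i ∈ A, a i • b i with hξ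
  set η := ∑ i ∈ B, a i • b i with hη
  have hself : ∀ T : Finset (Fin l), (∀ i ∈ T, ∀ j ∈ T, i ≠ j → inner ℝ (b i) (b j) = 0) →
      ∀ i ∈ T, inner ℝ (b i) (∑ j ∈ T, a j • b j) = a i := by
    intro T hT i hi
    rw [inner_sum, Finset.sum_eq_single i]
    · rw [inner_smul_right, h.inner_self, mul_one]
    · intro j hj hji
      rw [inner_smul_right, hT i hi j hj hji.symm, mul_zero]
    · exact fun hn => absurd hi hn
  have hsum : ∀ i, inner ℝ (b i) ξ + inner ℝ (b i) η = r * a i := by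
    intro i
    rw [← inner_add_right, hsplit fun j => a j • b j, hperron]
  have hAη : ∀ i ∈ A, inner ℝ (b i) η = -(1 - r) * a i := by
    intro i hi
    have h1 := hsum i
    rw [hξ, hself A hA i hi] at h1
    linarith
  have hBξ : ∀ i ∈ B, inner ℝ (b i) ξ = -(1 - r) * a i := by
    intro i hi
    have h1 := hsum i
    rw [hη, hself B hB i hi] at h1
    linarith
  have e1 : word b A.toList ξ = -ξ := by
    rw [hcA, Finset.sum_congr rfl fun i hi => by rw [hself A hA i hi, mul_smul],
      ← Finset.smul_sum, ← hξ]
    module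
  have e2 : word b B.toList η = -η := by
    rw [hcB, Finset.sum_congr rfl fun i hi => by rw [hself B hB i hi, mul_smul],
      ← Finset.smul_sum, ← hη]
    module
  have e3 : word b A.toList η = η + (2 * (1 - r)) • ξ := by
    rw [hcA, Finset.sum_congr rfl fun i hi => by rw [hAη i hi, ← mul_assoc, mul_smul],
      ← Finset.smul_sum, ← hξ]
    module
  have e4 : word b B.toList ξ = ξ + (2 * (1 - r)) • η := by
    rw [hcB, Finset.sum_congr rfl fun i hi => by rw [hBξ i hi, ← mul_assoc, mul_smul],
      ← Finset.smul_sum, ← hη]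
    module
  have hlen : (A.toList ++ B.toList).length = l := by
    rw [List.length_append, Finset.length_toList, Finset.length_toList]
    have := Finset.card_filter_add_card_filter_not (s := (Finset.univ : Finset (Fin l)))
      (fun i => color i = true)
    rw [this, Finset.card_univ, Fintype.card_fin]
  have happ : ∀ v, word b (A.toList ++ B.toList) v = word b A.toList (word b B.toList v) :=
    fun v => by rw [word_append]; rfl
  -- If `r ≥ 1`, row `i₀` of the Perron equation makes `b i₀` orthogonal to all other simple roots,
  -- against connectedness and `2 ≤ l`.
  have hr1 : r < 1 := by
    by_contra! hge
    let i₀ : Fin l := ⟨0, by omega⟩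
    have h1 := hperron i₀
    rw [inner_sum, ← Finset.add_sum_erase _ _ (Finset.mem_univ i₀), inner_smul_right,
      h.inner_self, mul_one] at h1
    have hterm : ∀ j ∈ Finset.univ.erase i₀, inner ℝ (b i₀) (a j • b j) ≤ 0 := by
      intro j hj
      rw [inner_smul_right]
      exact mul_nonpos_of_nonneg_of_nonpos (ha j).le
        (h.inner_nonpos _ _ (Finset.ne_of_mem_erase hj).symm)
    have hzero : ∑ j ∈ Finset.univ.erase i₀, inner ℝ (b i₀) (a j • b j) = 0 := by
      refine le_antisymm (Finset.sum_nonpos hterm) ?_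
      have := ha i₀
      nlinarith
    rw [Finset.sum_eq_zero_iff_of_nonpos hterm] at hzero
    rcases h.eq_empty_or_univ hW {i₀} (by
      rintro i rfl j hj
      have := hzero j (Finset.mem_erase.2 ⟨hj, Finset.mem_univ _⟩)
      rw [inner_smul_right] at this
      exact (mul_eq_zero.1 this).resolve_left (ha j).ne') with h0 | h0
    · exact Set.singleton_ne_empty _ h0
    · have : (⟨1, by omega⟩ : Fin l) ∈ ({i₀} : Set (Fin l)) := h0 ▸ Set.mem_univ _
      have := congrArg Fin.val (Set.mem_singleton_iff.1 this)
      simp [i₀] at this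
  have hfix : ∀ v, word b (A.toList ++ B.toList) v = v → v = 0 := by
    intro v hv
    rw [happ] at hv
    set u := word b B.toList v with hu
    have hu' : u = v - ∑ i ∈ B, (2 * inner ℝ (b i) v) • b i := hcB v
    rw [hcA] at hv
    -- The `A`-part equals `u - v` and the `B`-part `v - u`; independence of the simple roots kills
    -- every coefficient.
    have hlin : ∑ i, (if color i = true then 2 * inner ℝ (b i) u else 2 * inner ℝ (b i) v) • b i
        = 0 := by
      rw [← hsplit]
      have s1 : ∑ i ∈ A, (if color i = true then 2 * inner ℝ (b i) u
          else 2 * inner ℝ (b i) v) • b i = ∑ i ∈ A, (2 * inner ℝ (b i) u) • b i :=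
        Finset.sum_congr rfl fun i hi => by rw [if_pos (Finset.mem_filter.1 hi).2]
      have s2 : ∑ i ∈ B, (if color i = true then 2 * inner ℝ (b i) u
          else 2 * inner ℝ (b i) v) • b i = ∑ i ∈ B, (2 * inner ℝ (b i) v) • b i :=
        Finset.sum_congr rfl fun i hi => by rw [if_neg (Finset.mem_filter.1 hi).2]
      have s3 : ∑ i ∈ A, (2 * inner ℝ (b i) u) • b i = u - v := by rw [← hv]; abel
      have s4 : ∑ i ∈ B, (2 * inner ℝ (b i) v) • b i = v - u := by rw [hu']; abel
      rw [s1, s2, s3, s4]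
      abel
    have hz := Fintype.linearIndependent_iff.1 b.linearIndependent _ hlin
    have hvB : ∀ i ∈ B, inner ℝ (b i) v = 0 := by
      intro i hi
      have := hz i
      rw [if_neg (Finset.mem_filter.1 hi).2] at this
      linarith
    have huv : u = v := by
      rw [hu', Finset.sum_eq_zero fun i hi => by rw [hvB i hi, mul_zero, zero_smul], sub_zero]
    have hall : ∀ i, inner ℝ (b i) v = 0 := by
      intro i
      have := hz i
      rw [huv, ite_self] at this
      linarith
    refine inner_self_eq_zero (𝕜 := ℝ).1 ?_
    conv_lhs => arg 2; rw [← b.sum_repr v]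
    rw [sum_inner]
    exact Finset.sum_eq_zero fun i _ => by rw [inner_smul_left, hall, mul_zero]
  refine ⟨word b (A.toList ++ B.toList), h.word_mem _, ξ, η, 1 - r, by linarith, by linarith,
    ?_, ?_, ?_, ?_⟩
  · rw [happ, e4, map_add, map_smul, e1, e3]
    module
  · rw [happ, e2, map_neg, e3]
    module
  · intro v hv hvW h0
    obtain ⟨u, hu, t, ht, rfl⟩ := exists_root_smul hv hvW
    rw [inner_smul_left, conj_trivial] at h0
    have h1 := (mul_eq_zero.1 h0).resolve_left ht
    -- By the Perron equation, `⟨u, ξ + η⟩ = r ∑ u_i a_i`, with `u_i` the simple-root coordinates of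
    -- `u`.
    have key : ∀ u ∈ roots W, 0 < inner ℝ u x → 0 < inner ℝ u (ξ + η) := by
      intro u hu hpos
      conv_rhs => rw [← b.sum_repr u]
      rw [sum_inner]
      have hterm : ∀ i, inner ℝ (b.repr u i • b i) (ξ + η) = b.repr u i * (r * a i) := by
        intro i
        rw [inner_smul_left, conj_trivial, inner_add_right, hsum]
      have hnn : ∀ i ∈ Finset.univ, 0 ≤ inner ℝ (b.repr u i • b i) (ξ + η) := by
        intro i _
        rw [hterm]
        exact mul_nonneg (h.nonneg u hu hpos i) (mul_pos hr (ha i)).le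
      refine lt_of_le_of_ne (Finset.sum_nonneg hnn) fun h0 => ?_
      rw [eq_comm, Finset.sum_eq_zero_iff_of_nonneg hnn] at h0
      refine ne_zero_of_mem_roots hu (b.ext_elem fun i => ?_)
      have := h0 i (Finset.mem_univ i)
      rw [hterm] at this
      rw [(mul_eq_zero.1 this).resolve_right (mul_pos hr (ha i)).ne', map_zero,
        Finsupp.zero_apply]
    rcases lt_or_gt_of_ne (h.regular u hu) with hneg | hpos
    · have := key (-u) (neg_mem_roots hu) (by rw [inner_neg_left]; linarith)
      rw [inner_neg_left, h1, neg_zero] at this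
      exact lt_irrefl _ this
    · exact (key u hu hpos).ne' h1
  · have := h.card_roots_le (A.toList ++ B.toList) hfix
    rwa [hlen] at this

end CoxeterLog

namespace CoxeterLog

open MvPolynomial

variable {l : ℕ}

/-! ### Degrees of basic invariants -/

theorem act_mul (w w' : V l ≃ₗᵢ[ℝ] V l) (f : S l) : act (w * w') f = act w' (act w f) :=
  poly_ext fun v => by rw [eval_act, eval_act, eval_act]; rfl

theorem act_isHomogeneous (w : V l ≃ₗᵢ[ℝ] V l) {f : S l} {d : ℕ} (hf : f.IsHomogeneous d) :
    (act w f).IsHomogeneous d := by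
  have := hf.aeval (fun n => lin (w.symm (EuclideanSpace.single n 1))) (n := 1)
    fun n => lin_isHomogeneous _
  simpa [act] using this

theorem act_pderiv_of_act_eq {f : S l} {w : V l ≃ₗᵢ[ℝ] V l} {e : S l}
    (he : ∀ n, pderiv n e = 0) (h : act w f = e * f) (n : Fin l) :
    act w (pderiv n f) = e * ∑ m, actMat w n m * pderiv m f := by
  have h1 : e • grad f = (actMat w).transpose.mulVec fun n => act w (pderiv n f) := by
    ext1 m
    have := pderiv_act w m f
    rw [h, Derivation.leibniz, he, smul_zero, add_zero] at this
    rw [Pi.smul_apply, grad, this]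
    simp [Matrix.mulVec, dotProduct]
  have h2 := congrArg (actMat w).mulVec h1
  rw [Matrix.mulVec_mulVec, actMat_mul_transpose, Matrix.one_mulVec, Matrix.mulVec_smul] at h2
  have := congrFun h2 n
  rw [← this]
  simp [Matrix.mulVec, dotProduct, grad]

/-- Orthogonal maps preserve the product of gradients. The factor `e` is a constant: `1` for
invariants, the determinant for `Q`. -/
theorem act_sum_pderiv_mul_pderiv {f h : S l} {w : V l ≃ₗᵢ[ℝ] V l} {e : S l}
    (he : ∀ n, pderiv n e = 0) (hf : act w f = f) (hh : act w h = e * h) :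
    act w (∑ r, pderiv r f * pderiv r h) = e * ∑ r, pderiv r f * pderiv r h := by
  have e1 : (fun r => act w (pderiv r f)) = (actMat w).mulVec (grad f) := by
    ext1 r
    rw [act_pderiv_of_act_eq (e := 1) (fun n => by simp) (hf.trans (one_mul _).symm), one_mul]
    rfl
  have e2 : (fun r => act w (pderiv r h)) = e • (actMat w).mulVec (grad h) := by
    ext1 r
    rw [act_pderiv_of_act_eq he hh]
    rfl
  have e3 : act w (∑ r, pderiv r f * pderiv r h) =
      (fun r => act w (pderiv r f)) ⬝ᵥ (fun r => act w (pderiv r h)) := by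
    rw [map_sum]
    exact Finset.sum_congr rfl fun r _ => map_mul _ _ _
  rw [e3, e1, e2, dotProduct_smul, smul_eq_mul, Matrix.dotProduct_mulVec,
    ← Matrix.mulVec_transpose, Matrix.mulVec_mulVec, actMat_transpose_mul, Matrix.one_mulVec]
  rfl

theorem det_isHomogeneous {M : Matrix (Fin l) (Fin l) (S l)} {d : Fin l → ℕ}
    (hM : ∀ i j, (M i j).IsHomogeneous (d j)) : M.det.IsHomogeneous (∑ j, d j) := by
  rw [Matrix.det_apply']
  refine IsHomogeneous.sum _ _ _ fun σ _ => ?_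
  have h1 := IsHomogeneous.prod Finset.univ (fun i => M (σ i) i) d fun i _ => hM _ _
  have h2 : ((Equiv.Perm.sign σ : ℤ) : S l).IsHomogeneous 0 := by
    rw [← map_intCast (C : ℝ →+* S l)]
    exact isHomogeneous_C _ _
  simpa using h2.mul h1

theorem isHomogeneous_zero_eq_C {f : S l} (hf : f.IsHomogeneous 0) : ∃ c, f = C c :=
  ⟨_, totalDegree_eq_zero_iff_eq_C.1 ((totalDegree_zero_iff_isHomogeneous _).2 hf)⟩

theorem isHomogeneous_one_eq_lin {f : S l} (hf : f.IsHomogeneous 1) : ∃ a : V l, f = lin a := by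
  have h : ∀ i, ∃ c, pderiv i f = C c := fun i => isHomogeneous_zero_eq_C hf.pderiv
  choose a ha using h
  refine ⟨WithLp.toLp 2 a, ?_⟩
  have := hf.sum_X_mul_pderiv
  rw [one_smul] at this
  rw [← this, lin]
  exact Finset.sum_congr rfl fun i _ => by rw [ha, mul_comm]

theorem pderiv_comm (i j : Fin l) (f : S l) :
    pderiv i (pderiv j f) = pderiv j (pderiv i f) := by
  have h : ⁅(pderiv i : Derivation ℝ (S l) (S l)), pderiv j⁆ = 0 :=
    MvPolynomial.derivation_ext fun n => by
      rw [Derivation.commutator_apply, pderiv_X, pderiv_X]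
      simp only [Pi.single_apply, apply_ite, map_zero, Derivation.map_one_eq_zero]
      simp
  have := DFunLike.congr_fun h f
  rwa [Derivation.commutator_apply, Derivation.zero_apply, sub_eq_zero] at this

/-- Schur's lemma for the Hessian of `f`: being symmetric it has a real eigenvalue, and the
eigenspace is `W`-stable. -/
theorem exists_grad_eq_smul_of_quadratic {W : Subgroup (V l ≃ₗᵢ[ℝ] V l)}
    (hW : IsFiniteCoxeterGroup W) {f : S l} (hf : f.IsHomogeneous 2) (hinv : f ∈ invariants W) :
    ∃ c : ℝ, ∀ n, pderiv n f = C c * X n := by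
  have := hW.nontrivial
  have h : ∀ i, ∃ a : V l, pderiv i f = lin a := fun i => isHomogeneous_one_eq_lin hf.pderiv
  choose a ha using h
  let T : V l →ₗ[ℝ] V l :=
    { toFun := fun v => WithLp.toLp 2 fun i => inner ℝ (a i) v
      map_add' := fun v w => by ext i; simp [inner_add_right]
      map_smul' := fun c v => by ext i; simp [inner_smul_right] }
  have hT : ∀ v i, T v i = eval v.ofLp (pderiv i f) := fun v i => by rw [ha, eval_lin]; rfl
  have hsymm : ∀ i j, a i j = a j i := by
    intro i j
    have h1 : pderiv j (pderiv i f) = pderiv i (pderiv j f) := pderiv_comm _ _ _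
    rw [ha, ha, pderiv_lin, pderiv_lin] at h1
    exact C_injective _ _ h1
  have hTs : T.IsSymmetric := by
    intro v w
    change inner ℝ (WithLp.toLp 2 fun i => inner ℝ (a i) v) w =
      inner ℝ v (WithLp.toLp 2 fun i => inner ℝ (a i) w)
    simp only [PiLp.inner_apply, RCLike.inner_apply, conj_trivial, Finset.mul_sum, Finset.sum_mul]
    rw [Finset.sum_comm]
    refine Finset.sum_congr rfl fun i _ => Finset.sum_congr rfl fun j _ => ?_
    rw [hsymm]
    ring
  obtain ⟨c, hc⟩ : ∃ c : ℝ, Module.End.HasEigenvalue T c :=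
    ⟨_, hTs.hasEigenvalue_iSup_of_finiteDimensional⟩
  have htop : Module.End.eigenspace T c = ⊤ := by
    refine (hW.irreducible _ fun w hw u hu => ?_).resolve_left hc
    rw [Module.End.mem_eigenspace_iff] at hu ⊢
    have hcomm : T (w u) = w (T u) := by
      ext n
      have h1 := act_pderiv_of_act_eq (e := 1) (fun n => by simp)
        ((mem_invariants_iff.1 hinv w hw).trans (one_mul f).symm) n
      rw [hT, ← eval_act, h1, one_mul, map_sum]
      have hv : T u = ∑ i, T u i • EuclideanSpace.single i (1 : ℝ) := by
        have := (EuclideanSpace.basisFun (Fin l) ℝ).sum_repr (T u)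
        simpa using this.symm
      conv_rhs => rw [hv, map_sum]
      simp only [WithLp.ofLp_sum, Finset.sum_apply, map_smul, WithLp.ofLp_smul, Pi.smul_apply,
        smul_eq_mul]
      refine Finset.sum_congr rfl fun m _ => ?_
      rw [map_mul, hT, actMat, Matrix.of_apply, eval_C, mul_comm]
    rw [hcomm, hu, map_smul]
  refine ⟨c, fun n => poly_ext fun v => ?_⟩
  have hv : T v = c • v := Module.End.mem_eigenspace_iff.1 (htop ▸ Submodule.mem_top)
  rw [← hT, hv]
  simp

section Degrees

variable {W : Subgroup (V l ≃ₗᵢ[ℝ] V l)} {g : Fin l → S l}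

theorem IsBasicInvariants.mem (hg : IsBasicInvariants W g) (j : Fin l) : g j ∈ invariants W :=
  hg.adjoin_eq ▸ Algebra.subset_adjoin ⟨j, rfl⟩

theorem det_jac_ne_zero [Finite W] {α : Submodule ℝ (V l) → Module.Dual ℝ (V l)}
    (hα : IsDefining W α) (hg : IsBasicInvariants W g) : (jac g).det ≠ 0 := by
  obtain ⟨c, hc, h⟩ := exists_det_jac_eq hα hg
  rw [h]
  exact mul_ne_zero (by simpa using hc) (Q_ne_zero hα)

/-- A constant has zero gradient, and an invariant linear form would span a stable line. -/
theorem two_le_degree (hW : IsFiniteCoxeterGroup W) (hl : 2 ≤ l) (hg : IsBasicInvariants W g)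
    (hdet : (jac g).det ≠ 0) {j : Fin l} {d : ℕ} (hd : (g j).IsHomogeneous d) : 2 ≤ d := by
  by_contra! hlt
  have hcol : ¬ ∀ n, pderiv n (g j) = 0 := fun h =>
    hdet (Matrix.det_eq_zero_of_column_eq_zero j h)
  obtain rfl | rfl : d = 0 ∨ d = 1 := by omega
  · obtain ⟨c, hc⟩ := isHomogeneous_zero_eq_C hd
    exact hcol fun n => by rw [hc, pderiv_C]
  · obtain ⟨a, ha⟩ := isHomogeneous_one_eq_lin hd
    have ha0 : a ≠ 0 := by
      rintro rfl
      exact hcol fun n => by rw [ha, lin_zero, map_zero]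
    have hne := exists_submodule_ne hl ha0
    rcases hW.irreducible (Submodule.span ℝ {a}) (fun w hw u hu => by
      obtain ⟨t, rfl⟩ := Submodule.mem_span_singleton.1 hu
      have h1 := hg.act_eq (W.inv_mem hw) j
      rw [ha, act_lin] at h1
      rw [map_smul, show w a = a from lin_injective h1]
      exact hu) with h | h
    · exact hne.1 h
    · exact hne.2 h

/-- Two quadratic invariants have gradients proportional to `x`, so `det J` would vanish. -/
theorem eq_of_degree_eq_two (hW : IsFiniteCoxeterGroup W) (hg : IsBasicInvariants W g)
    (hdet : (jac g).det ≠ 0) {i j : Fin l} (hi : (g i).IsHomogeneous 2)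
    (hj : (g j).IsHomogeneous 2) : i = j := by
  by_contra hij
  obtain ⟨a, ha⟩ := exists_grad_eq_smul_of_quadratic hW hi (hg.mem i)
  obtain ⟨b, hb⟩ := exists_grad_eq_smul_of_quadratic hW hj (hg.mem j)
  by_cases ha0 : a = 0
  · refine hdet (Matrix.det_eq_zero_of_column_eq_zero i fun n => ?_)
    simp [jac, ha, ha0]
  · have h0 : (jac g).mulVec (Pi.single i (C b) - Pi.single j (C a)) = 0 := by
      ext1 n
      rw [Matrix.mulVec_sub, Matrix.mulVec_single, Matrix.mulVec_single]
      simp [jac, ha, hb]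
      ring
    have h1 := congrFun (Matrix.eq_zero_of_mulVec_eq_zero hdet h0) j
    rw [Pi.sub_apply, Pi.single_eq_of_ne (Ne.symm hij), Pi.single_eq_same] at h1
    simp [ha0] at h1

theorem sum_degree_sub_one [Finite W] {α : Submodule ℝ (V l) → Module.Dual ℝ (V l)}
    (hα : IsDefining W α) (hg : IsBasicInvariants W g) {m : Fin l → ℕ}
    (hm : ∀ j, (g j).IsHomogeneous (m j + 1)) : ∑ j, m j = (arrangement W).ncard := by
  obtain ⟨c, hc, h⟩ := exists_det_jac_eq hα hg
  have h1 : (jac g).det.IsHomogeneous (∑ j, m j) := det_isHomogeneous fun i j => (hm j).pderiv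
  rw [h] at h1
  have h2 := (Q_isHomogeneous (W := W) α).C_mul c
  exact h1.inj_right h2 (mul_ne_zero (by simpa using hc) (Q_ne_zero hα))

end Degrees

/-! ### The regular eigenvector of a Coxeter element -/

/-- The complex vector `μ ξ + η`. -/
noncomputable def cvec (μ : ℂ) (ξ η : V l) : Fin l → ℂ := fun i => μ * ξ i + η i

theorem sum_coord_mul (a v : V l) : ∑ i, (a i : ℂ) * (v i : ℂ) = (inner ℝ a v : ℝ) := by
  rw [PiLp.inner_apply]
  push_cast
  exact Finset.sum_congr rfl fun i _ => by simp [mul_comm]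

theorem aeval_lin (z : Fin l → ℂ) (a : V l) : aeval z (lin a) = ∑ i, (a i : ℂ) * z i := by
  simp [lin, algHom_C]

theorem aeval_cvec_lin (μ : ℂ) (ξ η a : V l) :
    aeval (cvec μ ξ η) (lin a) = μ * (inner ℝ a ξ : ℝ) + (inner ℝ a η : ℝ) := by
  rw [aeval_lin, ← sum_coord_mul, ← sum_coord_mul, Finset.mul_sum, ← Finset.sum_add_distrib]
  exact Finset.sum_congr rfl fun i _ => by rw [cvec]; ring

theorem aeval_act_cvec (μ : ℂ) (ξ η : V l) (w : V l ≃ₗᵢ[ℝ] V l) (f : S l) :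
    aeval (cvec μ ξ η) (act w f) = aeval (cvec μ (w ξ) (w η)) f := by
  have : ((aeval (cvec μ ξ η) : S l →ₐ[ℝ] ℂ).comp (act w)) = aeval (cvec μ (w ξ) (w η)) := by
    ext n
    rw [AlgHom.comp_apply, ← lin_single, act_lin, aeval_cvec_lin, aeval_cvec_lin,
      inner_symm_apply, inner_symm_apply]
  exact congrArg (fun φ : S l →ₐ[ℝ] ℂ => φ f) this

theorem aeval_smul_of_isHomogeneous (ζ : ℂ) (z : Fin l → ℂ) {f : S l} {d : ℕ}
    (hf : f.IsHomogeneous d) : aeval (ζ • z) f = ζ ^ d * aeval z f := by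
  simp only [aeval_def, eval₂_eq, Finset.mul_sum]
  refine Finset.sum_congr rfl fun s hs => ?_
  simp only [Pi.smul_apply, smul_eq_mul, mul_pow, Finset.prod_mul_distrib]
  rw [Finset.prod_pow_eq_pow_sum, hf.degree_eq_sum_deg_support hs]
  ring

theorem actMat_eq_one {w : V l ≃ₗᵢ[ℝ] V l} {z : Fin l → ℂ}
    (h : (actMat w).map (aeval z) = (1 : Matrix (Fin l) (Fin l) ℂ)) : w = 1 := by
  refine LinearIsometryEquiv.ext fun v => ?_
  have hb : ∀ i, w (EuclideanSpace.single i 1) = EuclideanSpace.single i (1 : ℝ) := by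
    intro i
    ext n
    have h1 := congrFun (congrFun h n) i
    simp only [Matrix.map_apply, actMat, Matrix.of_apply, algHom_C, Matrix.one_apply] at h1
    rw [PiLp.single_apply]
    split_ifs at h1 ⊢ with hn
    · exact Complex.ofReal_injective (by simpa using h1)
    · exact Complex.ofReal_injective (by simpa using h1)
  have hv : v = ∑ i, v i • EuclideanSpace.single i (1 : ℝ) := by
    have := (EuclideanSpace.basisFun (Fin l) ℝ).sum_repr v
    simpa using this.symm
  rw [LinearIsometryEquiv.coe_one, id]
  conv_rhs => rw [hv]
  conv_lhs => rw [hv, map_sum]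
  exact Finset.sum_congr rfl fun i _ => by rw [map_smul, hb]

theorem act_det_actMat (w w' : V l ≃ₗᵢ[ℝ] V l) :
    act w (actMat w').det = (actMat w').det ∧ ∀ n, pderiv n (actMat w').det = 0 := by
  obtain ⟨r, hr⟩ : ∃ r : ℝ, (actMat w').det = C r := by
    refine ⟨(Matrix.of fun n m => w' (EuclideanSpace.single m 1) n).det, ?_⟩
    rw [RingHom.map_det]
    rfl
  rw [hr]
  exact ⟨by simp [act], fun n => pderiv_C⟩

/-- A complex vector outside the hyperplanes at which all basic invariants but the one of highest
degree vanish, together with the numerical facts that it yields. -/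
structure IsRegularVector (W : Subgroup (V l ≃ₗᵢ[ℝ] V l)) (q : S l) (g : Fin l → S l)
    (k : Fin l) (m : Fin l → ℕ) (z : Fin l → ℂ) : Prop where
  Q_ne_zero : aeval z q ≠ 0
  eq_zero : ∀ i, i ≠ k → aeval z (g i) = 0
  ne_zero : aeval z (g k) ≠ 0
  two_mul_card : 2 * (arrangement W).ncard = (m k + 1) * l
  orthogonal : ∃ i₀, ∀ i, i ≠ i₀ → aeval z (∑ n, pderiv n (g i) * pderiv n (g k)) = 0 ∧
    aeval z (∑ n, pderiv n (g i) * pderiv n q) = 0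

/-- The vector is an eigenvector of `c` in the complexified plane of `ξ` and `η`. A homogeneous
invariant of degree `d` can be nonzero there only if `ζ^d = 1`, that is, if `ord(c)` divides `d`.
Applied to the `g_i` and to the products `∇g_i·∇g_j`, this restricts the exponents enough to
determine which values vanish. -/
theorem exists_isRegularVector {W : Subgroup (V l ≃ₗᵢ[ℝ] V l)} (hW : IsFiniteCoxeterGroup W)
    (hl : 2 ≤ l) {α : Submodule ℝ (V l) → Module.Dual ℝ (V l)} (hα : IsDefining W α)
    {g : Fin l → S l} (hg : IsBasicInvariants W g) {m : Fin l → ℕ}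
    (hm : ∀ j, (g j).IsHomogeneous (m j + 1)) {k : Fin l} (hk : ∀ j, m j ≤ m k) :
    ∃ z, IsRegularVector W (Q W α) g k m z := by
  classical
  have := hW.finite
  obtain ⟨c, hcW, ξ, η, κ, hκ0, hκ1, hcξ, hcη, hreg, hcard⟩ := hW.exists_coxeter_element hl
  set N := (arrangement W).ncard with hN
  set n := orderOf c with hn
  have hdet := det_jac_ne_zero hα hg
  have hm1 : ∀ j, 1 ≤ m j := fun j => by
    have := two_le_degree hW hl hg hdet (hm j)
    omega
  have hsum : ∑ j, m j = N := sum_degree_sub_one hα hg hm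
  set s := Real.sqrt (1 - κ ^ 2) with hs
  have hs2 : s ^ 2 = 1 - κ ^ 2 := Real.sq_sqrt (by nlinarith)
  have hs0 : s ≠ 0 := fun h => by rw [h] at hs2; nlinarith
  -- A root of `T² - 2κT + 1`, which makes `μξ + η` an eigenvector of `c` with eigenvalue `μ²`.
  set μ : ℂ := κ + s * Complex.I with hμ
  have hμ2 : μ ^ 2 = 2 * κ * μ - 1 := by
    have h1 : (s : ℂ) ^ 2 = 1 - (κ : ℂ) ^ 2 := by exact_mod_cast hs2
    rw [hμ]
    linear_combination (-1 : ℂ) * h1 + (s : ℂ) ^ 2 * Complex.I_sq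
  have hμ0 : μ ≠ 0 := fun h => by rw [h] at hμ2; simp at hμ2
  set ζ := μ ^ 2 with hζ
  have hζ0 : ζ ≠ 0 := pow_ne_zero 2 hμ0
  set z := cvec μ ξ η with hz
  have hcz : cvec μ (c ξ) (c η) = ζ • z := by
    ext i
    rw [hcξ, hcη]
    simp only [cvec, hz, hζ, PiLp.add_apply, PiLp.sub_apply, PiLp.neg_apply, PiLp.smul_apply,
      smul_eq_mul, Pi.smul_apply]
    push_cast
    linear_combination ((-(2 * κ + μ)) * ξ i - η i) * hμ2
  have hact : ∀ {f : S l} {d : ℕ}, f.IsHomogeneous d →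
      aeval z (act c f) = ζ ^ d * aeval z f := by
    intro f d hf
    rw [hz, aeval_act_cvec, hcz, aeval_smul_of_isHomogeneous _ _ hf]
  have hactpow : ∀ (t : ℕ) {f : S l} {d : ℕ}, f.IsHomogeneous d →
      aeval z (act (c ^ t) f) = (ζ ^ t) ^ d * aeval z f := by
    intro t f d hf
    induction t with
    | zero =>
      have : act (1 : V l ≃ₗᵢ[ℝ] V l) f = f := poly_ext fun v => by rw [eval_act]; rfl
      rw [pow_zero, this, pow_zero, one_pow, one_mul]
    | succ t ih =>
      rw [pow_succ, act_mul, hact (act_isHomogeneous _ hf), ih, pow_succ, mul_pow]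
      ring
  -- Since `s ≠ 0`, a real linear form vanishing at `z` vanishes at both `ξ` and `η`, hence at `ξ +
  -- η`, which lies on no hyperplane.
  have hQz : aeval z (Q W α) ≠ 0 := by
    rw [Q_eq_prod, map_prod, Finset.prod_ne_zero_iff]
    intro H hH h0
    have hH' := (Set.Finite.mem_toFinset _).1 hH
    rw [hz, aeval_cvec_lin] at h0
    have him := congrArg Complex.im h0
    have hre := congrArg Complex.re h0
    simp only [hμ, Complex.add_im, Complex.mul_im, Complex.ofReal_im, Complex.ofReal_re,
      Complex.I_im, Complex.I_re, Complex.add_re, Complex.mul_re, Complex.zero_im,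
      Complex.zero_re] at him hre
    have h1 : inner ℝ (normalVec (α H)) ξ = 0 := by
      have : s * inner ℝ (normalVec (α H)) ξ = 0 := by linarith
      exact (mul_eq_zero.1 this).resolve_left hs0
    rw [h1] at hre
    refine hreg _ (hα.normalVec_ne_zero hH') (hα.refl_mem hH') ?_
    rw [inner_add_right, h1, zero_add]
    linarith
  have hJz : ((jac g).map (aeval z)).det ≠ 0 := by
    obtain ⟨a, ha, h⟩ := exists_det_jac_eq hα hg
    have h1 := (aeval z : S l →ₐ[ℝ] ℂ).map_det (jac g)
    rw [AlgHom.mapMatrix_apply] at h1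
    rw [← h1, h, map_mul, algHom_C]
    exact mul_ne_zero (by simpa using ha) hQz
  have hjac : ∀ i j, (jac g i j).IsHomogeneous (m j) := fun i j => (hm j).pderiv
  -- If `ζ^t = 1`, evaluating the equivariance of `J` under `c^t` at `z` gives `J(z) = c^t J(z)`,
  -- and `J(z)` is invertible.
  have horder : ∀ t : ℕ, ζ ^ t = 1 → n ∣ t := by
    intro t ht
    rw [hn, orderOf_dvd_iff_pow_eq_one]
    have h1 := congrArg (fun M : Matrix (Fin l) (Fin l) (S l) => M.map (aeval z : S l →ₐ[ℝ] ℂ))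
      (actMat_mul_map_jac (hg.act_eq (W.pow_mem hcW t)))
    simp only [Matrix.map_map] at h1
    have h2 : (jac g).map ((aeval z : S l →ₐ[ℝ] ℂ) ∘ act (c ^ t)) = (jac g).map (aeval z) := by
      ext i j
      rw [Matrix.map_apply, Matrix.map_apply, Function.comp_apply, hactpow t (hjac i j), ht,
        one_pow, one_mul]
    rw [h2, Matrix.map_mul] at h1
    refine actMat_eq_one (z := z) ?_
    have hu : IsUnit ((jac g).map (aeval z : S l →ₐ[ℝ] ℂ)) :=
      (Matrix.isUnit_iff_isUnit_det _).2 (IsUnit.mk0 _ hJz)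
    exact hu.mul_right_cancel (by rw [one_mul]; exact h1.symm)
  have hgram : ∀ i j, aeval z (∑ r, pderiv r (g i) * pderiv r (g j)) ≠ 0 → n ∣ m i + m j := by
    intro i j hne
    refine horder _ ?_
    have hinv : act c (∑ r, pderiv r (g i) * pderiv r (g j)) =
        ∑ r, pderiv r (g i) * pderiv r (g j) := by
      simpa using act_sum_pderiv_mul_pderiv (e := 1) (fun n => by simp) (hg.act_eq hcW i)
        ((hg.act_eq hcW j).trans (one_mul _).symm)
    have hhom : (∑ r, pderiv r (g i) * pderiv r (g j)).IsHomogeneous (m i + m j) :=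
      IsHomogeneous.sum _ _ _ fun r _ => (hm i).pderiv.mul (hm j).pderiv
    have h3 := hact hhom
    rw [hinv] at h3
    exact (mul_right_cancel₀ hne (by rw [one_mul]; exact h3)).symm
  -- `JᵀJ` is invertible at `z`, so its determinant has a nonzero term. Then each `m (σ i) + m i` is
  -- a positive multiple of `n`, while their sum `2N` is at most `n * l`: all equal `n`.
  obtain ⟨σ, hσ⟩ : ∃ σ : Equiv.Perm (Fin l), ∀ i,
      aeval z (∑ r, pderiv r (g (σ i)) * pderiv r (g i)) ≠ 0 := by
    have hG : (((jac g).map (aeval z)).transpose * (jac g).map (aeval z)).det ≠ 0 := by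
      rw [Matrix.det_mul, Matrix.det_transpose]
      exact mul_ne_zero hJz hJz
    rw [Matrix.det_apply] at hG
    obtain ⟨σ, -, hσ⟩ := Finset.exists_ne_zero_of_sum_ne_zero hG
    refine ⟨σ, fun i h0 => hσ ?_⟩
    rw [Finset.prod_eq_zero (Finset.mem_univ i), smul_zero]
    rw [← h0]
    simp [Matrix.mul_apply, jac]
  have hle : ∀ i, n ≤ m (σ i) + m i := fun i =>
    Nat.le_of_dvd (by have := hm1 i; omega) (hgram _ _ (hσ i))
  have hsum2 : ∑ i, (m (σ i) + m i) = 2 * N := by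
    rw [Finset.sum_add_distrib, Equiv.sum_comp σ m, hsum, two_mul]
  have hsumn : ∑ _i : Fin l, n = n * l := by simp [mul_comm]
  have heq : ∀ i, m (σ i) + m i = n := by
    have h1 : ∑ _i : Fin l, n = ∑ i, (m (σ i) + m i) :=
      le_antisymm (Finset.sum_le_sum fun i _ => hle i) (by rw [hsum2, hsumn]; exact hcard)
    rw [Finset.sum_eq_sum_iff_of_le fun i _ => hle i] at h1
    exact fun i => (h1 i (Finset.mem_univ i)).symm
  have hlt : ∀ i, m i < n := fun i => by
    have := heq i
    have := hm1 (σ i)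
    omega
  have hgz : ∀ i, aeval z (g i) ≠ 0 → m i + 1 = n := by
    intro i hi
    have h1 := hact (hm i)
    rw [hg.act_eq hcW] at h1
    have h2 := horder _ (mul_right_cancel₀ hi (by rw [one_mul]; exact h1)).symm
    exact le_antisymm (hlt i) (Nat.le_of_dvd (Nat.succ_pos _) h2)
  have hone : ∀ i j, m i = 1 → m j = 1 → i = j := fun i j hi hj =>
    eq_of_degree_eq_two hW hg hdet (by simpa [hi] using hm i) (by simpa [hj] using hm j)
  -- The partner under `σ` of exponent `n - 1` has exponent `1`, and only one invariant is
  -- quadratic.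
  have htop : ∀ i j, m i + 1 = n → m j + 1 = n → i = j := by
    intro i j hi hj
    have h1 := heq i
    have h2 := heq j
    exact σ.injective (hone _ _ (by omega) (by omega))
  -- If all `g_i` vanished at `z`, Euler's formula would give `J(z)ᵀz = 0`; but `z ≠ 0` because
  -- `Q(z) ≠ 0`.
  obtain ⟨k₀, hk₀⟩ : ∃ k₀, aeval z (g k₀) ≠ 0 := by
    by_contra! hcon
    have hz0 : z ≠ 0 := by
      intro h0
      have h1 : (Q W α).IsHomogeneous N := Q_isHomogeneous α
      have h2 := aeval_smul_of_isHomogeneous 0 z h1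
      rw [zero_smul, ← h0, zero_pow (by
        rw [← hsum]
        have h3 := Finset.single_le_sum (f := m) (fun i _ => Nat.zero_le _) (Finset.mem_univ k)
        have := hm1 k
        omega), zero_mul] at h2
      exact hQz h2
    have h1 : ((jac g).map (aeval z)).transpose.mulVec z = 0 := by
      ext1 j
      have h2 := congrArg (aeval z) (hm j).sum_X_mul_pderiv
      rw [map_nsmul, hcon, smul_zero, map_sum] at h2
      rw [Pi.zero_apply, ← h2]
      simp [Matrix.mulVec, dotProduct, jac, mul_comm]
    exact hz0 (Matrix.eq_zero_of_mulVec_eq_zero (by rwa [Matrix.det_transpose]) h1)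
  have hk₀n := hgz k₀ hk₀
  have hkn : m k + 1 = n := le_antisymm (hlt k) (by have := hk k₀; omega)
  have hkk : k₀ = k := htop _ _ hk₀n hkn
  refine ⟨z, hQz, fun i hi => ?_, hkk ▸ hk₀, ?_, σ k, fun i hi => ⟨?_, ?_⟩⟩
  · by_contra h0
    exact hi (htop _ _ (hgz i h0) hkn)
  · rw [hkn, ← hsum2, ← hsumn]
    exact Finset.sum_congr rfl fun i _ => heq i
  · by_contra h0
    obtain ⟨t, ht⟩ := hgram _ _ h0
    have h1 := heq k
    have h2 := hlt i
    have h3 := hm1 i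
    have ht1 : t = 1 := by
      have h4 : t < 2 := by
        by_contra! h5
        have := Nat.mul_le_mul_left n h5
        omega
      have h5 : t ≠ 0 := by rintro rfl; omega
      omega
    rw [ht1] at ht
    exact hi (hone _ _ (by omega) (by omega))
  · by_contra h0
    obtain ⟨a, ha, hdetQ⟩ := exists_det_jac_eq hα hg
    have hε : act c (Q W α) = (actMat c).det * Q W α := by
      have h1 := act_det_jac (hg.act_eq hcW)
      rw [hdetQ, map_mul, mul_left_comm] at h1
      refine mul_left_cancel₀ (a := (C a : S l)) (by simpa using ha) ?_
      rw [← h1]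
      simp [act]
    have h1 : ζ ^ N * aeval z (Q W α) = aeval z (actMat c).det * aeval z (Q W α) := by
      rw [← hact (Q_isHomogeneous α), hε, map_mul]
    have h2 := mul_right_cancel₀ hQz h1
    have h3 : act c (∑ r, pderiv r (g i) * pderiv r (Q W α)) =
        (actMat c).det * ∑ r, pderiv r (g i) * pderiv r (Q W α) :=
      act_sum_pderiv_mul_pderiv (act_det_actMat c c).2 (hg.act_eq hcW i) hε
    have hN1 : N = (N - 1) + 1 := by
      have h4 := Finset.single_le_sum (f := m) (fun i _ => Nat.zero_le _) (Finset.mem_univ k)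
      rw [hsum] at h4
      have := hm1 k
      omega
    have hQhom : (Q W α).IsHomogeneous ((N - 1) + 1) := hN1 ▸ Q_isHomogeneous α
    have hhom : (∑ r, pderiv r (g i) * pderiv r (Q W α)).IsHomogeneous (m i + (N - 1)) :=
      IsHomogeneous.sum _ _ _ fun r _ => (hm i).pderiv.mul hQhom.pderiv
    have h4 := hact hhom
    rw [h3, map_mul, ← h2] at h4
    have h5 := mul_right_cancel₀ h0 h4
    -- `∇g_i·∇Q` has degree `m i + N - 1` and transforms by `det c`, which equals `ζ^N` since `Q(z)
    -- ≠ 0`. As `m i - 1 < n`, this forces exponent `1`.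
    have h6 : ζ ^ (m i - 1) = 1 := by
      have h7 : m i + (N - 1) = (m i - 1) + N := by have := hm1 i; omega
      rw [h7, pow_add] at h5
      exact (mul_right_cancel₀ (pow_ne_zero N hζ0) (by rw [one_mul]; exact h5)).symm
    have h8 := Nat.eq_zero_of_dvd_of_lt (horder _ h6) (by have := hlt i; omega)
    refine hi (hone _ _ (by have := hm1 i; omega) ?_)
    have := heq k
    omega

/-! ### The matrix of `d̂` with respect to the invariant forms -/

/-- The vector field `θ` takes the basic invariant `g k` to `q` and the others to `0`. -/
def IsPrimitiveField (q : S l) (g : Fin l → S l) (k : Fin l) (θ : Fin l → S l) : Prop :=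
  ∀ j, ∑ r, pderiv r (g j) * θ r = if j = k then q else 0

/-- The matrix of partial derivatives of the coefficients of a vector field. -/
noncomputable def fieldDeriv (θ : Fin l → S l) : Matrix (Fin l) (Fin l) (S l) :=
  Matrix.of fun n r => pderiv n (θ r)

theorem IsPrimitiveField.transpose_mulVec {q : S l} {g : Fin l → S l} {k : Fin l}
    {θ : Fin l → S l} (h : IsPrimitiveField q g k θ) :
    (jac g).transpose.mulVec θ = Pi.single k q := by
  ext1 j
  rw [Pi.single_apply, ← h j]
  rfl

theorem IsPrimitiveField.unique {q : S l} {g : Fin l → S l} {k : Fin l}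
    {θ θ' : Fin l → S l} (hdet : (jac g).det ≠ 0) (h : IsPrimitiveField q g k θ)
    (h' : IsPrimitiveField q g k θ') : θ = θ' := by
  rw [← sub_eq_zero]
  refine Matrix.eq_zero_of_mulVec_eq_zero (M := (jac g).transpose)
    (by rwa [Matrix.det_transpose]) ?_
  rw [Matrix.mulVec_sub, h.transpose_mulVec, h'.transpose_mulVec, sub_self]

/-- Cramer's rule: `θ` is a column of the adjugate of `Jᵀ`, divided by the constant `det J / Q`. -/
theorem exists_isPrimitiveField {W : Subgroup (V l ≃ₗᵢ[ℝ] V l)} [Finite W]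
    {α : Submodule ℝ (V l) → Module.Dual ℝ (V l)} (hα : IsDefining W α)
    {g : Fin l → S l} (hg : IsBasicInvariants W g) {m : Fin l → ℕ}
    (hm : ∀ j, (g j).IsHomogeneous (m j + 1)) (k : Fin l) :
    ∃ θ, IsPrimitiveField (Q W α) g k θ ∧
      ∀ r, (θ r).IsHomogeneous (∑ j ∈ Finset.univ.erase k, m j) := by
  obtain ⟨c, hc, h⟩ := exists_det_jac_eq hα hg
  refine ⟨fun r => C c⁻¹ * (jac g).transpose.adjugate r k, fun j => ?_, fun r => ?_⟩
  · have h1 := congrFun (congrFun (Matrix.mul_adjugate (jac g).transpose) j) k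
    rw [Matrix.det_transpose, h, Matrix.mul_apply, Matrix.smul_apply, Matrix.one_apply] at h1
    calc ∑ r, pderiv r (g j) * (C c⁻¹ * (jac g).transpose.adjugate r k)
        = C c⁻¹ * ∑ r, (jac g).transpose j r * (jac g).transpose.adjugate r k := by
          rw [Finset.mul_sum]
          exact Finset.sum_congr rfl fun r _ => by
            rw [Matrix.transpose_apply, jac, Matrix.of_apply]; ring
      _ = _ := by
          rw [h1]
          split_ifs
          · rw [smul_eq_mul, mul_one, ← mul_assoc, ← C_mul, inv_mul_cancel₀ hc, C_1, one_mul]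
          · simp
  · refine IsHomogeneous.C_mul ?_ _
    rw [Matrix.adjugate_apply, ← Matrix.det_transpose, ← Matrix.updateCol_transpose,
      Matrix.transpose_transpose]
    have h1 : ∑ j ∈ Finset.univ.erase k, m j = ∑ j, if j = k then 0 else m j := by
      rw [← Finset.add_sum_erase Finset.univ (fun j => if j = k then 0 else m j)
        (Finset.mem_univ k), if_pos rfl, zero_add]
      exact Finset.sum_congr rfl fun j hj => (if_neg (Finset.ne_of_mem_erase hj)).symm
    rw [h1]
    refine det_isHomogeneous fun i j => ?_
    rw [Matrix.updateCol_apply]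
    split_ifs
    · rw [Pi.single_apply]
      split_ifs
      · exact isHomogeneous_one _ _
      · exact isHomogeneous_zero _ _ _
    · exact (hm j).pderiv

theorem act_refl_Q {W : Subgroup (V l ≃ₗᵢ[ℝ] V l)} [Finite W]
    {α : Submodule ℝ (V l) → Module.Dual ℝ (V l)} (hα : IsDefining W α)
    {g : Fin l → S l} (hg : IsBasicInvariants W g) {v : V l} (hv : v ≠ 0) (hvW : refl v ∈ W) :
    act (refl v) (Q W α) = -Q W α := by
  obtain ⟨c, hc, h⟩ := exists_det_jac_eq hα hg
  have h1 := act_det_jac (hg.act_eq hvW)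
  rw [det_actMat_refl hv, h, map_mul, neg_one_mul, ← mul_neg] at h1
  refine mul_left_cancel₀ (a := (C c : S l)) (by simpa using hc) ?_
  rw [← h1]
  simp [act]

/-- A reflection with matrix `A` takes `J` to `AJ`, `θ` to `-Aθ` and `B = fieldDeriv θ` to `-ABAᵀ`,
so the entries of `JᵀBJ` change sign. -/
theorem exists_mul_fieldDeriv_mul_eq {W : Subgroup (V l ≃ₗᵢ[ℝ] V l)} [Finite W]
    {α : Submodule ℝ (V l) → Module.Dual ℝ (V l)} (hα : IsDefining W α)
    {g : Fin l → S l} (hg : IsBasicInvariants W g) {k : Fin l} {θ : Fin l → S l}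
    (hθ : IsPrimitiveField (Q W α) g k θ) :
    ∃ U, (jac g).transpose * fieldDeriv θ * jac g = Q W α • U := by
  have hdet := det_jac_ne_zero hα hg
  suffices h : ∀ i j, Q W α ∣ ((jac g).transpose * fieldDeriv θ * jac g) i j by
    choose U hU using h
    exact ⟨Matrix.of U, by ext1 i j; rw [hU]; rfl⟩
  intro i j
  refine Q_dvd hα fun H hH => lin_dvd_of_act_refl_eq_neg ?_
  have hv := hα.normalVec_ne_zero hH
  have hvW := hα.refl_mem hH
  set v := normalVec (α H)
  set A := actMat (refl v) with hA
  have hJ : (jac g).map (act (refl v)) = A * jac g := actMat_mul_map_jac (hg.act_eq hvW)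
  have hact : (fun r => act (refl v) (θ r)) = -A.mulVec θ := by
    rw [← sub_eq_zero]
    refine Matrix.eq_zero_of_mulVec_eq_zero (M := (A * jac g).transpose) ?_ ?_
    · rw [Matrix.det_transpose, Matrix.det_mul, det_actMat_refl hv]
      simpa using hdet
    · rw [Matrix.mulVec_sub, Matrix.mulVec_neg, Matrix.transpose_mul A, Matrix.mulVec_mulVec _ _ A,
        mul_assoc, actMat_transpose_mul, mul_one, hθ.transpose_mulVec, ← Matrix.transpose_mul, ← hJ]
      ext1 j
      have h1 := congrArg (act (refl v)) (hθ j)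
      rw [map_sum] at h1
      simp only [map_mul, apply_ite (act (refl v)), map_zero, act_refl_Q hα hg hv hvW] at h1
      simp only [Pi.sub_apply, Matrix.mulVec, dotProduct, Matrix.transpose_apply,
        Matrix.map_apply, jac, Matrix.of_apply, h1, Pi.neg_apply, Pi.single_apply, Pi.zero_apply]
      split_ifs <;> simp
  have hM : (fieldDeriv θ).map (act (refl v)) = -(A * fieldDeriv θ * A.transpose) := by
    have h1 : -(fieldDeriv θ * A.transpose) =
        A.transpose * (fieldDeriv θ).map (act (refl v)) := by
      ext1 n r
      have h2 := pderiv_act (refl v) n (θ r)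
      have h3 := congrFun hact r
      simp only [Pi.neg_apply] at h3
      rw [h3, map_neg, Matrix.mulVec, dotProduct, map_sum] at h2
      simp only [Derivation.leibniz, smul_eq_mul, hA, actMat, Matrix.of_apply, pderiv_C,
        mul_zero, add_zero] at h2
      simp only [Matrix.neg_apply, Matrix.mul_apply, Matrix.transpose_apply, Matrix.map_apply,
        fieldDeriv, Matrix.of_apply, hA, actMat]
      rw [← h2]
      congr 1
      exact Finset.sum_congr rfl fun q _ => mul_comm _ _
    calc (fieldDeriv θ).map (act (refl v))
        = A * (A.transpose * (fieldDeriv θ).map (act (refl v))) := by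
          rw [← mul_assoc, hA, actMat_mul_transpose, one_mul]
      _ = _ := by rw [← h1, mul_neg, mul_assoc]
  have h1 : ((jac g).transpose * fieldDeriv θ * jac g).map (act (refl v)) =
      -((jac g).transpose * fieldDeriv θ * jac g) := by
    rw [Matrix.map_mul, Matrix.map_mul, Matrix.transpose_map, hJ, hM, Matrix.transpose_mul]
    have h2 : A.transpose * A = 1 := actMat_transpose_mul _
    calc (jac g).transpose * A.transpose * -(A * fieldDeriv θ * A.transpose) * (A * jac g)
        = -((jac g).transpose * (A.transpose * A) * fieldDeriv θ * (A.transpose * A) * jac g) := by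
          simp only [mul_neg, neg_mul, mul_assoc]
      _ = _ := by rw [h2, mul_one, mul_one]
  exact congrFun (congrFun h1 i) j

/-- Differentiate the defining relation of `θ` with respect to `x_n`. -/
theorem IsPrimitiveField.fieldDeriv_mul_jac {q : S l} {g : Fin l → S l} {k : Fin l}
    {θ : Fin l → S l} (h : IsPrimitiveField q g k θ) (n j : Fin l) :
    (fieldDeriv θ * jac g) n j =
      (if j = k then pderiv n q else 0) - ∑ r, θ r * pderiv r (pderiv n (g j)) := by
  have h1 := congrArg (pderiv n) (h j)
  rw [map_sum, apply_ite (pderiv n), map_zero] at h1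
  rw [← h1, ← Finset.sum_sub_distrib, Matrix.mul_apply]
  refine Finset.sum_congr rfl fun r _ => ?_
  rw [Derivation.leibniz, pderiv_comm r n]
  simp only [fieldDeriv, jac, Matrix.of_apply, smul_eq_mul]
  ring

/-- At `z` one has `θ = a z` and `∇Q = aN ∇g_k`, so `fieldDeriv_mul_jac` and Euler's formula for the
partial derivatives of `g_j` show that `∇g_j(z)` is an eigenvector with eigenvalue `a(δ_{jk}N - m
j)`. -/
theorem map_det_fieldDeriv_ne_zero {W : Subgroup (V l ≃ₗᵢ[ℝ] V l)} [Finite W] (hl : 2 ≤ l)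
    {α : Submodule ℝ (V l) → Module.Dual ℝ (V l)} (hα : IsDefining W α)
    {g : Fin l → S l} (hg : IsBasicInvariants W g) {k : Fin l} {θ : Fin l → S l}
    (hθ : IsPrimitiveField (Q W α) g k θ) {m : Fin l → ℕ}
    (hm : ∀ j, (g j).IsHomogeneous (m j + 1)) (hm1 : ∀ j, 1 ≤ m j) {z : Fin l → ℂ}
    (hz : IsRegularVector W (Q W α) g k m z) : aeval z (fieldDeriv θ).det ≠ 0 := by
  classical
  set N := (arrangement W).ncard with hN
  set q := Q W α with hq
  set J := (jac g).map (aeval z) with hJ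
  have hJz : J.det ≠ 0 := by
    obtain ⟨a, ha, h⟩ := exists_det_jac_eq hα hg
    have h1 := (aeval z : S l →ₐ[ℝ] ℂ).map_det (jac g)
    rw [AlgHom.mapMatrix_apply] at h1
    rw [hJ, ← h1, h, map_mul, algHom_C]
    exact mul_ne_zero (by simpa using ha) hz.Q_ne_zero
  have hinj : ∀ u w : Fin l → ℂ, J.transpose.mulVec u = J.transpose.mulVec w → u = w := by
    intro u w h
    rw [← sub_eq_zero]
    refine Matrix.eq_zero_of_mulVec_eq_zero (M := J.transpose) (by rwa [Matrix.det_transpose]) ?_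
    rw [Matrix.mulVec_sub, h, sub_self]
  have hmulVec : ∀ (f : Fin l → S l) j, J.transpose.mulVec (fun r => aeval z (f r)) j =
      aeval z (∑ r, pderiv r (g j) * f r) := by
    intro f j
    simp [hJ, Matrix.mulVec, dotProduct, jac]
  have hzX : z = fun r => aeval z (X r : S l) := by ext; simp
  have hd : ((m k + 1 : ℕ) : ℂ) * aeval z (g k) ≠ 0 :=
    mul_ne_zero (Nat.cast_ne_zero.2 (Nat.succ_ne_zero _)) hz.ne_zero
  set a : ℂ := aeval z q / (((m k + 1 : ℕ) : ℂ) * aeval z (g k)) with ha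
  have ha0 : a ≠ 0 := div_ne_zero hz.Q_ne_zero hd
  have heuler : ∀ j, J.transpose.mulVec z j = ((m j + 1 : ℕ) : ℂ) * aeval z (g j) := by
    intro j
    conv_lhs => rw [hzX]
    rw [hmulVec]
    have := congrArg (aeval z) (hm j).sum_X_mul_pderiv
    rw [map_nsmul, nsmul_eq_mul] at this
    rw [← this]
    congr 1
    exact Finset.sum_congr rfl fun r _ => mul_comm _ _
  have hθz : (fun r => aeval z (θ r)) = a • z := by
    apply hinj
    ext1 j
    rw [hmulVec, hθ j, Matrix.mulVec_smul, Pi.smul_apply, heuler, smul_eq_mul]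
    split_ifs with h
    · rw [h, ha, div_mul_cancel₀ _ hd]
    · rw [hz.eq_zero j h, map_zero, mul_zero, mul_zero]
  obtain ⟨i₀, hi₀⟩ := hz.orthogonal
  -- Both gradients are orthogonal to all `∇g_i(z)` with `i ≠ i₀`, which leaves a line.
  have hgk : ∃ ρ : ℂ, ∀ n, aeval z (pderiv n q) = ρ * aeval z (pderiv n (g k)) := by
    have hne : aeval z (∑ n, pderiv n (g i₀) * pderiv n (g k)) ≠ 0 := by
      intro h0
      have h1 : (fun r => aeval z (pderiv r (g k))) = 0 := by
        apply hinj
        ext1 j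
        rw [hmulVec, Matrix.mulVec_zero, Pi.zero_apply]
        by_cases hj : j = i₀
        · rw [hj, h0]
        · exact (hi₀ j hj).1
      exact hJz (Matrix.det_eq_zero_of_column_eq_zero k fun r => congrFun h1 r)
    refine ⟨aeval z (∑ n, pderiv n (g i₀) * pderiv n q) /
      aeval z (∑ n, pderiv n (g i₀) * pderiv n (g k)), fun n => ?_⟩
    have h1 := hinj (fun r => aeval z (pderiv r q))
      ((aeval z (∑ n, pderiv n (g i₀) * pderiv n q) /
      aeval z (∑ n, pderiv n (g i₀) * pderiv n (g k))) • fun r => aeval z (pderiv r (g k))) ?_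
    · exact congrFun h1 n
    · ext1 j
      rw [Matrix.mulVec_smul, Pi.smul_apply, hmulVec, hmulVec, smul_eq_mul]
      by_cases hj : j = i₀
      · rw [hj, div_mul_cancel₀ _ hne]
      · rw [(hi₀ j hj).1, (hi₀ j hj).2, mul_zero]
  obtain ⟨ρ, hρ⟩ := hgk
  have hρN : ρ = a * N := by
    have h1 := congrArg (aeval z) (Q_isHomogeneous (W := W) α).sum_X_mul_pderiv
    have h2 := congrArg (aeval z) (hm k).sum_X_mul_pderiv
    rw [map_sum, map_nsmul, nsmul_eq_mul] at h1 h2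
    simp only [map_mul, ← hq] at h1 h2
    simp only [hρ] at h1
    have h3 : ρ * (((m k + 1 : ℕ) : ℂ) * aeval z (g k)) = N * aeval z q := by
      rw [← h2, ← h1, Finset.mul_sum]
      exact Finset.sum_congr rfl fun r _ => by ring
    rw [ha, div_mul_eq_mul_div, eq_div_iff hd, h3, mul_comm]
  have hmain : (fieldDeriv θ).map (aeval z) * J =
      J * Matrix.diagonal fun j => a * ((if j = k then (N : ℂ) else 0) - m j) := by
    rw [hJ, ← Matrix.map_mul]
    ext1 n j
    rw [Matrix.map_apply, hθ.fieldDeriv_mul_jac, Matrix.mul_diagonal, Matrix.map_apply, jac,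
      Matrix.of_apply, map_sub, map_sum]
    have h1 : ∑ r, aeval z (θ r * pderiv r (pderiv n (g j))) =
        a * m j * aeval z (pderiv n (g j)) := by
      have h2 := congrArg (aeval z) ((hm j).pderiv (i := n)).sum_X_mul_pderiv
      rw [map_sum, map_nsmul, nsmul_eq_mul, Nat.add_sub_cancel] at h2
      rw [mul_assoc, ← h2, Finset.mul_sum]
      refine Finset.sum_congr rfl fun r _ => ?_
      have h3 := congrFun hθz r
      simp only [Pi.smul_apply, smul_eq_mul] at h3
      rw [map_mul, map_mul, h3, aeval_X]
      ring
    rw [h1]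
    split_ifs with h
    · rw [hρ, hρN, h]; ring
    · rw [map_zero]; ring
  have hdetmain := congrArg Matrix.det hmain
  rw [Matrix.det_mul, Matrix.det_mul, Matrix.det_diagonal, mul_comm] at hdetmain
  have h4 := mul_left_cancel₀ hJz hdetmain
  have h5 := (aeval z : S l →ₐ[ℝ] ℂ).map_det (fieldDeriv θ)
  rw [AlgHom.mapMatrix_apply] at h5
  rw [h5, h4, Finset.prod_ne_zero_iff]
  intro j _
  refine mul_ne_zero ha0 ?_
  have h6 := hm1 j
  split_ifs with h
  · have h7 := hz.two_mul_card
    have h8 : m k < N := by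
      by_contra! h9
      have := Nat.mul_le_mul_left (m k + 1) hl
      omega
    rw [h, sub_ne_zero]
    exact fun h9 => h8.ne' (Nat.cast_injective h9)
  · rw [zero_sub, neg_ne_zero]
    exact Nat.cast_ne_zero.2 (by omega)

theorem IsBasicInvariants.exists_isHomogeneous_succ {W : Subgroup (V l ≃ₗᵢ[ℝ] V l)}
    {g : Fin l → S l} (hg : IsBasicInvariants W g) (hW : IsFiniteCoxeterGroup W) (hl : 2 ≤ l)
    (hdet : (jac g).det ≠ 0) : ∃ m : Fin l → ℕ, ∀ j, (g j).IsHomogeneous (m j + 1) := by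
  choose d hd using hg.homogeneous
  refine ⟨fun j => d j - 1, fun j => ?_⟩
  have := two_le_degree hW hl hg hdet (hd j)
  rw [Nat.sub_add_cancel (by omega)]
  exact hd j

/-- Compare degrees in `det(JᵀBJ) = Q^l det U`: the left side has degree `2N + l(N - m k - 1)`,
which is `lN` because `2N = (m k + 1)l`. -/
theorem isUnit_det_of_mul_fieldDeriv_mul_eq {W : Subgroup (V l ≃ₗᵢ[ℝ] V l)}
    (hW : IsFiniteCoxeterGroup W) (hl : 2 ≤ l)
    {α : Submodule ℝ (V l) → Module.Dual ℝ (V l)} (hα : IsDefining W α)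
    {g : Fin l → S l} (hg : IsBasicInvariants W g) {k : Fin l}
    (hk : ∀ i, (g i).totalDegree ≤ (g k).totalDegree) {θ : Fin l → S l}
    (hθ : IsPrimitiveField (Q W α) g k θ) {U : Matrix (Fin l) (Fin l) (S l)}
    (hU : (jac g).transpose * fieldDeriv θ * jac g = Q W α • U) : IsUnit U.det := by
  have := hW.finite
  have hdet := det_jac_ne_zero hα hg
  have hg0 : ∀ j, g j ≠ 0 := fun j h =>
    hdet (Matrix.det_eq_zero_of_column_eq_zero j fun n => by simp [jac, h])
  obtain ⟨m, hm⟩ := hg.exists_isHomogeneous_succ hW hl hdet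
  have hm1 : ∀ j, 1 ≤ m j := fun j => by
    have := two_le_degree hW hl hg hdet (hm j)
    omega
  have hmk : ∀ j, m j ≤ m k := fun j => by
    have := hk j
    rw [(hm j).totalDegree (hg0 j), (hm k).totalDegree (hg0 k)] at this
    omega
  obtain ⟨z, hz⟩ := exists_isRegularVector hW hl hα hg hm hmk
  have hMz := map_det_fieldDeriv_ne_zero hl hα hg hθ hm hm1 hz
  have hM0 : (fieldDeriv θ).det ≠ 0 := fun h => hMz (by rw [h, map_zero])
  have hQ0 := Q_ne_zero hα
  obtain ⟨c, hc, hJ⟩ := exists_det_jac_eq hα hg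
  have hCc : (C c : S l) ≠ 0 := by simpa using hc
  have hdetU := congrArg Matrix.det hU
  rw [Matrix.det_mul, Matrix.det_mul, Matrix.det_transpose, Matrix.det_smul, Fintype.card_fin]
    at hdetU
  have hU0 : U.det ≠ 0 := by
    intro h
    rw [h, mul_zero] at hdetU
    exact mul_ne_zero (mul_ne_zero hdet hM0) hdet hdetU
  obtain ⟨θ', hθ', hhom⟩ := exists_isPrimitiveField hα hg hm k
  rw [← hθ.unique hdet hθ'] at hhom
  set N := (arrangement W).ncard with hN
  have hsum : m k + ∑ j ∈ Finset.univ.erase k, m j = N := by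
    rw [Finset.add_sum_erase _ _ (Finset.mem_univ k)]
    exact sum_degree_sub_one hα hg hm
  set d := ∑ j ∈ Finset.univ.erase k, m j with hd
  have hMhom : (fieldDeriv θ).det.IsHomogeneous (∑ _j : Fin l, (d - 1)) :=
    det_isHomogeneous fun i j => (hhom j).pderiv
  have hJhom : (jac g).det.IsHomogeneous N := by
    rw [hJ]
    exact (Q_isHomogeneous α).C_mul c
  have h1 := congrArg totalDegree hdetU
  rw [totalDegree_mul_of_isDomain (pow_ne_zero _ hQ0) hU0,
    ((Q_isHomogeneous α).pow l).totalDegree (pow_ne_zero _ hQ0),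
    ((hJhom.mul hMhom).mul hJhom).totalDegree (mul_ne_zero (mul_ne_zero hdet hM0) hdet)] at h1
  rw [Finset.sum_const, Finset.card_univ, Fintype.card_fin, smul_eq_mul, ← hN] at h1
  have h2 := hz.two_mul_card
  rw [← hN] at h2
  have hd1 : 1 ≤ d := by
    by_contra! h0
    have := hm1 k
    have := Nat.mul_le_mul_left (m k + 1) hl
    omega
  have h3 : U.det.totalDegree = 0 := by
    obtain ⟨e, he⟩ := Nat.exists_eq_add_of_le' hd1
    rw [he, Nat.add_sub_cancel] at h1
    have h4 : N = m k + 1 + e := by omega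
    have h5 : N * l = 2 * N + l * e := by
      rw [h2, ← mul_comm l, ← mul_comm l, ← mul_add, ← h4]
    omega
  rw [totalDegree_eq_zero_iff_eq_C.1 h3] at hU0 ⊢
  exact (IsUnit.mk0 _ (by simpa using hU0)).map C

/-! ### Lattices of forms -/

/-- The subring of polynomials inside the field of rational functions. -/
noncomputable def polys (l : ℕ) : Subring (K l) := (algebraMap (S l) (K l)).range

theorem algebraMap_mem_polys (s : S l) : algebraMap (S l) (K l) s ∈ polys l := ⟨s, rfl⟩

theorem det_mem_polys {n : Type*} [Fintype n] [DecidableEq n] {M : Matrix n n (K l)}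
    (h : ∀ i j, M i j ∈ polys l) : M.det ∈ polys l := by
  rw [Matrix.det_apply]
  refine sum_mem fun σ _ => ?_
  rw [Units.smul_def]
  exact zsmul_mem (prod_mem fun i _ => h _ _) _

/-- The `S`-lattice of `p`-forms spanned by the exterior products of the elements of a basis. -/
noncomputable def lattice (b : Module.Basis (Fin l) (K l) (Form1 l)) (p : ℕ) :
    Submodule (S l) (Form l p) :=
  Submodule.span (S l) (Set.range (exteriorPower.ιMulti_family (K l) p b))

theorem mem_lattice_iff {b : Module.Basis (Fin l) (K l) (Form1 l)} {p : ℕ} {ω : Form l p} :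
    ω ∈ lattice b p ↔ ∀ I, (b.exteriorPower p).repr ω I ∈ polys l := by
  rw [lattice, ← exteriorPower.coe_basis, Module.Basis.mem_span_iff_repr_mem]
  rfl

theorem repr_ιMulti (b : Module.Basis (Fin l) (K l) (Form1 l)) {p : ℕ}
    (I : Set.powersetCard (Fin l) p) (v : Fin p → Form1 l) :
    (b.exteriorPower p).repr (exteriorPower.ιMulti (K l) p v) I =
      (Matrix.of fun i j => b.repr (v i) (Set.powersetCard.ofFinEmbEquiv.symm I j)).det := by
  rw [exteriorPower.basis_repr_apply, exteriorPower.ιMultiDual_apply_ιMulti]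
  rfl

theorem ιMulti_mem_lattice {b : Module.Basis (Fin l) (K l) (Form1 l)} {p : ℕ}
    {v : Fin p → Form1 l} (hv : ∀ i j, b.repr (v i) j ∈ polys l) :
    exteriorPower.ιMulti (K l) p v ∈ lattice b p :=
  mem_lattice_iff.2 fun I => by
    rw [repr_ιMulti]
    exact det_mem_polys fun i j => hv _ _

theorem lattice_le {b b' : Module.Basis (Fin l) (K l) (Form1 l)}
    (h : ∀ i j, b'.repr (b i) j ∈ polys l) (p : ℕ) : lattice b p ≤ lattice b' p := by
  rw [lattice, Submodule.span_le]
  rintro _ ⟨I, rfl⟩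
  exact ιMulti_mem_lattice fun i j => h _ _

theorem dx_repr (v : Form1 l) (i : Fin l) : (dx l).repr v i = v i := by
  simp [dx]

/-! ### Exterior multiplication by a `1`-form and exterior differentiation -/

/-- Exterior multiplication by a `1`-form. -/
noncomputable def wedge (l p : ℕ) : Form1 l →ₗ[K l] Form l p →ₗ[K l] Form l (p + 1) :=
  exteriorPower.alternatingMapLinearEquiv.toLinearMap ∘ₗ
    (exteriorPower.ιMulti (K l) (p + 1)).curryLeft

theorem wedge_ιMulti {p : ℕ} (u : Form1 l) (v : Fin p → Form1 l) :
    wedge l p u (exteriorPower.ιMulti (K l) p v) =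
      exteriorPower.ιMulti (K l) (p + 1) (Fin.cons u v) := by
  simp only [wedge, LinearMap.comp_apply, LinearEquiv.coe_coe,
    exteriorPower.alternatingMapLinearEquiv_apply_ιMulti]
  rfl

theorem dFun_mul (f h : K l) : dFun (f * h) = f • dFun h + h • dFun f := by
  simp only [dFun, Derivation.leibniz, Finset.smul_sum, ← Finset.sum_add_distrib]
  exact Finset.sum_congr rfl fun i _ => by rw [add_smul, smul_eq_mul, smul_eq_mul, mul_smul, mul_smul]

theorem dFun_apply (f : K l) (i : Fin l) : dFun f i = partialD i f := by
  rw [dFun, Finset.sum_apply, Finset.sum_eq_single i]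
  · simp [dx]
  · intro j _ hj; simp [dx, hj.symm]
  · simp

theorem partialD_algebraMap (i : Fin l) (s : S l) :
    partialD i (algebraMap (S l) (K l) s) = algebraMap (S l) (K l) (pderiv i s) :=
  extDerivation_algebraMap _ _

theorem extDer_eq_sum {p : ℕ} (ω : Form l p) :
    extDer ω = ∑ I, wedge l p (dFun (((dx l).exteriorPower p).repr ω I))
      (exteriorPower.ιMulti_family (K l) p (dx l) I) := by
  rw [extDer]
  refine Finset.sum_congr rfl fun I _ => ?_
  rw [exteriorPower.ιMulti_family, wedge_ιMulti]
  rfl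

theorem wedge_dFun_mul {p : ℕ} (f h : K l) (ω : Form l p) :
    wedge l p (dFun (f * h)) ω = f • wedge l p (dFun h) ω + h • wedge l p (dFun f) ω := by
  rw [dFun_mul, (wedge l p).map_add, (wedge l p).map_smul, (wedge l p).map_smul]
  rfl

theorem wedge_eq_sum {p : ℕ} (u : Form1 l) (ω : Form l p) :
    wedge l p u ω = ∑ I, ((dx l).exteriorPower p).repr ω I •
      wedge l p u (exteriorPower.ιMulti_family (K l) p (dx l) I) := by
  have h := ((dx l).exteriorPower p).sum_repr ω
  simp only [exteriorPower.basis_apply] at h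
  conv_lhs => rw [← h]
  exact map_sum (wedge l p u) _ _ |>.trans
    (Finset.sum_congr rfl fun I _ => (wedge l p u).map_smul _ _)

theorem extDer_smul {p : ℕ} (f : K l) (ω : Form l p) :
    extDer (f • ω) = wedge l p (dFun f) ω + f • extDer ω := by
  rw [extDer_eq_sum, extDer_eq_sum, wedge_eq_sum, Finset.smul_sum, ← Finset.sum_add_distrib]
  refine Finset.sum_congr rfl fun I _ => ?_
  have h : ((dx l).exteriorPower p).repr (f • ω) I = f * ((dx l).exteriorPower p).repr ω I := by
    rw [LinearEquiv.map_smul]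
    rfl
  rw [h, wedge_dFun_mul]
  exact add_comm _ _

theorem polyForms_eq_lattice (l p : ℕ) : polyForms l p = lattice (dx l) p := rfl

theorem extDer_mem_polyForms {p : ℕ} {ω : Form l p} (hω : ω ∈ polyForms l p) :
    extDer ω ∈ polyForms l (p + 1) := by
  rw [polyForms_eq_lattice] at *
  rw [extDer_eq_sum]
  refine sum_mem fun I _ => ?_
  rw [exteriorPower.ιMulti_family, wedge_ιMulti]
  obtain ⟨s, hs⟩ := mem_lattice_iff.1 hω I
  refine ιMulti_mem_lattice fun i j => ?_
  rw [dx_repr]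
  refine Fin.cases ?_ (fun i => ?_) i
  · rw [Fin.cons_zero, ← hs, dFun_apply, partialD_algebraMap]
    exact algebraMap_mem_polys _
  · rw [Fin.cons_succ, Function.comp_apply, dx, Pi.basisFun_apply, Pi.single_apply]
    split_ifs
    · exact one_mem _
    · exact zero_mem _

/-- By Leibniz `q dω = d(qω) - dq ∧ ω`, and `d(qω)` is polynomial once `qω` is. The condition on
`dω` becomes linear over `S`. -/
theorem mem_logForms_iff {q : S l} (hq : q ≠ 0) {p : ℕ} {ω : Form l p} :
    ω ∈ logForms q p ↔ algebraMap (S l) (K l) q • ω ∈ polyForms l p ∧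
      wedge l p (dFun (algebraMap (S l) (K l) q)) ω ∈ polyForms l (p + 1) := by
  have hq' : algebraMap (S l) (K l) q ≠ 0 :=
    fun h => hq (IsFractionRing.injective (S l) (K l) (by rw [h, map_zero]))
  constructor
  · rintro ⟨⟨η, hη, h1⟩, ζ, hζ, h2⟩
    have h3 : algebraMap (S l) (K l) q • ω = η := by rw [h1, smul_inv_smul₀ hq']
    refine ⟨h3 ▸ hη, ?_⟩
    have h4 := extDer_smul (algebraMap (S l) (K l) q) ω
    rw [h2, smul_inv_smul₀ hq', h3] at h4
    rw [eq_sub_of_add_eq h4.symm]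
    exact sub_mem (extDer_mem_polyForms hη) hζ
  · rintro ⟨h1, h2⟩
    refine ⟨⟨_, h1, by rw [inv_smul_smul₀ hq']⟩, algebraMap (S l) (K l) q • extDer ω, ?_,
      by rw [inv_smul_smul₀ hq']⟩
    have h4 := extDer_smul (algebraMap (S l) (K l) q) ω
    rw [eq_sub_of_add_eq' h4.symm]
    exact sub_mem (extDer_mem_polyForms h1) h2

/-! ### Evaluation of forms on vector fields -/

/-- The pairing of a `1`-form with a vector field. -/
noncomputable def pairing (θ : Fin l → K l) : Module.Dual (K l) (Form1 l) where
  toFun v := ∑ n, v n * θ n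
  map_add' u v := by simp [add_mul, Finset.sum_add_distrib]
  map_smul' c v := by simp [Finset.mul_sum, mul_assoc]

/-- The evaluation of a `p`-form on `p` vector fields. -/
noncomputable def evalForm {p : ℕ} (θ : Fin p → Fin l → K l) : Form l p →ₗ[K l] K l :=
  exteriorPower.pairingDual (K l) (Form1 l) p
    (exteriorPower.ιMulti (K l) p fun j => pairing (θ j))

theorem evalForm_ιMulti {p : ℕ} (θ : Fin p → Fin l → K l) (v : Fin p → Form1 l) :
    evalForm θ (exteriorPower.ιMulti (K l) p v) =
      (Matrix.of fun i j => pairing (θ j) (v i)).det :=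
  exteriorPower.pairingDual_ιMulti_ιMulti _ _

/-- Laplace expansion along the row of `u`. -/
theorem evalForm_wedge {p : ℕ} (θ : Fin (p + 1) → Fin l → K l) (u : Form1 l) (ω : Form l p) :
    evalForm θ (wedge l p u ω) = ∑ j : Fin (p + 1), (-1) ^ (j : ℕ) * pairing (θ j) u *
      evalForm (fun i => θ (j.succAbove i)) ω := by
  have h : evalForm θ ∘ₗ wedge l p u = ∑ j : Fin (p + 1), ((-1) ^ (j : ℕ) * pairing (θ j) u) •
      evalForm (fun i => θ (j.succAbove i)) := by
    refine exteriorPower.linearMap_ext (AlternatingMap.ext fun v => ?_)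
    simp only [LinearMap.compAlternatingMap_apply, LinearMap.comp_apply, wedge_ιMulti,
      evalForm_ιMulti, LinearMap.sum_apply, LinearMap.smul_apply, smul_eq_mul]
    rw [Matrix.det_succ_row_zero]
    rfl
  have := LinearMap.congr_fun h ω
  simpa only [LinearMap.comp_apply, LinearMap.sum_apply, LinearMap.smul_apply, smul_eq_mul]
    using this

theorem evalForm_mem_polys {p : ℕ} {θ : Fin p → Fin l → K l} (hθ : ∀ i j, θ i j ∈ polys l)
    {ω : Form l p} (hω : ω ∈ polyForms l p) : evalForm θ ω ∈ polys l := by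
  rw [polyForms, ← exteriorPower.coe_basis] at hω
  induction hω using Submodule.span_induction with
  | mem x hx =>
    obtain ⟨I, rfl⟩ := hx
    rw [exteriorPower.basis_apply, exteriorPower.ιMulti_family, evalForm_ιMulti]
    refine det_mem_polys fun i j => ?_
    change ∑ n : Fin l, (dx l (Set.powersetCard.ofFinEmbEquiv.symm I i)) n * θ j n ∈ polys l
    refine sum_mem fun n _ => mul_mem ?_ (hθ _ _)
    rw [dx, Pi.basisFun_apply, Pi.single_apply]
    split_ifs
    · exact one_mem _
    · exact zero_mem _
  | zero => rw [map_zero]; exact zero_mem _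
  | add x y _ _ hx hy => rw [map_add]; exact add_mem hx hy
  | smul s x _ hx =>
    rw [← algebraMap_smul (K l) s x, map_smul, smul_eq_mul]
    exact mul_mem (algebraMap_mem_polys s) hx

/-! ### Logarithmic forms -/

theorem algebraMap_ne_zero {s : S l} (hs : s ≠ 0) : algebraMap (S l) (K l) s ≠ 0 :=
  fun h => hs (IsFractionRing.injective (S l) (K l) (by rw [h, map_zero]))

theorem dvd_of_eq_mul_mem_polys {q s : S l} {t : K l} (ht : t ∈ polys l)
    (h : algebraMap (S l) (K l) s = algebraMap (S l) (K l) q * t) : q ∣ s := by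
  obtain ⟨t, rfl⟩ := ht
  exact ⟨t, IsFractionRing.injective (S l) (K l) (by rw [h, map_mul])⟩

/-- The basis of `1`-forms in which the coordinates of a form are given by an invertible
matrix. -/
noncomputable def coordBasis (M : Matrix (Fin l) (Fin l) (K l)) (hM : IsUnit M.det) :
    Module.Basis (Fin l) (K l) (Form1 l) :=
  Module.Basis.ofEquivFun (Matrix.toLin'OfInv (M.mul_nonsing_inv hM) (M.nonsing_inv_mul hM)).symm

theorem coordBasis_repr {M : Matrix (Fin l) (Fin l) (K l)} (hM : IsUnit M.det) (v : Form1 l)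
    (i : Fin l) : (coordBasis M hM).repr v i = M.mulVec v i := by
  rw [coordBasis, Module.Basis.ofEquivFun_repr_apply]
  rfl

theorem mulVec_coordBasis {M : Matrix (Fin l) (Fin l) (K l)} (hM : IsUnit M.det) (j : Fin l) :
    M.mulVec (coordBasis M hM j) = Pi.single j 1 := by
  ext i
  rw [← coordBasis_repr hM, Module.Basis.repr_self, Finsupp.single_apply, Pi.single_apply]
  simp only [eq_comm]

theorem pi_single_mem_polys (i j : Fin l) : (Pi.single i 1 : Form1 l) j ∈ polys l := by
  rw [Pi.single_apply]
  split_ifs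
  · exact one_mem _
  · exact zero_mem _

theorem mulVec_mem_polys {M : Matrix (Fin l) (Fin l) (S l)} {v : Form1 l}
    (hv : ∀ i, v i ∈ polys l) (i : Fin l) :
    (M.map (algebraMap (S l) (K l))).mulVec v i ∈ polys l := by
  change ∑ j, algebraMap (S l) (K l) (M i j) * v j ∈ polys l
  exact sum_mem fun j _ => mul_mem (algebraMap_mem_polys _) (hv j)

theorem lattice_coordBasis_le {M M' : Matrix (Fin l) (Fin l) (K l)} (hM : IsUnit M.det)
    (hM' : IsUnit M'.det) {U : Matrix (Fin l) (Fin l) (S l)}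
    (h : M' = U.map (algebraMap (S l) (K l)) * M) (p : ℕ) :
    lattice (coordBasis M hM) p ≤ lattice (coordBasis M' hM') p := by
  refine lattice_le (fun i j => ?_) p
  rw [coordBasis_repr, h, ← Matrix.mulVec_mulVec, mulVec_coordBasis]
  exact mulVec_mem_polys (pi_single_mem_polys i) j

theorem det_toSquareBlockProp_eq {R m n : Type*} [CommRing R] [Fintype m] [Fintype n]
    [DecidableEq m] [DecidableEq n] (T : Matrix m m R) {P : m → Prop} [DecidablePred P]
    (e : n ≃ {i // P i}) :
    (T.toSquareBlockProp P).det = (Matrix.of fun i j => T (e i) (e j)).det :=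
  (Matrix.det_submatrix_equiv_self e _).symm

/-- Jacobi's identity for minors of `M⁻¹`. Replacing columns of the identity by columns of `M⁻¹`
gives a matrix `T` whose determinant is the minor, while `M T` has polynomial entries. -/
theorem mul_det_mem_polys {M : Matrix (Fin l) (Fin l) (S l)}
    (hM : IsUnit (M.map (algebraMap (S l) (K l))).det) {p : ℕ} (m : Fin p → Fin l)
    {k : Fin p → Fin l} (hk : Function.Injective k) :
    (M.map (algebraMap (S l) (K l))).det *
      (Matrix.of fun i j => coordBasis _ hM (m i) (k j)).det ∈ polys l := by
  classical
  set δ := coordBasis _ hM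
  let T : Matrix (Fin l) (Fin l) (K l) := Matrix.of fun n c =>
    if h : c ∈ Set.range k then δ (m h.choose) n else (Pi.single c 1 : Form1 l) n
  have hTk : ∀ i n, T n (k i) = δ (m i) n := fun i n => by
    have h : k i ∈ Set.range k := ⟨i, rfl⟩
    simp only [T, Matrix.of_apply, dif_pos h, hk h.choose_spec]
  have hT : T.det = (Matrix.of fun i j => δ (m i) (k j)).det := by
    rw [Matrix.twoBlockTriangular_det' T (· ∈ Set.range k)]
    · have h1 : T.toSquareBlockProp (fun i => ¬ i ∈ Set.range k) = 1 := by
        ext1 ⟨i, hi⟩ ⟨j, hj⟩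
        simp only [Matrix.toSquareBlockProp_def, Matrix.of_apply, T, dif_neg hj, Matrix.one_apply,
          Pi.single_apply, Subtype.mk.injEq]
      rw [h1, Matrix.det_one, mul_one, ← Matrix.det_transpose (Matrix.of _)]
      rw [det_toSquareBlockProp_eq T (Equiv.ofInjective k hk)]
      congr 1
      ext1 i j
      exact hTk j (k i)
    · intro i hi j hj
      simp only [T, Matrix.of_apply, dif_neg hj, Pi.single_apply]
      exact if_neg fun h : i = j => hj (h ▸ hi)
  rw [← hT, ← Matrix.det_mul]
  refine det_mem_polys fun i c => ?_
  change (M.map (algebraMap (S l) (K l))).mulVec (fun n => T n c) i ∈ polys l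
  by_cases h : c ∈ Set.range k
  · obtain ⟨j, rfl⟩ := h
    simp only [hTk]
    change (M.map (algebraMap (S l) (K l))).mulVec (δ (m j)) i ∈ polys l
    rw [mulVec_coordBasis]
    exact pi_single_mem_polys _ _
  · simp only [T, Matrix.of_apply, dif_neg h]
    exact mulVec_mem_polys (pi_single_mem_polys c) i

theorem smul_ιMulti_mem_polyForms {M : Matrix (Fin l) (Fin l) (S l)}
    (hM : IsUnit (M.map (algebraMap (S l) (K l))).det) {p : ℕ} (m : Fin p → Fin l) :
    (M.map (algebraMap (S l) (K l))).det •
      exteriorPower.ιMulti (K l) p (fun i => coordBasis _ hM (m i)) ∈ polyForms l p := by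
  rw [polyForms_eq_lattice, mem_lattice_iff]
  intro I
  rw [LinearEquiv.map_smul, Finsupp.smul_apply, repr_ιMulti, smul_eq_mul]
  simp only [dx_repr]
  exact mul_det_mem_polys hM m (Set.powersetCard.ofFinEmbEquiv.symm I).injective

theorem exteriorPower_repr_eq_evalForm {M : Matrix (Fin l) (Fin l) (K l)} (hM : IsUnit M.det)
    {p : ℕ} (ω : Form l p) (I : Set.powersetCard (Fin l) p) :
    ((coordBasis M hM).exteriorPower p).repr ω I =
      evalForm (fun j => M (Set.powersetCard.ofFinEmbEquiv.symm I j)) ω := by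
  have h : (fun j => (coordBasis M hM).coord (Set.powersetCard.ofFinEmbEquiv.symm I j)) =
      fun j => pairing (M (Set.powersetCard.ofFinEmbEquiv.symm I j)) := by
    ext1 j
    refine LinearMap.ext fun v => ?_
    rw [Module.Basis.coord_apply, coordBasis_repr]
    change ∑ n, M _ n * v n = ∑ n, v n * M _ n
    exact Finset.sum_congr rfl fun n _ => mul_comm _ _
  rw [exteriorPower.basis_repr_apply, evalForm, ← h]
  rfl

theorem pairing_dFun (θ : Fin l → S l) (q : S l) :
    pairing (fun n => algebraMap (S l) (K l) (θ n)) (dFun (algebraMap (S l) (K l) q)) =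
      algebraMap (S l) (K l) (∑ n, θ n * pderiv n q) := by
  change ∑ n, dFun (algebraMap (S l) (K l) q) n * algebraMap (S l) (K l) (θ n) = _
  rw [map_sum]
  exact Finset.sum_congr rfl fun n _ => by
    rw [dFun_apply, partialD_algebraMap, map_mul, mul_comm]

/-- By `hu`, the coordinates of `dq` in the basis dual to the rows of `M` are multiples of `q`. So
`dq ∧ ω`, like `qω`, is an `S`-combination of `q` times products of basis forms, which are
polynomial by `smul_ιMulti_mem_polyForms`. -/
theorem wedge_mem_polyForms_of_mem_lattice {q : S l} {c : ℝ} {M : Matrix (Fin l) (Fin l) (S l)}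
    (hM : IsUnit (M.map (algebraMap (S l) (K l))).det) (hc : c ≠ 0) (hdet : M.det = C c * q)
    (hu : ∀ i, q ∣ ∑ n, M i n * pderiv n q) {p : ℕ} {ω : Form l p}
    (hω : ω ∈ lattice (coordBasis _ hM) p) :
    algebraMap (S l) (K l) q • ω ∈ polyForms l p ∧
      wedge l p (dFun (algebraMap (S l) (K l) q)) ω ∈ polyForms l (p + 1) := by
  have hq : algebraMap (S l) (K l) q = algebraMap (S l) (K l) (C c⁻¹) *
      (M.map (algebraMap (S l) (K l))).det := by
    have h1 := (algebraMap (S l) (K l)).map_det M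
    rw [RingHom.mapMatrix_apply] at h1
    rw [← h1, hdet, ← map_mul, ← mul_assoc, ← C_mul, inv_mul_cancel₀ hc, C_1, one_mul]
  have hmem : ∀ {p : ℕ} (m : Fin p → Fin l), algebraMap (S l) (K l) q •
      exteriorPower.ιMulti (K l) p (fun i => coordBasis _ hM (m i)) ∈ polyForms l p := by
    intro p m
    rw [hq, mul_smul, algebraMap_smul]
    exact Submodule.smul_mem _ _ (smul_ιMulti_mem_polyForms hM m)
  choose u hu using hu
  have hd : dFun (algebraMap (S l) (K l) q) =
      ∑ i, (algebraMap (S l) (K l) (u i) * algebraMap (S l) (K l) q) • coordBasis _ hM i := by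
    conv_lhs => rw [← (coordBasis _ hM).sum_repr (dFun (algebraMap (S l) (K l) q))]
    refine Finset.sum_congr rfl fun i _ => ?_
    congr 1
    rw [coordBasis_repr, ← map_mul, mul_comm, ← hu, ← pairing_dFun]
    change ∑ n, algebraMap (S l) (K l) (M i n) * dFun (algebraMap (S l) (K l) q) n =
      ∑ n, dFun (algebraMap (S l) (K l) q) n * algebraMap (S l) (K l) (M i n)
    exact Finset.sum_congr rfl fun n _ => mul_comm _ _
  induction hω using Submodule.span_induction with
  | mem x hx =>
    obtain ⟨I, rfl⟩ := hx
    refine ⟨hmem _, ?_⟩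
    rw [hd, map_sum, LinearMap.sum_apply]
    refine sum_mem fun i _ => ?_
    rw [map_smul, LinearMap.smul_apply, mul_smul, algebraMap_smul, exteriorPower.ιMulti_family,
      wedge_ιMulti]
    refine Submodule.smul_mem _ _ ?_
    convert hmem (Fin.cons i (Set.powersetCard.ofFinEmbEquiv.symm I)) using 3
    ext1 j
    refine Fin.cases ?_ (fun j => ?_) j
    · rw [Fin.cons_zero, Fin.cons_zero]
    · rw [Fin.cons_succ, Fin.cons_succ]
      rfl
  | zero =>
    rw [smul_zero, map_zero]
    exact ⟨zero_mem _, zero_mem _⟩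
  | add x y _ _ hx hy =>
    rw [smul_add, map_add]
    exact ⟨add_mem hx.1 hy.1, add_mem hx.2 hy.2⟩
  | smul s x _ hx =>
    rw [← algebraMap_smul (K l) s x, map_smul, smul_smul, mul_comm, mul_smul, algebraMap_smul,
      algebraMap_smul]
    exact ⟨Submodule.smul_mem _ _ hx.1, Submodule.smul_mem _ _ hx.2⟩

/-- The coordinates of `ω` are its values on rows of `M`. With `s` such a value for `qω`, evaluating
`q (dq ∧ ω)` on `∂_n` and those rows gives `(∂_n q)s` plus multiples of `q`; hence `q` divides every
`(∂_n q)s`, and so `s` by `hsq`. -/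
theorem mem_lattice_of_wedge_mem_polyForms {q : S l} (hq : q ≠ 0)
    {M : Matrix (Fin l) (Fin l) (S l)}
    (hM : IsUnit (M.map (algebraMap (S l) (K l))).det)
    (hu : ∀ i, q ∣ ∑ n, M i n * pderiv n q)
    (hsq : ∀ s, (∀ n, q ∣ pderiv n q * s) → q ∣ s) {p : ℕ} {ω : Form l p}
    (h1 : algebraMap (S l) (K l) q • ω ∈ polyForms l p)
    (h2 : wedge l p (dFun (algebraMap (S l) (K l) q)) ω ∈ polyForms l (p + 1)) :
    ω ∈ lattice (coordBasis _ hM) p := by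
  rw [mem_lattice_iff]
  intro I
  rw [exteriorPower_repr_eq_evalForm]
  set θ : Fin p → Fin l → S l := fun j => M (Set.powersetCard.ofFinEmbEquiv.symm I j) with hθ
  change evalForm (fun j n => algebraMap (S l) (K l) (θ j n)) ω ∈ polys l
  have hpoly : ∀ {p' : ℕ} (θ' : Fin p' → Fin l → S l), ∀ i j,
      (fun j n => algebraMap (S l) (K l) (θ' j n)) i j ∈ polys l :=
    fun θ' i j => algebraMap_mem_polys _
  obtain ⟨s, hs⟩ := evalForm_mem_polys (hpoly θ) h1
  rw [map_smul, smul_eq_mul] at hs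
  have hq' := algebraMap_ne_zero hq
  obtain ⟨t, rfl⟩ : q ∣ s := by
    refine hsq s fun n => ?_
    let θ' : Fin (p + 1) → Fin l → S l := Fin.cons (Pi.single n 1) θ
    have h3 := evalForm_wedge (fun j r => algebraMap (S l) (K l) (θ' j r))
      (dFun (algebraMap (S l) (K l) q)) (algebraMap (S l) (K l) q • ω)
    rw [Fin.sum_univ_succ, map_smul, map_smul, smul_eq_mul] at h3
    have h4 : pairing (fun r => algebraMap (S l) (K l) (θ' 0 r))
        (dFun (algebraMap (S l) (K l) q)) = algebraMap (S l) (K l) (pderiv n q) := by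
      rw [pairing_dFun]
      congr 1
      simp [θ', Pi.single_apply]
    have h5 : evalForm (fun i r => algebraMap (S l) (K l) (θ' ((0 : Fin (p + 1)).succAbove i) r))
        (algebraMap (S l) (K l) q • ω) = algebraMap (S l) (K l) s := by
      rw [hs, map_smul, smul_eq_mul]
      simp only [θ', Fin.zero_succAbove, Fin.cons_succ]
    choose u hu using hu
    have h6 : ∀ j : Fin p, pairing (fun r => algebraMap (S l) (K l) (θ' j.succ r))
        (dFun (algebraMap (S l) (K l) q)) = algebraMap (S l) (K l) q *
          algebraMap (S l) (K l) (u (Set.powersetCard.ofFinEmbEquiv.symm I j)) := by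
      intro j
      rw [pairing_dFun, ← map_mul, ← hu]
      simp only [θ', Fin.cons_succ, hθ]
    refine dvd_of_eq_mul_mem_polys (t := evalForm (fun j r => algebraMap (S l) (K l) (θ' j r))
      (wedge l p (dFun (algebraMap (S l) (K l) q)) ω) -
      ∑ j : Fin p, (-1) ^ ((j.succ : Fin (p + 1)) : ℕ) *
        algebraMap (S l) (K l) (u (Set.powersetCard.ofFinEmbEquiv.symm I j)) *
        evalForm (fun i r => algebraMap (S l) (K l) (θ' (j.succ.succAbove i) r))
          (algebraMap (S l) (K l) q • ω)) ?_ ?_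
    · refine sub_mem (evalForm_mem_polys (hpoly _) h2) (sum_mem fun j _ => mul_mem (mul_mem ?_
        (algebraMap_mem_polys _)) (evalForm_mem_polys (hpoly _) h1))
      exact pow_mem (neg_mem (one_mem _)) _
    · rw [mul_sub, h3, h4, h5, map_mul, Fin.val_zero, pow_zero, one_mul, Finset.mul_sum,
        eq_comm, sub_eq_iff_eq_add]
      congr 1
      refine Finset.sum_congr rfl fun j _ => ?_
      rw [h6]
      ring
  rw [map_mul] at hs
  rw [← mul_left_cancel₀ hq' hs]
  exact algebraMap_mem_polys t

theorem logForms_eq_lattice {q : S l} (hq : q ≠ 0) {c : ℝ} {M : Matrix (Fin l) (Fin l) (S l)}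
    (hM : IsUnit (M.map (algebraMap (S l) (K l))).det) (hc : c ≠ 0) (hdet : M.det = C c * q)
    (hu : ∀ i, q ∣ ∑ n, M i n * pderiv n q)
    (hsq : ∀ s, (∀ n, q ∣ pderiv n q * s) → q ∣ s) (p : ℕ) :
    logForms q p = lattice (coordBasis _ hM) p :=
  Set.ext fun _ => (mem_logForms_iff hq).trans
    ⟨fun h => mem_lattice_of_wedge_mem_polyForms hq hM hu hsq h.1 h.2,
      fun h => wedge_mem_polyForms_of_mem_lattice hM hc hdet hu h⟩

/-! ### The forms `d̂f` -/

theorem derivation_algebraMap (D : Derivation ℝ (K l) (K l)) (f : S l) :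
    D (algebraMap (S l) (K l) f) =
      ∑ r, algebraMap (S l) (K l) (pderiv r f) * D (algebraMap (S l) (K l) (X r)) := by
  induction f using MvPolynomial.induction_on with
  | C a =>
    have h : algebraMap (S l) (K l) (C a) = algebraMap ℝ (K l) a := by
      rw [← algebraMap_eq, ← IsScalarTower.algebraMap_apply]
    simp [h]
  | add f h hf hh => simp only [map_add, hf, hh, add_mul, Finset.sum_add_distrib]
  | mul_X f i hf =>
    simp only [map_mul, Derivation.leibniz, hf, pderiv_X, smul_eq_mul, map_add, add_mul,
      Finset.sum_add_distrib, Finset.mul_sum]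
    congr 1
    · rw [Finset.sum_eq_single i]
      · simp
      · intro j _ hj; simp [hj.symm]
      · simp
    · exact Finset.sum_congr rfl fun r _ => (mul_assoc _ _ _).symm

theorem eq_coordBasis {M : Matrix (Fin l) (Fin l) (K l)} (hM : IsUnit M.det) {v : Form1 l}
    {j : Fin l} (h : M.mulVec v = Pi.single j 1) : v = coordBasis M hM j := by
  refine (coordBasis M hM).repr.injective (Finsupp.ext fun i => ?_)
  rw [coordBasis_repr, coordBasis_repr, mulVec_coordBasis, h]

/-- Both sides take the same values on the `g_j`, and `Jᵀ` is injective over the fraction field. -/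
theorem mul_derivation_X_eq {q : S l} {g : Fin l → S l} {k : Fin l} {θ : Fin l → S l}
    (hθ : IsPrimitiveField q g k θ) (hdet : (jac g).det ≠ 0) {D : Derivation ℝ (K l) (K l)}
    (hk : D (algebraMap (S l) (K l) (g k)) = 1)
    (hD : ∀ i, i ≠ k → D (algebraMap (S l) (K l) (g i)) = 0) (r : Fin l) :
    algebraMap (S l) (K l) q * D (algebraMap (S l) (K l) (X r)) =
      algebraMap (S l) (K l) (θ r) := by
  have h : (fun r => algebraMap (S l) (K l) q * D (algebraMap (S l) (K l) (X r)) -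
      algebraMap (S l) (K l) (θ r)) = 0 := by
    refine Matrix.eq_zero_of_mulVec_eq_zero
      (M := (jac g).transpose.map (algebraMap (S l) (K l))) ?_ (funext fun j => ?_)
    · have h1 := (algebraMap (S l) (K l)).map_det (jac g).transpose
      rw [RingHom.mapMatrix_apply] at h1
      rw [← h1, Matrix.det_transpose]
      exact algebraMap_ne_zero hdet
    · change ∑ r, algebraMap (S l) (K l) (pderiv r (g j)) * (algebraMap (S l) (K l) q *
        D (algebraMap (S l) (K l) (X r)) - algebraMap (S l) (K l) (θ r)) = 0
      have h1 := congrArg (algebraMap (S l) (K l)) (hθ j)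
      simp only [map_sum, map_mul] at h1
      simp only [mul_sub, Finset.sum_sub_distrib, h1, mul_left_comm, ← Finset.mul_sum]
      rw [← derivation_algebraMap]
      split_ifs with hj
      · rw [hj, hk, mul_one, sub_self]
      · rw [hD j hj, mul_zero, map_zero, sub_self]
  exact sub_eq_zero.1 (congrFun h r)

theorem dHat_apply {q : S l} {D : Derivation ℝ (K l) (K l)} {θ : Fin l → S l}
    (hθ : ∀ r, algebraMap (S l) (K l) q * D (algebraMap (S l) (K l) (X r)) =
      algebraMap (S l) (K l) (θ r)) (f : Fin l → S l) (j n : Fin l) :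
    dHat q D (f j) n = algebraMap (S l) (K l) ((fieldDeriv θ * jac f) n j) := by
  rw [dHat, Finset.sum_apply, Matrix.mul_apply, map_sum]
  refine Finset.sum_congr rfl fun r _ => ?_
  rw [Pi.smul_apply, hθ, dFun_apply, partialD_algebraMap, smul_eq_mul, ← map_mul, mul_comm]
  rfl

/-- Both Jacobian determinants are nonzero constants times `Q`, so `det P` is constant. -/
theorem exists_jac_eq_mul {W : Subgroup (V l ≃ₗᵢ[ℝ] V l)} [Finite W]
    {α : Submodule ℝ (V l) → Module.Dual ℝ (V l)} (hα : IsDefining W α) {f g : Fin l → S l}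
    (hf : IsBasicInvariants W f) (hg : IsBasicInvariants W g) :
    ∃ P : Matrix (Fin l) (Fin l) (S l), IsUnit P.det ∧ jac f = jac g * P := by
  choose P hP using fun j => grad_mem_range_jac hg (hf.mem j)
  have h : jac f = jac g * (Matrix.of P).transpose := by
    ext1 n j
    exact (congrFun (hP j) n).symm
  refine ⟨_, ?_, h⟩
  obtain ⟨c, hc, h1⟩ := exists_det_jac_eq hα hf
  obtain ⟨c', hc', h2⟩ := exists_det_jac_eq hα hg
  have h3 := congrArg Matrix.det h
  rw [Matrix.det_mul, h1, h2, mul_right_comm] at h3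
  have h4 := mul_right_cancel₀ (Q_ne_zero hα) h3
  exact isUnit_of_mul_isUnit_right (h4 ▸ (IsUnit.mk0 c hc).map C)

theorem hatForm_eq {q : S l} {D : Derivation ℝ (K l) (K l)} {f : Fin l → S l}
    {b : Fin l → Form1 l} (h : ∀ j, (algebraMap (S l) (K l) q)⁻¹ • dHat q D (f j) = b j) (p : ℕ) :
    hatForm q D f p = exteriorPower.ιMulti_family (K l) p b := by
  ext1 I
  have h1 := (exteriorPower.ιMulti (K l) p).map_smul_univ
    (fun _ => (algebraMap (S l) (K l) q)⁻¹)
    (fun i => dHat q D (f (Set.powersetCard.ofFinEmbEquiv.symm I i)))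
  rw [Finset.prod_const, Finset.card_univ, Fintype.card_fin, inv_pow] at h1
  simp only [h] at h1
  exact h1.symm

end CoxeterLog

/-! ### The main theorem -/

theorem corollary6 (l : ℕ) (hl : 2 ≤ l)
    (W : Subgroup (V l ≃ₗᵢ[ℝ] V l)) (hW : IsFiniteCoxeterGroup W)
    (α : Submodule ℝ (V l) → Module.Dual ℝ (V l))
    (hα : ∀ H ∈ arrangement W, LinearMap.ker (α H) = H)
    (D : Derivation ℝ (K l) (K l)) (hD : IsSaitoDerivation W D)
    (f : Fin l → S l) (hf : IsBasicInvariants W f)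
    (p : ℕ) (hp : p ≤ l) :
    LinearIndependent (S l) (hatForm (Q W α) D f p) ∧
    (Submodule.span (S l) (Set.range (hatForm (Q W α) D f p)) :
      Set (Form l p)) = logForms (Q W α) p := by
  have := hW.finite
  have hα : IsDefining W α := hα
  obtain ⟨g, k, hg, hk, hDk, hD⟩ := hD
  have hq := Q_ne_zero hα
  have hq' := algebraMap_ne_zero hq
  have hdet := det_jac_ne_zero hα hg
  obtain ⟨m, hm⟩ := hg.exists_isHomogeneous_succ hW hl hdet
  obtain ⟨θ, hθ, -⟩ := exists_isPrimitiveField hα hg hm k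
  obtain ⟨U, hU⟩ := exists_mul_fieldDeriv_mul_eq hα hg hθ
  have hUu := isUnit_det_of_mul_fieldDeriv_mul_eq hW hl hα hg hk hθ hU
  obtain ⟨A, hA, hfA⟩ := exists_jac_eq_mul hα hf hg
  obtain ⟨c, hc, hcQ⟩ := exists_det_jac_eq hα hg
  set φ := algebraMap (S l) (K l) with hφ
  set M := (jac g).transpose with hMdef
  have hM : IsUnit (M.map φ).det := by
    have h1 := φ.map_det M
    rw [RingHom.mapMatrix_apply] at h1
    rw [← h1, hMdef, Matrix.det_transpose]
    exact (algebraMap_ne_zero hdet).isUnit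
  have hP : IsUnit (U * A).det := by
    rw [Matrix.det_mul]
    exact hUu.mul hA
  set P := U * A with hPdef
  have hPP : P⁻¹.map φ * P.map φ = 1 := by
    rw [← Matrix.map_mul, Matrix.nonsing_inv_mul _ hP, Matrix.map_one _ (map_zero _) (map_one _)]
  have hPP' : P.map φ * P⁻¹.map φ = 1 := mul_eq_one_comm.1 hPP
  have hM' : IsUnit (P⁻¹.map φ * M.map φ).det := by
    rw [Matrix.det_mul]
    exact (Matrix.isUnit_det_of_right_inverse hPP).mul hM
  have hdHat := dHat_apply (mul_derivation_X_eq hθ hdet hDk hD) f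
  -- `Jᵀ B (jac f) = JᵀBJ A = Q·UA`, so `Jᵀ` sends `Q⁻¹ d̂f_j` to column `j` of `P`, and `P⁻¹Jᵀ`
  -- sends it to the standard vector.
  have hb : ∀ j, (φ (Q W α))⁻¹ • dHat (Q W α) D (f j) = coordBasis _ hM' j := by
    intro j
    refine eq_coordBasis hM' ?_
    have h1 : (M.map φ).mulVec (dHat (Q W α) D (f j)) = φ (Q W α) • (P.map φ).col j := by
      have h2 : M * (fieldDeriv θ * jac f) = Q W α • P := by
        rw [hfA, ← mul_assoc, ← mul_assoc, hU, hPdef, smul_mul_assoc]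
      ext1 i
      have h3 := congrArg φ (congrFun (congrFun h2 i) j)
      rw [Matrix.mul_apply, map_sum, Matrix.smul_apply, smul_eq_mul, map_mul] at h3
      rw [Pi.smul_apply, smul_eq_mul]
      refine Eq.trans ?_ h3
      change ∑ n, φ (M i n) * dHat (Q W α) D (f j) n = _
      exact Finset.sum_congr rfl fun n _ => by rw [hdHat, map_mul]
    rw [Matrix.mulVec_smul, ← Matrix.mulVec_mulVec, h1, Matrix.mulVec_smul, inv_smul_smul₀ hq']
    ext1 i
    have h4 := congrFun (congrFun hPP i) j
    rw [Matrix.one_apply] at h4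
    rw [Pi.single_apply, ← h4]
    rfl
  rw [hatForm_eq hb p]
  constructor
  · have h := ((coordBasis _ hM').exteriorPower p).linearIndependent
    rw [exteriorPower.coe_basis] at h
    -- Independence over the fraction field restricts to `S`.
    refine h.restrict_scalars fun a b hab => ?_
    simp only [Algebra.smul_def, mul_one] at hab
    exact IsFractionRing.injective (S l) (K l) hab
  · rw [logForms_eq_lattice hq hM hc (by rw [hMdef, Matrix.det_transpose, hcQ])
      (fun i => Q_dvd hα fun H hH => lin_dvd_of_act_refl_eq_neg ?_)
      (fun s => Q_dvd_of_dvd_pderiv_mul hα) p]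
    -- `P` and `P⁻¹` are both polynomial, so the coordinates `Jᵀ` and `P⁻¹Jᵀ` define the same
    -- lattice.
    · refine congrArg _ (le_antisymm
        (lattice_coordBasis_le hM' hM (U := P) ?_ p) (lattice_coordBasis_le hM hM' rfl p))
      rw [← mul_assoc, hPP', one_mul]
    -- `∇g_i·∇Q` is anti-invariant, hence divisible by `Q`: the gradients of invariants are tangent
    -- to the arrangement.
    · have h := act_sum_pderiv_mul_pderiv (e := -1) (fun n => by simp)
        (hg.act_eq (hα.refl_mem hH) i) (h := Q W α) (by
          rw [act_refl_Q hα hg (hα.normalVec_ne_zero hH) (hα.refl_mem hH), neg_one_mul])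
      rw [neg_one_mul] at h
      exact h
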